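/- Let $\mathrm{Herm}(n)$ be the real vector space of $n\times n$ complex Hermitian matrices, with the Lebesgue measure $dA=\prod_{j} dA_{jj}\prod_{j<k} d\,\mathrm{Re}A_{jk}\, d\,\mathrm{Im}A_{jk}$, and let $\Delta_n(x)=\prod_{j<k}(x_k-x_j)$. For measurable functions $w_1,\dots,w_n:\mathbb R\to\mathbb R$ and a random Hermitian matrix $A$, write $A\sim PE(w_1,\dots,w_n)$ if, for some constant $Z\neq 0$, the function $$\frac1Z\,\Delta_n(x)\,\det\bigl[w_k(x_j)\bigr]_{j,k=1}^n,\qquad x\in\mathbb R^n,$$ is nonnegative almost everywhere and is the probability density on $\mathbb R^n$ of the eigenvalues of $A$ (listed in uniformly random order). Let $X$ be a random $n\times n$ Hermitian matrix whose law is invariant under $X\mapsto UXU^*$ for every unitary $U$, and suppose that $X\sim PE(f_1,\dots,f_n)$ for certain measurable functions $f_1,\dots,f_n$. Let $\alpha>-1$, and let $L$ be an $n\times n$ LUE (Laguerre Unitary Ensemble) matrix with parameter $\alpha$, independent of $X$; that is, $L$ has the probability density $$\frac{(\det L)^{\alpha}}{\pi^{n(n-1)/2}\prod_{j=1}^n\Gamma(\alpha+j)}\,e^{-\mathrm{Tr}\,L}$$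 on the positive definite Hermitian matrices. Then $X+L\sim PE(g_1,\dots,g_n)$, where $$g_k(y)=\int_0^\infty x^{\alpha+n-1}e^{-x}f_k(y-x)\,dx,\qquad k=1,\dots,n,$$ and for each $k$ the integral converges absolutely for almost every $y\in\mathbb R$. -/

import Mathlib

open MeasureTheory ProbabilityTheory
open scoped ENNReal Nat ComplexOrder

noncomputable section

namespace PolyEns

/-- The real vector space `Herm(n)` of `n × n` complex Hermitian matrices. -/
abbrev Herm (n : ℕ) : Type := selfAdjoint (Matrix (Fin n) (Fin n) ℂ)

/-- `Herm(n)` carries its Borel `σ`-algebra. -/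
instance instMeasurableSpaceHerm (n : ℕ) : MeasurableSpace (Herm n) := borel _

instance instBorelSpaceHerm (n : ℕ) : BorelSpace (Herm n) := ⟨rfl⟩

/-- The Hermitian matrix with prescribed real diagonal entries and prescribed complex entries
strictly above the diagonal. -/
def hermOfCoords {n : ℕ}
    (p : (Fin n → ℝ) × ({q : Fin n × Fin n // q.1 < q.2} → ℂ)) : Herm n :=
  ⟨Matrix.of fun j k =>
      if h : j < k then p.2 ⟨(j, k), h⟩
      else if h : k < j then star (p.2 ⟨(k, j), h⟩)
      else (p.1 j : ℂ), by
    rw [selfAdjoint.mem_iff]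
    ext j k
    rw [Matrix.star_apply]
    rcases lt_trichotomy j k with h | h | h
    · simp [h, h.not_gt]
    · subst h
      simp
    · simp [h, h.not_gt]⟩

/-- The flat Lebesgue measure `dX = ∏ⱼ dXⱼⱼ ∏_{j<k} d(Re Xⱼₖ) d(Im Xⱼₖ)` on `Herm(n)`; the
standard volume of `ℂ` is `d(Re z) d(Im z)`. -/
def hermVolume (n : ℕ) : Measure (Herm n) :=
  Measure.map hermOfCoords volume

/-- The matrix `U A U*`, for `U` unitary and `A` Hermitian. -/
def conjBy {n : ℕ} (U : Matrix.unitaryGroup (Fin n) ℂ) (A : Herm n) : Herm n :=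
  ⟨(U : Matrix (Fin n) (Fin n) ℂ) * (A : Matrix (Fin n) (Fin n) ℂ) *
      star (U : Matrix (Fin n) (Fin n) ℂ), A.2.conjugate _⟩

/-- The vector of eigenvalues of a Hermitian matrix, with multiplicities. -/
def eigs {n : ℕ} (A : Herm n) : Fin n → ℝ :=
  Matrix.IsHermitian.eigenvalues (A := (A : Matrix (Fin n) (Fin n) ℂ)) A.2

/-- The law on `ℝⁿ` of the eigenvalues of the random Hermitian matrix `X`, the eigenvalues being
listed in a uniformly random order: the symmetric measure that carries the joint law of the
unordered eigenvalues. -/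
def eigenvalueLaw {Ω : Type*} [MeasurableSpace Ω] {n : ℕ} (P : Measure Ω) (X : Ω → Herm n) :
    Measure (Fin n → ℝ) :=
  ((n ! : ℝ≥0∞)⁻¹) •
    ∑ σ : Equiv.Perm (Fin n), Measure.map (fun ω => fun j => eigs (X ω) (σ j)) P

/-- The Vandermonde product `Δₙ(x) = ∏_{j<k} (xₖ - xⱼ)`. -/
def vandermondeProd {n : ℕ} (x : Fin n → ℝ) : ℝ :=
  ∏ j : Fin n, ∏ k ∈ Finset.Ioi j, (x k - x j)

/-- The function `Z⁻¹ Δₙ(x) det [wₖ(xⱼ)]` on `ℝⁿ`. -/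
def peDensity {n : ℕ} (Z : ℝ) (w : Fin n → ℝ → ℝ) (x : Fin n → ℝ) : ℝ :=
  Z⁻¹ * vandermondeProd x * (Matrix.of fun j k : Fin n => w k (x j)).det

/-- `X ∼ PE(w₁, …, wₙ)`: for some normalization constant `Z`, the function
`Z⁻¹ Δₙ(x) det [wₖ(xⱼ)]` is a.e. nonnegative and is the density of the eigenvalues of the random
Hermitian matrix `X`. (That its integral is `1` is part of the last clause when `P` is a
probability measure.) -/
def IsPE {Ω : Type*} [MeasurableSpace Ω] {n : ℕ} (P : Measure Ω) (X : Ω → Herm n)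
    (w : Fin n → ℝ → ℝ) : Prop :=
  (∀ k, Measurable (w k)) ∧
    ∃ Z : ℝ, Z ≠ 0 ∧ (∀ᵐ x : Fin n → ℝ, 0 ≤ peDensity Z w x) ∧
      eigenvalueLaw P X = volume.withDensity fun x => ENNReal.ofReal (peDensity Z w x)

/-- The law of the random Hermitian matrix `X` is invariant under unitary conjugation. -/
def UnitarilyInvariant {Ω : Type*} [MeasurableSpace Ω] {n : ℕ} (P : Measure Ω)
    (X : Ω → Herm n) : Prop :=
  ∀ U : Matrix.unitaryGroup (Fin n) ℂ,
    Measure.map (fun ω => conjBy U (X ω)) P = Measure.map X P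

open Classical in
/-- The density of the Laguerre Unitary Ensemble with parameter `α`,
`(det L)^α e^{-Tr L} / (π^{n(n-1)/2} ∏_{j=1}^n Γ(α + j))` on the positive definite matrices, and
`0` elsewhere. -/
def lueDensity (n : ℕ) (α : ℝ) (L : Herm n) : ℝ :=
  if (L : Matrix (Fin n) (Fin n) ℂ).PosDef then
    (L : Matrix (Fin n) (Fin n) ℂ).det.re ^ α /
        (Real.pi ^ (n * (n - 1) / 2) * ∏ j ∈ Finset.Icc 1 n, Real.Gamma (α + j)) *
      Real.exp (-(L : Matrix (Fin n) (Fin n) ℂ).trace.re)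
  else 0

/-- The law of the Laguerre Unitary Ensemble with parameter `α`. -/
def lueLaw (n : ℕ) (α : ℝ) : Measure (Herm n) :=
  (hermVolume n).withDensity fun L => ENNReal.ofReal (lueDensity n α L)

/-- The function `y ↦ ∫₀^∞ x^{α+n-1} e^{-x} f(y - x) dx`. -/
def lueTransform (n : ℕ) (α : ℝ) (f : ℝ → ℝ) (y : ℝ) : ℝ :=
  ∫ x in Set.Ioi (0 : ℝ), x ^ (α + n - 1) * Real.exp (-x) * f (y - x)

end PolyEns

end

/-!
Let `γ_b` be the density of the Gamma distribution of shape `b`. For a deterministic increasing `x`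
and an LUE matrix `L` of size `n` with parameter `α`, the increasingly ordered eigenvalues of
`diag(x) + L` have the density

  `Δₙ(y) / Δₙ(x) · det [γ_{α+n}(yⱼ - xₖ)]`

on the Weyl chamber `y₁ < ⋯ < yₙ` (`lintegral_sortedEigs_diagHerm_add`). Everything else is soft:
`L` is unitarily invariant, so the spectrum of `X + L` depends on `X` through its spectrum only, and
averaging the kernel above against the density `Z⁻¹ Δₙ(x) det [fₖ(xⱼ)]` cancels `Δₙ(x)` and leaves,
by Andréief's identity (`integral_det_mul_kernelDet`), a multiple of
`Δₙ(y) det [(γ_{α+n} * fₖ)(yⱼ)]`.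

The formula for `diag(x) + L` holds by induction on `n`. By the Schur complement, an LUE matrix of
size `n + 1` is made of a Gamma variable `ℓ`, a complex Gaussian vector `u` and an LUE matrix `W` of
size `n`, all independent (`lintegral_lueLaw_succ`). Put `x = (x₀, x')`. After diagonalization of
`diag(x') + W`, with eigenvalues `w`, the matrix `diag(x) + L` is a rank one perturbation of
`diag(x₀, w)` by a vector whose entries have squared moduli `ℓ` and `rᵢ`, where the `rᵢ` are
independent exponential variables (`charpoly_blockHerm_diag`, `lintegral_gauss_sortedEigs`). Its
eigenvalues `y` interlace with the nodes `(x₀, w)`, and the passage from the weights `(ℓ, r)` to `y`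
is a bijection whose Jacobian is a Cauchy determinant
(`lintegral_weights_eq_lintegral_interlaces`). The density in `w` is known by induction. Its
integral over the box of all `w` that interlace with `y` is the determinant of one-dimensional
integrals with elementary antiderivatives, and row operations turn it into the determinant of
size `n + 1` (`lintegral_chamberDensity_step`).

The absolute convergence of the integrals follows from the integrability of each `fₖ`
(`integrable_of_integrable_peProd`): by Fubini, almost every section of `Δₙ(x) det [fₖ(xⱼ)]` in one
coordinate is integrable. By Cramer's rule, `fₖ` is then integrable away from the coordinates of a
generic point, and two generic points remove the exceptions.
-/

noncomputable section

namespace PolyEns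

/-! ### Vandermonde products and the secular equation -/

section Secular

variable {n : ℕ}

lemma vandermondeProd_eq_det (x : Fin n → ℝ) :
    vandermondeProd x = (Matrix.vandermonde x).det :=
  (Matrix.det_vandermonde x).symm

lemma vandermondeProd_pos {x : Fin n → ℝ} (hx : StrictMono x) : 0 < vandermondeProd x :=
  Finset.prod_pos fun _ _ => Finset.prod_pos fun _ hk => sub_pos.2 (hx (Finset.mem_Ioi.1 hk))

lemma vandermondeProd_cons (x₀ : ℝ) (x : Fin n → ℝ) :
    vandermondeProd (Fin.cons x₀ x : Fin (n + 1) → ℝ) =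
      (∏ k, (x k - x₀)) * vandermondeProd x := by
  rw [vandermondeProd, Fin.prod_univ_succ]
  simp only [Fin.prod_Ioi_zero, Fin.cons_succ, Fin.cons_zero, Fin.prod_Ioi_succ]
  rfl

lemma vandermondeProd_comp_perm (x : Fin n → ℝ) (σ : Equiv.Perm (Fin n)) :
    vandermondeProd (x ∘ σ) = (Equiv.Perm.sign σ : ℤ) * vandermondeProd x := by
  rw [vandermondeProd_eq_det, vandermondeProd_eq_det, ← Matrix.det_permute]
  rfl

lemma abs_prod_prod_erase_sub (x : Fin n → ℝ) :
    |∏ i, ∏ k ∈ Finset.univ.erase i, (x i - x k)| = vandermondeProd x ^ 2 := by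
  have h := Finset.prod_prod_Ioi_mul_eq_prod_prod_off_diag (fun i k : Fin n => x k - x i)
  have e : ∀ i : Fin n, (Finset.univ.erase i) = ({i}ᶜ : Finset (Fin n)) := fun i => by
    ext; simp
  simp_rw [e]
  rw [← h, vandermondeProd, ← Finset.prod_pow, Finset.abs_prod]
  refine Finset.prod_congr rfl fun i _ => ?_
  rw [← Finset.prod_pow, Finset.abs_prod]
  refine Finset.prod_congr rfl fun k _ => ?_
  rw [show (x i - x k) * (x k - x i) = -(x k - x i) ^ 2 by ring, abs_neg, abs_sq]

/-- Evaluating polynomials of degree less than `n` at `n` points multiplies the coefficient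
matrix by the Vandermonde matrix of the points. -/
lemma det_eval_eq_vandermonde_mul (x : Fin n → ℝ) (q : Fin n → Polynomial ℝ)
    (hq : ∀ j, (q j).natDegree < n) :
    (Matrix.of fun i j => (q j).eval (x i)).det =
      vandermondeProd x * (Matrix.of fun a j : Fin n => (q j).coeff a).det := by
  rw [vandermondeProd_eq_det, ← Matrix.det_mul]
  congr 1
  ext i j
  simp only [Matrix.of_apply, Matrix.mul_apply, Matrix.vandermonde_apply]
  rw [Polynomial.eval_eq_sum_range' (hq j), Finset.sum_range]
  exact Finset.sum_congr rfl fun _ _ => mul_comm _ _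

/-- A form of Cauchy's determinant, obtained by evaluating the same coefficient determinant at the
points `x` and at the points `y`, where the matrix is diagonal. -/
lemma det_prod_erase_mul_vandermonde (x y : Fin n → ℝ) :
    (Matrix.of fun i j => ∏ k ∈ Finset.univ.erase j, (x i - y k)).det * vandermondeProd y =
      vandermondeProd x * ∏ j, ∏ k ∈ Finset.univ.erase j, (y j - y k) := by
  set q : Fin n → Polynomial ℝ := fun j =>
    ∏ k ∈ Finset.univ.erase j, (Polynomial.X - Polynomial.C (y k))
  have hq : ∀ j, (q j).natDegree < n := fun j => by
    rw [Polynomial.natDegree_finsetProd_X_sub_C_eq_card, Finset.card_erase_of_mem (Finset.mem_univ j),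
      Finset.card_univ, Fintype.card_fin]
    exact Nat.sub_lt (Fin.pos j) one_pos
  have he : ∀ (z : Fin n → ℝ), (Matrix.of fun i j => ∏ k ∈ Finset.univ.erase j, (z i - y k)) =
      (Matrix.of fun i j => (q j).eval (z i)) := fun z => by
    ext i j
    simp [q, Polynomial.eval_prod]
  have hd : (Matrix.of fun i j => ∏ k ∈ Finset.univ.erase j, (y i - y k)).det =
      ∏ j, ∏ k ∈ Finset.univ.erase j, (y j - y k) := by
    rw [← Matrix.det_diagonal]
    congr 1
    ext i j
    by_cases h : i = j
    · subst h; simp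
    · rw [Matrix.diagonal_apply_ne _ h, Matrix.of_apply]
      exact Finset.prod_eq_zero (i := i) (by simp [h]) (sub_self _)
  rw [← hd, he x, he y, det_eval_eq_vandermonde_mul x q hq, det_eval_eq_vandermonde_mul y q hq]
  ring

/-- The characteristic polynomial `∏ᵢ (X - ξᵢ) - ∑ᵢ rᵢ ∏_{k ≠ i} (X - ξₖ)` of a rank one
perturbation of `diag(ξ)` by a vector whose entries have squared moduli `rᵢ`. -/
def secularPoly (ξ r : Fin n → ℝ) : Polynomial ℝ :=
  ∏ i, (Polynomial.X - Polynomial.C (ξ i)) -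
    ∑ i, Polynomial.C (r i) * ∏ k ∈ Finset.univ.erase i, (Polynomial.X - Polynomial.C (ξ k))

/-- The weights `rᵢ` for which the secular polynomial at the nodes `ξ` has the roots `y`. -/
def secularWeight (ξ y : Fin n → ℝ) (i : Fin n) : ℝ :=
  -(∏ j, (ξ i - y j)) / ∏ k ∈ Finset.univ.erase i, (ξ i - ξ k)

/-- Strict interlacing `ξ₁ < y₁ < ξ₂ < y₂ < ⋯ < ξₙ < yₙ`. -/
def Interlaces (ξ y : Fin n → ℝ) : Prop :=
  (∀ i, ξ i < y i) ∧ ∀ i k, i < k → y i < ξ k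

lemma Interlaces.strictMono_left {ξ y : Fin n → ℝ} (h : Interlaces ξ y) : StrictMono ξ :=
  fun i k hik => (h.1 i).trans (h.2 i k hik)

lemma Interlaces.strictMono_right {ξ y : Fin n → ℝ} (h : Interlaces ξ y) : StrictMono y :=
  fun i k hik => (h.2 i k hik).trans (h.1 k)

lemma prod_erase_sub_ne_zero {ξ : Fin n → ℝ} (hξ : Function.Injective ξ) (i : Fin n) :
    ∏ k ∈ Finset.univ.erase i, (ξ i - ξ k) ≠ 0 :=
  Finset.prod_ne_zero_iff.2 fun k hk => sub_ne_zero.2 fun h =>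
    (Finset.mem_erase.1 hk).1 (hξ h).symm

lemma eval_secularPoly (ξ r : Fin n → ℝ) (z : ℝ) : (secularPoly ξ r).eval z =
    ∏ i, (z - ξ i) - ∑ i, r i * ∏ k ∈ Finset.univ.erase i, (z - ξ k) := by
  simp [secularPoly, Polynomial.eval_prod, Polynomial.eval_finsetSum]

lemma eval_secularPoly_node (ξ r : Fin n → ℝ) (i : Fin n) : (secularPoly ξ r).eval (ξ i) =
    -(r i * ∏ k ∈ Finset.univ.erase i, (ξ i - ξ k)) := by
  rw [eval_secularPoly, Finset.prod_eq_zero (Finset.mem_univ i) (sub_self _), zero_sub,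
    Finset.sum_eq_single i]
  · intro j _ hj
    rw [Finset.prod_eq_zero (i := i) (by simp [hj.symm]) (sub_self _), mul_zero]
  · simp

lemma degree_secularPoly_sub_lt (ξ r y : Fin n → ℝ) :
    (secularPoly ξ r - ∏ j, (Polynomial.X - Polynomial.C (y j))).degree < (n : WithBot ℕ) := by
  have h1 : (∏ i, (Polynomial.X - Polynomial.C (ξ i)) -
      ∏ j, (Polynomial.X - Polynomial.C (y j))).degree < (n : WithBot ℕ) := by
    have hd : ∀ z : Fin n → ℝ, (∏ i, (Polynomial.X - Polynomial.C (z i))).degree = (n : WithBot ℕ) := fun z => by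
      rw [Polynomial.degree_prod]; simp
    have hm : ∀ z : Fin n → ℝ, (∏ i, (Polynomial.X - Polynomial.C (z i))).Monic := fun z =>
      Polynomial.monic_prod_of_monic _ _ fun i _ => Polynomial.monic_X_sub_C _
    have := Polynomial.degree_sub_lt_left (p := ∏ i, (Polynomial.X - Polynomial.C (ξ i)))
      (q := ∏ j, (Polynomial.X - Polynomial.C (y j))) (by rw [hd, hd]) (hm ξ).ne_zero
      (by rw [(hm ξ).leadingCoeff, (hm y).leadingCoeff])
    rwa [hd] at this
  have h2 : (∑ i, Polynomial.C (r i) *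
      ∏ k ∈ Finset.univ.erase i, (Polynomial.X - Polynomial.C (ξ k))).degree < (n : WithBot ℕ) := by
    rw [← Polynomial.mem_degreeLT]
    refine Submodule.sum_mem _ fun i _ => ?_
    rw [Polynomial.mem_degreeLT]
    refine (Polynomial.degree_mul_le _ _).trans_lt ?_
    have : (∏ k ∈ Finset.univ.erase i, (Polynomial.X - Polynomial.C (ξ k))).degree < (n : WithBot ℕ) := by
      rw [Polynomial.degree_prod]
      simp only [Polynomial.degree_X_sub_C, Finset.sum_const, Finset.card_erase_of_mem
        (Finset.mem_univ i), Finset.card_univ, Fintype.card_fin, nsmul_one]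
      exact_mod_cast Nat.sub_lt (Fin.pos i) one_pos
    calc _ ≤ 0 + (∏ k ∈ Finset.univ.erase i, (Polynomial.X - Polynomial.C (ξ k))).degree := by
          gcongr; exact Polynomial.degree_C_le
      _ < (n : WithBot ℕ) := by rwa [zero_add]
  rw [secularPoly, sub_right_comm]
  exact (Polynomial.degree_sub_le _ _).trans_lt (max_lt h1 h2)

/-- Both polynomials are monic of degree `n`, so agreement at `n` points suffices. -/
lemma secularPoly_eq_of_eval {ξ r y z : Fin n → ℝ} (hz : Function.Injective z)
    (h : ∀ i, (secularPoly ξ r).eval (z i) = ∏ j, (z i - y j)) :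
    secularPoly ξ r = ∏ j, (Polynomial.X - Polynomial.C (y j)) := by
  refine Polynomial.eq_of_degree_sub_lt_of_eval_finset_eq (Finset.univ.image z) ?_ ?_
  · rw [Finset.card_image_of_injective _ hz, Finset.card_univ, Fintype.card_fin]
    exact degree_secularPoly_sub_lt ξ r y
  · intro t ht
    obtain ⟨i, -, rfl⟩ := Finset.mem_image.1 ht
    rw [h, Polynomial.eval_prod]
    simp

lemma secularPoly_secularWeight {ξ y : Fin n → ℝ} (hξ : Function.Injective ξ) :
    secularPoly ξ (secularWeight ξ y) = ∏ j, (Polynomial.X - Polynomial.C (y j)) :=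
  secularPoly_eq_of_eval hξ fun i => by
    rw [eval_secularPoly_node, secularWeight, div_mul_cancel₀ _ (prod_erase_sub_ne_zero hξ i),
      neg_neg]

lemma secularWeight_eq_of_secularPoly_eq {ξ r y : Fin n → ℝ} (hξ : Function.Injective ξ)
    (h : secularPoly ξ r = ∏ j, (Polynomial.X - Polynomial.C (y j))) : secularWeight ξ y = r := by
  funext i
  have h1 := congrArg (Polynomial.eval (ξ i)) h
  rw [eval_secularPoly_node, Polynomial.eval_prod] at h1
  simp only [Polynomial.eval_sub, Polynomial.eval_X, Polynomial.eval_C] at h1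
  rw [secularWeight, ← h1, neg_neg, mul_div_cancel_right₀ _ (prod_erase_sub_ne_zero hξ i)]

lemma secularWeight_pos {ξ y : Fin n → ℝ} (h : Interlaces ξ y) (i : Fin n) :
    0 < secularWeight ξ y i := by
  rw [secularWeight, ← Finset.mul_prod_erase _ _ (Finset.mem_univ i), ← neg_mul, mul_div_assoc,
    ← Finset.prod_div_distrib]
  refine mul_pos (by linarith [h.1 i]) (Finset.prod_pos fun k hk => ?_)
  rcases lt_or_gt_of_ne (Finset.mem_erase.1 hk).1 with hki | hki
  · exact div_pos (sub_pos.2 (h.2 k i hki)) (sub_pos.2 (h.strictMono_left hki))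
  · exact div_pos_of_neg_of_neg (sub_neg.2 ((h.strictMono_left hki).trans (h.1 k)))
      (sub_neg.2 (h.strictMono_left hki))

/-- For positive weights the secular polynomial has a root between consecutive nodes, and one to the
right of the last node. -/
lemma exists_root_secularPoly {ξ r : Fin n → ℝ} (hξ : StrictMono ξ) (hr : ∀ i, 0 < r i)
    (i : Fin n) : ∃ t, ξ i < t ∧ (∀ k, i < k → t < ξ k) ∧ (secularPoly ξ r).eval t = 0 := by
  obtain ⟨m, rfl⟩ : ∃ m, n = m + 1 := ⟨n - 1, by have := i.pos; omega⟩
  have hcont : Continuous fun t => (secularPoly ξ r).eval t := (secularPoly ξ r).continuous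
  rcases Fin.eq_castSucc_or_eq_last i with ⟨j, rfl⟩ | rfl
  · -- the values at consecutive nodes have opposite signs
    have hlt : ξ j.castSucc < ξ j.succ := hξ j.castSucc_lt_succ
    have hne : j.castSucc ≠ j.succ := j.castSucc_lt_succ.ne
    have hsign : (secularPoly ξ r).eval (ξ j.castSucc) * (secularPoly ξ r).eval (ξ j.succ) < 0 := by
      rw [eval_secularPoly_node, eval_secularPoly_node,
        ← Finset.mul_prod_erase (Finset.univ.erase j.castSucc) _
          (Finset.mem_erase.2 ⟨hne.symm, Finset.mem_univ _⟩),
        ← Finset.mul_prod_erase (Finset.univ.erase j.succ) _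
          (Finset.mem_erase.2 ⟨hne, Finset.mem_univ _⟩), Finset.erase_right_comm (a := j.succ)]
      have hp : 0 < ∏ k ∈ (Finset.univ.erase j.castSucc).erase j.succ,
          ((ξ j.castSucc - ξ k) * (ξ j.succ - ξ k)) := by
        refine Finset.prod_pos fun k hk => ?_
        obtain ⟨hk1, hk2, -⟩ := by simpa only [Finset.mem_erase] using hk
        rcases lt_or_gt_of_ne hk2 with h | h
        · exact mul_pos (sub_pos.2 (hξ h)) (sub_pos.2 (hξ (h.trans j.castSucc_lt_succ)))
        · have h' : j.succ < k := lt_of_le_of_ne (Fin.castSucc_lt_iff_succ_le.1 h) hk1.symm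
          exact mul_pos_of_neg_of_neg (sub_neg.2 (hξ h)) (sub_neg.2 (hξ h'))
      rw [Finset.prod_mul_distrib] at hp
      have h2 : 0 < r j.castSucc * r j.succ * (ξ j.succ - ξ j.castSucc) ^ 2 :=
        mul_pos (mul_pos (hr _) (hr _)) (pow_pos (sub_pos.2 hlt) 2)
      nlinarith [mul_pos h2 hp]
    have key : ∃ t ∈ Set.Ioo (ξ j.castSucc) (ξ j.succ), (secularPoly ξ r).eval t = 0 := by
      rcases mul_neg_iff.1 hsign with ⟨h1, h2⟩ | ⟨h1, h2⟩
      · exact intermediate_value_Ioo' hlt.le hcont.continuousOn ⟨h2, h1⟩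
      · exact intermediate_value_Ioo hlt.le hcont.continuousOn ⟨h1, h2⟩
    obtain ⟨t, ht, h0⟩ := key
    exact ⟨t, ht.1, fun k hk => ht.2.trans_le (hξ.monotone (Fin.castSucc_lt_iff_succ_le.1 hk)), h0⟩
  · have hneg : (secularPoly ξ r).eval (ξ (Fin.last m)) < 0 := by
      rw [eval_secularPoly_node, neg_lt_zero]
      refine mul_pos (hr _) (Finset.prod_pos fun k hk => sub_pos.2 (hξ ?_))
      exact lt_of_le_of_ne (Fin.le_last k) (Finset.mem_erase.1 hk).1
    -- right of all nodes, at distance more than `∑ rᵢ`, the secular polynomial is positive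
    set z := ξ (Fin.last m) + (∑ i, r i + 1) with hz
    have hs : 0 < ∑ i, r i := Finset.sum_pos (fun i _ => hr i) Finset.univ_nonempty
    have hd : ∀ k, ∑ i, r i + 1 ≤ z - ξ k := fun k => by
      have := hξ.monotone (Fin.le_last k)
      rw [hz]; linarith
    have hpos : 0 < (secularPoly ξ r).eval z := by
      rw [eval_secularPoly]
      have hfac : ∀ i, ∏ k ∈ Finset.univ.erase i, (z - ξ k) =
          (∏ k, (z - ξ k)) * (z - ξ i)⁻¹ := fun i => by
        have : z - ξ i ≠ 0 := by have := hd i; intro h; linarith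
        rw [← Finset.mul_prod_erase _ _ (Finset.mem_univ i)]
        field_simp
      have hP : 0 < ∏ k, (z - ξ k) := Finset.prod_pos fun k _ => by linarith [hd k]
      have hle : ∑ i, r i * ∏ k ∈ Finset.univ.erase i, (z - ξ k) ≤
          ∑ i, r i * ((∏ k, (z - ξ k)) * (∑ i, r i + 1)⁻¹) := by
        refine Finset.sum_le_sum fun i _ => ?_
        rw [hfac]
        have := hd i
        have := (hr i).le
        gcongr
      rw [← Finset.sum_mul] at hle
      have : (∑ i, r i) * ((∏ k, (z - ξ k)) * (∑ i, r i + 1)⁻¹) < ∏ k, (z - ξ k) := by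
        rw [mul_left_comm, ← div_eq_mul_inv]
        exact mul_lt_of_lt_one_right hP ((div_lt_one (by linarith)).2 (by linarith))
      linarith
    obtain ⟨t, ht, h0⟩ := intermediate_value_Ioo (by rw [hz]; linarith) hcont.continuousOn
      (show (0 : ℝ) ∈ Set.Ioo ((secularPoly ξ r).eval (ξ (Fin.last m))) ((secularPoly ξ r).eval z)
        from ⟨hneg, hpos⟩)
    exact ⟨t, ht.1, fun k hk => absurd hk (Fin.le_last k).not_gt, h0⟩

lemma exists_interlaces_secularPoly_eq {ξ r : Fin n → ℝ} (hξ : StrictMono ξ)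
    (hr : ∀ i, 0 < r i) : ∃ y, Interlaces ξ y ∧
      secularPoly ξ r = ∏ j, (Polynomial.X - Polynomial.C (y j)) := by
  choose y h1 h2 h3 using exists_root_secularPoly hξ hr
  have hy : Interlaces ξ y := ⟨h1, h2⟩
  refine ⟨y, hy, secularPoly_eq_of_eval hy.strictMono_right.injective fun i => ?_⟩
  rw [h3, Finset.prod_eq_zero (Finset.mem_univ i) (sub_self _)]

/-- Two increasing families with the same monic polynomial agree. -/
lemma eq_of_prod_X_sub_C_eq {x y : Fin n → ℝ} (hx : Monotone x) (hy : Monotone y)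
    (h : ∏ j, (Polynomial.X - Polynomial.C (x j)) = ∏ j, (Polynomial.X - Polynomial.C (y j))) :
    x = y := by
  have h1 := congrArg Polynomial.roots h
  have hr : ∀ z : Fin n → ℝ, (∏ j, (Polynomial.X - Polynomial.C (z j))).roots =
      (List.ofFn z : Multiset ℝ) := fun z => by
    rw [← Polynomial.roots_multiset_prod_X_sub_C (List.ofFn z : Multiset ℝ)]
    congr 1
    rw [Multiset.map_coe, Multiset.prod_coe, List.map_ofFn, List.prod_ofFn]
    rfl
  rw [hr, hr, Multiset.coe_eq_coe] at h1
  exact List.ofFn_injective (h1.eq_of_sortedLE (by simpa using hx.sortedLE_ofFn)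
    (by simpa using hy.sortedLE_ofFn))

/-- The trace identity for the rank one perturbation. -/
lemma sum_secularWeight {ξ y : Fin n → ℝ} (hξ : Function.Injective ξ) :
    ∑ i, secularWeight ξ y i = ∑ i, y i - ∑ i, ξ i := by
  obtain rfl | ⟨m, rfl⟩ : n = 0 ∨ ∃ m, n = m + 1 := by
    rcases n with _ | m
    · exact Or.inl rfl
    · exact Or.inr ⟨m, rfl⟩
  · simp
  have hc : ∀ z : Fin (m + 1) → ℝ,
      (∏ i, (Polynomial.X - Polynomial.C (z i))).coeff m = -∑ i, z i := fun z => by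
    have hd : (∏ i, (Polynomial.X - Polynomial.C (z i))).natDegree = m + 1 := by
      rw [Polynomial.natDegree_finsetProd_X_sub_C_eq_card]; simp
    rw [← Polynomial.prod_X_sub_C_nextCoeff, Polynomial.nextCoeff_of_natDegree_pos (by omega), hd]
    rfl
  have hc' : ∀ i, (∏ k ∈ Finset.univ.erase i,
      (Polynomial.X - Polynomial.C (ξ k))).coeff m = 1 := fun i => by
    have hd : (∏ k ∈ Finset.univ.erase i, (Polynomial.X - Polynomial.C (ξ k))).natDegree = m := by
      rw [Polynomial.natDegree_finsetProd_X_sub_C_eq_card]; simp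
    have := (Polynomial.monic_prod_of_monic (Finset.univ.erase i) _ fun k _ =>
      Polynomial.monic_X_sub_C (ξ k)).coeff_natDegree
    rwa [hd] at this
  have h := congrArg (fun p => Polynomial.coeff p m) (secularPoly_secularWeight (y := y) hξ)
  simp only [secularPoly, Polynomial.coeff_sub, Polynomial.finsetSum_coeff,
    Polynomial.coeff_C_mul, hc, hc', mul_one] at h
  linarith

end Secular

/-! ### Change of variables from weights to interlacing roots -/

section ChangeOfVariables

variable {n : ℕ}

lemma measurableSet_interlaces (ξ : Fin n → ℝ) : MeasurableSet {y | Interlaces ξ y} := by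
  have : {y | Interlaces ξ y} = (⋂ i, {y : Fin n → ℝ | ξ i < y i}) ∩
      ⋂ i, ⋂ k, {y : Fin n → ℝ | i < k → y i < ξ k} := by
    ext y; simp [Interlaces]
  rw [this]
  refine (MeasurableSet.iInter fun i => measurableSet_lt measurable_const (measurable_pi_apply i)).inter
    (MeasurableSet.iInter fun i => MeasurableSet.iInter fun k => ?_)
  by_cases h : i < k
  · simpa [h] using measurableSet_lt (measurable_pi_apply i) measurable_const
  · simp [h]

/-- The Jacobian matrix of `secularWeight ξ`. -/
def secularJacobian (ξ y : Fin n → ℝ) : Matrix (Fin n) (Fin n) ℝ :=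
  Matrix.of fun i j => (∏ k ∈ Finset.univ.erase i, (ξ i - ξ k))⁻¹ *
    ∏ k ∈ Finset.univ.erase j, (ξ i - y k)

lemma hasFDerivAt_secularWeight (ξ y : Fin n → ℝ) :
    HasFDerivAt (secularWeight ξ)
      (LinearMap.toContinuousLinearMap (Matrix.toLin' (secularJacobian ξ y))) y := by
  refine hasFDerivAt_pi'.2 fun i => ?_
  have h := HasFDerivAt.finsetProd (u := Finset.univ) (x := y)
    (g := fun (j : Fin n) (y : Fin n → ℝ) => ξ i - y j)
    (g' := fun j => -(ContinuousLinearMap.proj j : (Fin n → ℝ) →L[ℝ] ℝ))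
    (fun j _ => (hasFDerivAt_apply j y).const_sub (ξ i))
  have h2 := h.neg.mul_const (∏ k ∈ Finset.univ.erase i, (ξ i - ξ k))⁻¹
  refine (h2.congr_fderiv ?_)
  ext v
  simp [secularJacobian, Matrix.mulVec, dotProduct, Finset.mul_sum, mul_assoc]

lemma abs_det_secularJacobian {ξ y : Fin n → ℝ} (hξ : StrictMono ξ) (hy : StrictMono y) :
    |(secularJacobian ξ y).det| = vandermondeProd y / vandermondeProd ξ := by
  have hV := vandermondeProd_pos hξ
  have hW := vandermondeProd_pos hy
  have hdet : (secularJacobian ξ y).det = (∏ i, (∏ k ∈ Finset.univ.erase i, (ξ i - ξ k))⁻¹) *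
      (Matrix.of fun i j => ∏ k ∈ Finset.univ.erase j, (ξ i - y k)).det :=
    Matrix.det_mul_column _ _
  rw [hdet, abs_mul, Finset.prod_inv_distrib,
    abs_inv, abs_prod_prod_erase_sub]
  have h := congrArg abs (det_prod_erase_mul_vandermonde ξ y)
  rw [abs_mul, abs_mul, abs_prod_prod_erase_sub, abs_of_pos hV, abs_of_pos hW] at h
  have h' : |(Matrix.of fun i j => ∏ k ∈ Finset.univ.erase j, (ξ i - y k)).det| =
      vandermondeProd ξ * vandermondeProd y := by
    apply mul_right_cancel₀ hW.ne'
    rw [h]; ring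
  rw [h']
  field_simp

lemma injOn_secularWeight (ξ : Fin n → ℝ) :
    Set.InjOn (secularWeight ξ) {y | Interlaces ξ y} := by
  intro y hy z hz h
  have hξ := hy.strictMono_left.injective
  refine eq_of_prod_X_sub_C_eq hy.strictMono_right.monotone hz.strictMono_right.monotone ?_
  rw [← secularPoly_secularWeight hξ, ← secularPoly_secularWeight hξ, h]

lemma image_secularWeight {ξ : Fin n → ℝ} (hξ : StrictMono ξ) :
    secularWeight ξ '' {y | Interlaces ξ y} = {r | ∀ i, 0 < r i} := by
  ext r
  constructor
  · rintro ⟨y, hy, rfl⟩ i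
    exact secularWeight_pos hy i
  · intro hr
    obtain ⟨y, hy, h⟩ := exists_interlaces_secularPoly_eq hξ hr
    exact ⟨y, hy, secularWeight_eq_of_secularPoly_eq hξ.injective h⟩

/-- For fixed nodes `ξ`, the change of variables from the positive weights `r` to the interlacing
roots `y` of the secular polynomial has the Jacobian `Δ(y) / Δ(ξ)`. -/
lemma lintegral_weights_eq_lintegral_interlaces {ξ : Fin n → ℝ} (hξ : StrictMono ξ)
    (h : (Fin n → ℝ) → ℝ≥0∞) :
    ∫⁻ r in {r : Fin n → ℝ | ∀ i, 0 < r i}, h r =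
      ∫⁻ y in {y | Interlaces ξ y},
        ENNReal.ofReal (vandermondeProd y / vandermondeProd ξ) * h (secularWeight ξ y) := by
  rw [← image_secularWeight hξ, lintegral_image_eq_lintegral_abs_det_fderiv_mul volume
    (measurableSet_interlaces ξ)
    (fun y _ => (hasFDerivAt_secularWeight ξ y).hasFDerivWithinAt) (injOn_secularWeight ξ)]
  refine setLIntegral_congr_fun (measurableSet_interlaces ξ) fun y hy => ?_
  congr 2
  rw [← abs_det_secularJacobian hξ hy.strictMono_right]
  congr 1
  exact (LinearMap.det_toContinuousLinearMap _).trans (LinearMap.det_toLin' _)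

end ChangeOfVariables

/-! ### Symmetric functions and the Weyl chamber -/

section Chamber

variable {n : ℕ}

lemma measurableSet_strictMono : MeasurableSet {y : Fin n → ℝ | StrictMono y} := by
  have : {y : Fin n → ℝ | StrictMono y} = ⋂ i, ⋂ k, {y : Fin n → ℝ | i < k → y i < y k} := by
    ext y; simp [StrictMono]
  rw [this]
  refine MeasurableSet.iInter fun i => MeasurableSet.iInter fun k => ?_
  by_cases h : i < k
  · simpa [h] using measurableSet_lt (measurable_pi_apply i) (measurable_pi_apply k)
  · simp [h]

lemma volume_coord_eq_zero {i k : Fin n} (hik : i ≠ k) :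
    volume {y : Fin n → ℝ | y i = y k} = 0 := by
  have h := Measure.addHaar_submodule (volume : Measure (Fin n → ℝ))
    (LinearMap.ker ((LinearMap.proj i : (Fin n → ℝ) →ₗ[ℝ] ℝ) - LinearMap.proj k)) ?_
  · convert h using 2
    ext y; simp [sub_eq_zero]
  · intro h
    have h1 : (Pi.single i 1 : Fin n → ℝ) ∈ LinearMap.ker
        ((LinearMap.proj i : (Fin n → ℝ) →ₗ[ℝ] ℝ) - LinearMap.proj k) := by rw [h]; trivial
    simp [hik.symm] at h1

lemma ae_injective : ∀ᵐ y : Fin n → ℝ, Function.Injective y := by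
  have : ∀ i k : Fin n, i ≠ k → ∀ᵐ y : Fin n → ℝ, y i ≠ y k := fun i k hik => by
    rw [ae_iff]; simpa using volume_coord_eq_zero hik
  have h2 : ∀ᵐ y : Fin n → ℝ, ∀ i k : Fin n, i ≠ k → y i ≠ y k := by
    rw [ae_all_iff]; intro i
    rw [ae_all_iff]; intro k
    by_cases h : i = k
    · simp [h]
    · filter_upwards [this i k h] with y hy _ using hy
  filter_upwards [h2] with y hy i k hik
  by_contra h
  exact hy i k h hik

lemma strictMono_comp_perm_iff {y : Fin n → ℝ} (hy : Function.Injective y)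
    (σ : Equiv.Perm (Fin n)) : StrictMono (y ∘ σ) ↔ σ = Tuple.sort y := by
  have hs : Monotone (y ∘ Tuple.sort y) := Tuple.monotone_sort y
  constructor
  · intro h
    have := Tuple.unique_monotone h.monotone hs
    exact Equiv.ext fun i => hy (congrFun this i)
  · rintro rfl
    exact hs.strictMono_of_injective (hy.comp (Tuple.sort y).injective)

lemma measurePreserving_comp_perm (σ : Equiv.Perm (Fin n)) :
    MeasurePreserving (fun y : Fin n → ℝ => y ∘ σ) volume volume := by
  have := volume_measurePreserving_piCongrLeft (fun _ : Fin n => ℝ) σ.symm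
  convert! this using 1
  ext y i
  simp [MeasurableEquiv.piCongrLeft, Equiv.piCongrLeft, Equiv.piCongrLeft']

/-- The integral of a symmetric function is `n!` times its integral over the Weyl chamber. -/
lemma lintegral_eq_factorial_mul_chamber {G : (Fin n → ℝ) → ℝ≥0∞} (hG : Measurable G)
    (hs : ∀ (σ : Equiv.Perm (Fin n)) y, G (y ∘ σ) = G y) :
    ∫⁻ y, G y = (n ! : ℝ≥0∞) * ∫⁻ y in {y | StrictMono y}, G y := by
  classical
  have hpt : ∀ᵐ y : Fin n → ℝ, G y =
      ∑ σ : Equiv.Perm (Fin n), ({y | StrictMono y} : Set (Fin n → ℝ)).indicator G (y ∘ σ) := by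
    filter_upwards [ae_injective] with y hy
    rw [Finset.sum_eq_single (Tuple.sort y)]
    · rw [Set.indicator_of_mem (by exact (strictMono_comp_perm_iff hy _).2 rfl), hs]
    · intro σ _ hσ
      exact Set.indicator_of_notMem (fun h => hσ ((strictMono_comp_perm_iff hy _).1 h)) _
    · simp
  rw [lintegral_congr_ae hpt, lintegral_finsetSum]
  · have : ∀ σ : Equiv.Perm (Fin n),
        ∫⁻ y, ({y | StrictMono y} : Set (Fin n → ℝ)).indicator G (y ∘ σ) =
          ∫⁻ y in {y | StrictMono y}, G y := fun σ => by
      rw [(measurePreserving_comp_perm σ).lintegral_comp (hG.indicator measurableSet_strictMono),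
        lintegral_indicator measurableSet_strictMono]
    simp [this, Fintype.card_perm]
  · exact fun σ _ => (hG.indicator measurableSet_strictMono).comp (measurePreserving_comp_perm σ).measurable

end Chamber

/-! ### Determinants of integrals -/

section DetIntegral

variable {n : ℕ}

/-- Integrating a determinant row by row over a product measure. -/
lemma integral_det_eq_det_integral (μ : Fin n → Measure ℝ) [∀ j, SigmaFinite (μ j)]
    (F : Fin n → Fin n → ℝ → ℝ) (hF : ∀ j k, Integrable (F j k) (μ j)) :
    Integrable (fun t : Fin n → ℝ => (Matrix.of fun j k => F j k (t j)).det) (Measure.pi μ) ∧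
    ∫ t, (Matrix.of fun j k => F j k (t j)).det ∂(Measure.pi μ) =
      (Matrix.of fun j k => ∫ t, F j k t ∂(μ j)).det := by
  have hdet : ∀ t : Fin n → ℝ, (Matrix.of fun j k => F j k (t j)).det =
      ∑ σ : Equiv.Perm (Fin n), ((Equiv.Perm.sign σ : ℤ) : ℝ) * ∏ j, F j (σ j) (t j) := fun t => by
    rw [← Matrix.det_transpose, Matrix.det_apply']
    rfl
  have hint : ∀ σ : Equiv.Perm (Fin n), Integrable
      (fun t : Fin n → ℝ => ((Equiv.Perm.sign σ : ℤ) : ℝ) * ∏ j, F j (σ j) (t j)) (Measure.pi μ) :=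
    fun σ => (Integrable.fintype_prod (fun j => hF j (σ j))).const_mul _
  simp_rw [hdet]
  refine ⟨integrable_finsetSum _ fun σ _ => hint σ, ?_⟩
  rw [integral_finsetSum _ fun σ _ => hint σ, ← Matrix.det_transpose, Matrix.det_apply']
  refine Finset.sum_congr rfl fun σ _ => ?_
  rw [integral_const_mul, integral_fintype_prod_eq_prod]
  rfl

/-- Taking differences of consecutive rows removes a column of ones. -/
lemma det_sub_castSucc_eq_det_cons_one (q : Fin n → Fin (n + 1) → ℝ) :
    (Matrix.of fun j k : Fin n => q k j.succ - q k j.castSucc).det =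
      (Matrix.of fun j k : Fin (n + 1) =>
        (Fin.cons 1 (fun k => q k j) : Fin (n + 1) → ℝ) k).det := by
  set B : Matrix (Fin (n + 1)) (Fin (n + 1)) ℝ := Matrix.of fun j =>
    (Fin.cons (Fin.cons 1 fun k => q k 0 : Fin (n + 1) → ℝ)
      (fun j => Fin.cons 0 fun k => q k j.succ - q k j.castSucc) :
        Fin (n + 1) → Fin (n + 1) → ℝ) j with hB
  rw [Matrix.det_eq_of_forall_row_eq_smul_add_pred (B := B) (fun _ => 1)]
  · rw [Matrix.det_succ_column_zero, Fin.sum_univ_succ]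
    simp [hB, Matrix.submatrix]
  · intro k; simp [hB]
  · intro i k
    refine Fin.cases ?_ (fun k => ?_) k <;> simp [hB]

end DetIntegral

/-! ### Determinants of Gamma kernels -/

section GammaKernel

variable {n : ℕ}

/-- The truncated power `t₊ᶜ`, with the value `0` at `t ≤ 0` for every exponent. -/
def posPow (c t : ℝ) : ℝ := if 0 < t then t ^ c else 0

/-- The density of the Gamma distribution with shape `b` and scale `1`. -/
def gammaKernel (b t : ℝ) : ℝ := posPow (b - 1) t * Real.exp (-t) / Real.Gamma b

/-- The determinant `det [γ_b(yⱼ - xₖ)]` of Gamma densities. -/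
def kernelDet (b : ℝ) (x y : Fin n → ℝ) : ℝ :=
  (Matrix.of fun j k => gammaKernel b (y j - x k)).det

/-- The joint density at the increasing vector `y` of the ordered eigenvalues of `diag(x) + L`,
for an LUE matrix `L` with parameter `α = b - n`. -/
def chamberDensity (b : ℝ) (x y : Fin n → ℝ) : ℝ :=
  vandermondeProd y / vandermondeProd x * kernelDet b x y

lemma posPow_of_pos {c t : ℝ} (ht : 0 < t) : posPow c t = t ^ c := if_pos ht

lemma posPow_of_nonpos {c t : ℝ} (ht : t ≤ 0) : posPow c t = 0 := if_neg ht.not_gt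

lemma posPow_nonneg (c t : ℝ) : 0 ≤ posPow c t := by
  unfold posPow; split_ifs with h
  · positivity
  · exact le_rfl

lemma posPow_eq_max_rpow {c : ℝ} (hc : 0 < c) (t : ℝ) : posPow c t = max t 0 ^ c := by
  rcases lt_or_ge 0 t with h | h
  · rw [posPow_of_pos h, max_eq_left h.le]
  · rw [posPow_of_nonpos h, max_eq_right h, Real.zero_rpow hc.ne']

@[fun_prop]
lemma measurable_posPow (c : ℝ) : Measurable (posPow c) :=
  Measurable.ite measurableSet_Ioi (by fun_prop) measurable_const

@[fun_prop]
lemma measurable_gammaKernel (b : ℝ) : Measurable (gammaKernel b) := by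
  unfold gammaKernel; fun_prop

lemma gammaKernel_nonneg {b : ℝ} (hb : 0 < b) (t : ℝ) : 0 ≤ gammaKernel b t :=
  div_nonneg (mul_nonneg (posPow_nonneg _ _) (Real.exp_nonneg _)) (Real.Gamma_pos_of_pos hb).le

lemma gammaKernel_of_nonpos (b : ℝ) {t : ℝ} (ht : t ≤ 0) : gammaKernel b t = 0 := by
  simp [gammaKernel, posPow_of_nonpos ht]

lemma measurable_kernelDet (b : ℝ) :
    Measurable fun p : (Fin n → ℝ) × (Fin n → ℝ) => kernelDet b p.1 p.2 := by
  simp only [kernelDet, Matrix.det_apply']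
  refine Finset.measurable_sum _ fun σ _ => Measurable.const_mul (Finset.measurable_prod _ fun i _ => ?_) _
  exact (measurable_gammaKernel b).comp (by fun_prop)

lemma measurable_vandermondeProd : Measurable (vandermondeProd : (Fin n → ℝ) → ℝ) := by
  unfold vandermondeProd
  fun_prop

lemma measurable_chamberDensity (b : ℝ) :
    Measurable fun p : (Fin n → ℝ) × (Fin n → ℝ) => chamberDensity b p.1 p.2 :=
  ((measurable_vandermondeProd.comp measurable_snd).div
    (measurable_vandermondeProd.comp measurable_fst)).mul (measurable_kernelDet b)

/-- The exponential factors of the kernel depend on the row or on the column only. -/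
lemma kernelDet_eq (b : ℝ) (x y : Fin n → ℝ) : kernelDet b x y =
    (Real.Gamma b ^ n)⁻¹ * Real.exp (∑ k, x k - ∑ j, y j) *
      (Matrix.of fun j k => posPow (b - 1) (y j - x k)).det := by
  have h1 := Matrix.det_mul_column (fun j => Real.exp (-y j))
    (Matrix.of fun j k => posPow (b - 1) (y j - x k) * (Real.exp (x k) / Real.Gamma b))
  have h2 := Matrix.det_mul_row (fun k => Real.exp (x k) / Real.Gamma b)
    (Matrix.of fun j k => posPow (b - 1) (y j - x k))
  have h3 : (Matrix.of fun j k => posPow (b - 1) (y j - x k) * (Real.exp (x k) / Real.Gamma b)).det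
      = (∏ k, Real.exp (x k) / Real.Gamma b) *
        (Matrix.of fun j k => posPow (b - 1) (y j - x k)).det := by
    rw [← h2]; congr 1; ext j k; simp [mul_comm]
  rw [h3] at h1
  have h4 : kernelDet b x y = (∏ j, Real.exp (-y j)) * ((∏ k, Real.exp (x k) / Real.Gamma b) *
        (Matrix.of fun j k => posPow (b - 1) (y j - x k)).det) := by
    rw [← h1, kernelDet]
    congr 1
    ext j k
    simp only [Matrix.of_apply, gammaKernel]
    rw [show -(y j - x k) = -y j + x k by ring, Real.exp_add]
    ring
  rw [h4, Finset.prod_div_distrib, ← Real.exp_sum, ← Real.exp_sum, Finset.sum_neg_distrib,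
    Real.exp_sub, Real.exp_neg]
  simp only [Finset.prod_const, Finset.card_univ, Fintype.card_fin]
  field_simp

/-- The determinant vanishes unless the smallest `y` exceeds the smallest `x`. -/
lemma kernelDet_eq_zero (b : ℝ) {x y : Fin (n + 1) → ℝ} (hx : Monotone x) (h : y 0 ≤ x 0) :
    kernelDet b x y = 0 :=
  Matrix.det_eq_zero_of_row_eq_zero 0 fun k =>
    gammaKernel_of_nonpos b (by have := hx (Fin.zero_le k); linarith)

/-- The integrand `(t - a)₊^{b-1} (t - x₀)^{-b-1}`, which has an elementary antiderivative. -/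
def boxIntegrand (b x₀ a t : ℝ) : ℝ := posPow (b - 1) (t - a) * (t - x₀) ^ (-b - 1)

/-- The antiderivative `((t - a)₊ / (t - x₀))ᵇ / (b (a - x₀))` of `boxIntegrand b x₀ a`. -/
def boxPrimitive (b x₀ a t : ℝ) : ℝ :=
  posPow b (t - a) * (t - x₀) ^ (-b) / (b * (a - x₀))

lemma hasDerivAt_boxPrimitive {b x₀ a t : ℝ} (hb : 0 < b) (ha : x₀ < a) (ht : x₀ < t)
    (hta : t ≠ a) : HasDerivAt (boxPrimitive b x₀ a) (boxIntegrand b x₀ a t) t := by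
  rcases lt_or_gt_of_ne hta with h | h
  · have h0 : boxIntegrand b x₀ a t = 0 := by
      rw [boxIntegrand, posPow_of_nonpos (by linarith), zero_mul]
    rw [h0]
    refine (hasDerivAt_const t (0 : ℝ)).congr_of_eventuallyEq ?_
    filter_upwards [Iio_mem_nhds h] with s hs
    rw [boxPrimitive, posPow_of_nonpos (by linarith [Set.mem_Iio.1 hs]), zero_mul, zero_div]
  · have hta' : 0 < t - a := sub_pos.2 h
    have htx : 0 < t - x₀ := sub_pos.2 ht
    have hax : 0 < a - x₀ := sub_pos.2 ha
    have h1 : HasDerivAt (fun s => (s - a) ^ b) (1 * b * (t - a) ^ (b - 1)) t :=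
      ((hasDerivAt_id t).sub_const a).rpow_const (Or.inl hta'.ne')
    have h2 : HasDerivAt (fun s => (s - x₀) ^ (-b)) (1 * (-b) * (t - x₀) ^ (-b - 1)) t :=
      ((hasDerivAt_id t).sub_const x₀).rpow_const (Or.inl htx.ne')
    have h3 := (h1.mul h2).div_const (b * (a - x₀))
    have h4 : (1 * b * (t - a) ^ (b - 1) * (t - x₀) ^ (-b) +
        (t - a) ^ b * (1 * (-b) * (t - x₀) ^ (-b - 1))) / (b * (a - x₀)) =
        boxIntegrand b x₀ a t := by
      have e1 : (t - a) ^ b = (t - a) ^ (b - 1) * (t - a) := by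
        rw [← Real.rpow_add_one hta'.ne', sub_add_cancel]
      have e2 : (t - x₀) ^ (-b) = (t - x₀) ^ (-b - 1) * (t - x₀) := by
        rw [← Real.rpow_add_one htx.ne', sub_add_cancel]
      rw [boxIntegrand, posPow_of_pos hta', e1, e2, div_eq_iff (by positivity)]
      ring
    rw [h4] at h3
    refine h3.congr_of_eventuallyEq ?_
    filter_upwards [Ioi_mem_nhds h] with s hs
    simp only [boxPrimitive, Pi.mul_apply]
    rw [posPow_of_pos (sub_pos.2 hs)]

/-- For `b < 1` the integrand has an integrable singularity at `a`, the only point where the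
antiderivative may fail to be differentiable. -/
lemma integral_boxIntegrand {b x₀ a s t : ℝ} (hb : 0 < b) (ha : x₀ < a) (hs : x₀ < s)
    (hst : s ≤ t) : IntegrableOn (boxIntegrand b x₀ a) (Set.Ioo s t) ∧
      ∫ u in Set.Ioo s t, boxIntegrand b x₀ a u = boxPrimitive b x₀ a t - boxPrimitive b x₀ a s := by
  have hcont : ∀ c : ℝ, ContinuousOn (fun u => (u - x₀) ^ c) (Set.Icc s t) := fun c u hu => by
    have : u - x₀ ≠ 0 := by have := hu.1; intro h; linarith
    exact ((continuousAt_id.sub continuousAt_const).rpow_const (Or.inl this)).continuousWithinAt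
  have hint : IntegrableOn (boxIntegrand b x₀ a) (Set.Icc s t) := by
    refine IntegrableOn.mul_continuousOn ?_ (hcont _) isCompact_Icc
    have h1 : IntervalIntegrable (fun u => (u - a) ^ (b - 1)) volume s t := by
      have := (intervalIntegral.intervalIntegrable_rpow' (a := s - a) (b := t - a)
        (by linarith : -1 < b - 1)).comp_sub_right a
      simpa using this
    rw [intervalIntegrable_iff_integrableOn_Icc_of_le hst] at h1
    have h2 := h1.indicator (measurableSet_Ioi (a := a))
    refine h2.congr_fun (fun u _ => ?_) measurableSet_Icc
    by_cases hu : a < u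
    · rw [Set.indicator_of_mem (by exact hu)]
      exact (posPow_of_pos (sub_pos.2 hu)).symm
    · rw [Set.indicator_of_notMem (by exact hu)]
      exact (posPow_of_nonpos (by linarith)).symm
  refine ⟨hint.mono_set Set.Ioo_subset_Icc_self, ?_⟩
  rw [← integral_Ioc_eq_integral_Ioo, ← intervalIntegral.integral_of_le hst]
  refine integral_eq_of_hasDerivAt_off_countable_of_le _ _ hst (Set.countable_singleton a) ?_ ?_ ?_
  · refine ContinuousOn.div_const (ContinuousOn.mul ?_ (hcont _)) _
    have : Continuous fun u => posPow b (u - a) := by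
      simp_rw [posPow_eq_max_rpow hb]
      exact (by fun_prop : Continuous fun u : ℝ => max (u - a) 0).rpow_const fun _ => Or.inr hb.le
    exact this.continuousOn
  · rintro u ⟨hu, hua⟩
    exact hasDerivAt_boxPrimitive hb ha (hs.trans hu.1) hua
  · rw [intervalIntegrable_iff_integrableOn_Icc_of_le hst]
    exact hint

/-- Multiplied by `(yⱼ - x₀)ᵇ`, the column of ones becomes the kernel column of the node `x₀`, and
the antiderivatives become the kernel columns of the nodes `xₖ`. -/
lemma prod_rpow_mul_det_boxPrimitive {b x₀ : ℝ} {x : Fin n → ℝ} {y : Fin (n + 1) → ℝ}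
    (hy : ∀ j, x₀ < y j) :
    (∏ j, (y j - x₀) ^ b) * (Matrix.of fun j k : Fin n =>
        boxPrimitive b x₀ (x k) (y j.succ) - boxPrimitive b x₀ (x k) (y j.castSucc)).det =
      (∏ k, (b * (x k - x₀)))⁻¹ * (Matrix.of fun j k : Fin (n + 1) =>
        posPow b (y j - (Fin.cons x₀ x : Fin (n + 1) → ℝ) k)).det := by
  rw [det_sub_castSucc_eq_det_cons_one (fun k j => boxPrimitive b x₀ (x k) (y j)),
    ← Matrix.det_mul_column]
  have h := Matrix.det_mul_row (Fin.cons 1 (fun k => (b * (x k - x₀))⁻¹) : Fin (n + 1) → ℝ)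
    (Matrix.of fun j k : Fin (n + 1) => posPow b (y j - (Fin.cons x₀ x : Fin (n + 1) → ℝ) k))
  rw [Fin.prod_univ_succ] at h
  simp only [Fin.cons_zero, Fin.cons_succ, one_mul, Finset.prod_inv_distrib] at h
  rw [← h]
  congr 1
  ext j k
  have hyj : 0 < y j - x₀ := sub_pos.2 (hy j)
  refine Fin.cases ?_ (fun k => ?_) k
  · simp [posPow_of_pos hyj]
  · simp only [Matrix.of_apply, Fin.cons_succ, boxPrimitive]
    rw [Real.rpow_neg hyj.le]
    have : (y j - x₀) ^ b ≠ 0 := (Real.rpow_pos_of_pos hyj b).ne'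
    field_simp

/-- The interlacing box: for `x₀ < y₀`, the `z` for which `(x₀, z)` interlaces with `y`. -/
lemma setOf_interlaces_cons {x₀ : ℝ} {y : Fin (n + 1) → ℝ} (hy : StrictMono y) (h0 : x₀ < y 0) :
    {z : Fin n → ℝ | Interlaces (Fin.cons x₀ z : Fin (n + 1) → ℝ) y} =
      Set.univ.pi fun j => Set.Ioo (y j.castSucc) (y j.succ) := by
  ext z
  simp only [Interlaces, Set.mem_ofPred_eq, Set.mem_pi, Set.mem_univ, forall_true_left, Set.mem_Ioo]
  constructor
  · rintro ⟨h1, h2⟩ j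
    exact ⟨by simpa using h2 j.castSucc j.succ j.castSucc_lt_succ, by simpa using h1 j.succ⟩
  · intro h
    refine ⟨fun i => ?_, fun i k hik => ?_⟩
    · refine Fin.cases ?_ (fun j => ?_) i
      · simpa using h0
      · simpa using (h j).2
    · obtain ⟨j, rfl⟩ := Fin.exists_succ_eq.2 (Fin.ne_zero_of_lt hik)
      rw [Fin.cons_succ]
      exact (hy.monotone (Fin.le_castSucc_iff.2 hik)).trans_lt (h j).1

lemma secularWeight_cons_zero {x₀ : ℝ} (z : Fin n → ℝ) (y : Fin (n + 1) → ℝ) :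
    secularWeight (Fin.cons x₀ z : Fin (n + 1) → ℝ) y 0 =
      (∏ j, (y j - x₀)) / ∏ k, (z k - x₀) := by
  have he : (Finset.univ.erase (0 : Fin (n + 1))) = Finset.univ.map (Fin.succEmb n) := by
    ext i
    simp [Fin.exists_succ_eq]
  rw [secularWeight, he, Finset.prod_map]
  simp only [Fin.cons_zero, Fin.coe_succEmb, Fin.cons_succ]
  have h1 : ∏ j, (x₀ - y j) = (-1) ^ (n + 1) * ∏ j, (y j - x₀) := by
    simpa using Finset.prod_neg (s := Finset.univ) (fun j => y j - x₀)
  have h2 : ∏ k, (x₀ - z k) = (-1) ^ n * ∏ k, (z k - x₀) := by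
    simpa using Finset.prod_neg (s := Finset.univ) (fun k => z k - x₀)
  rw [h1, h2, pow_succ]
  have h3 : ((-1 : ℝ) ^ n) ≠ 0 := by positivity
  rw [show -((-1 : ℝ) ^ n * -1 * ∏ j, (y j - x₀)) = (-1) ^ n * ∏ j, (y j - x₀) by ring,
    mul_div_mul_left _ _ h3]

/-- The integrand of the recursion over the interlacing box, in terms of `boxIntegrand`. -/
lemma step_integrand_eq {b x₀ : ℝ} {x z : Fin n → ℝ} {y : Fin (n + 1) → ℝ}
    (hint : Interlaces (Fin.cons x₀ z : Fin (n + 1) → ℝ) y) :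
    chamberDensity b x z * (vandermondeProd y / vandermondeProd (Fin.cons x₀ z : Fin (n + 1) → ℝ) *
      (gammaKernel (b + 1) (secularWeight (Fin.cons x₀ z : Fin (n + 1) → ℝ) y 0) *
        ∏ i : Fin n, Real.exp
          (-secularWeight (Fin.cons x₀ z : Fin (n + 1) → ℝ) y i.succ))) =
    vandermondeProd y / vandermondeProd x * (Real.Gamma b ^ n)⁻¹ * (Real.Gamma (b + 1))⁻¹ *
      Real.exp (x₀ + ∑ k, x k - ∑ j, y j) * (∏ j, (y j - x₀) ^ b) *
      (Matrix.of fun j k => boxIntegrand b x₀ (x k) (z j)).det := by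
  set ξ : Fin (n + 1) → ℝ := Fin.cons x₀ z with hξ
  have hz : ∀ k, 0 < z k - x₀ := fun k => by
    have := hint.strictMono_left (Fin.succ_pos k)
    simpa [hξ] using this
  have hy : ∀ j, 0 < y j - x₀ := fun j => by
    have h1 := hint.1 0
    have h2 := hint.strictMono_right.monotone (Fin.zero_le j)
    simp only [hξ, Fin.cons_zero] at h1
    linarith
  have hVz : vandermondeProd z ≠ 0 := by
    refine (vandermondeProd_pos fun i k hik => ?_).ne'
    simpa [hξ] using hint.strictMono_left (Fin.succ_lt_succ_iff.2 hik)
  have hPz : 0 < ∏ k, (z k - x₀) := Finset.prod_pos fun k _ => hz k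
  have hPy : 0 < ∏ j, (y j - x₀) := Finset.prod_pos fun j _ => hy j
  have hR : 0 < secularWeight ξ y 0 := secularWeight_pos hint 0
  have hsum := sum_secularWeight (y := y) hint.strictMono_left.injective
  rw [Fin.sum_univ_succ, Fin.sum_univ_succ (f := ξ)] at hsum
  simp only [hξ, Fin.cons_zero, Fin.cons_succ] at hsum
  rw [← hξ] at hsum
  have hdet : (Matrix.of fun j k => boxIntegrand b x₀ (x k) (z j)).det =
      (∏ j, (z j - x₀) ^ (-b - 1)) * (Matrix.of fun j k => posPow (b - 1) (z j - x k)).det := by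
    rw [← Matrix.det_mul_column]
    congr 1
    ext j k
    simp [boxIntegrand, mul_comm]
  have hR0 : secularWeight ξ y 0 ^ b = (∏ j, (y j - x₀) ^ b) * (∏ k, (z k - x₀) ^ b)⁻¹ := by
    rw [Real.finsetProd_rpow _ _ fun j _ => (hy j).le, Real.finsetProd_rpow _ _ fun j _ => (hz j).le,
      hξ, secularWeight_cons_zero, Real.div_rpow hPy.le hPz.le, div_eq_mul_inv]
  have hzpow : ∏ j, (z j - x₀) ^ (-b - 1) = (∏ k, (z k - x₀) ^ b)⁻¹ * (∏ k, (z k - x₀))⁻¹ := by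
    rw [← Finset.prod_inv_distrib, ← Finset.prod_inv_distrib, ← Finset.prod_mul_distrib]
    refine Finset.prod_congr rfl fun j _ => ?_
    rw [Real.rpow_sub (hz j), Real.rpow_one, Real.rpow_neg (hz j).le, div_eq_mul_inv]
  rw [chamberDensity, kernelDet_eq, hdet, hzpow, gammaKernel, posPow_of_pos hR, add_sub_cancel_right,
    hR0, hξ, vandermondeProd_cons, ← hξ, ← Real.exp_sum, Finset.sum_neg_distrib]
  have hexp : Real.exp (x₀ + ∑ k, x k - ∑ j, y j) = Real.exp (∑ k, x k - ∑ j, z j) *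
      (Real.exp (-secularWeight ξ y 0) * Real.exp (-∑ i : Fin n, secularWeight ξ y i.succ)) := by
    rw [← Real.exp_add, ← Real.exp_add]
    congr 1
    linarith
  rw [hexp]
  field_simp

/-- The one-step recursion for the densities `chamberDensity`: adding a first node `x₀` amounts to
integrating over the interlacing box. For `n = 0` the box is a point and `b > -1` may be
nonpositive; the factors `b` and `Γ(b)` occur to the power `n` only. -/
lemma lintegral_chamberDensity_step {b x₀ : ℝ} (hb : n ≠ 0 → 0 < b) (hb1 : 0 < b + 1)
    {x : Fin n → ℝ} (hx : StrictMono (Fin.cons x₀ x : Fin (n + 1) → ℝ))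
    (hnonneg : ∀ z : Fin n → ℝ, StrictMono z → 0 ≤ kernelDet b x z)
    {y : Fin (n + 1) → ℝ} (hy : StrictMono y) :
    0 ≤ kernelDet (b + 1) (Fin.cons x₀ x : Fin (n + 1) → ℝ) y ∧
    ∫⁻ z in {z : Fin n → ℝ | Interlaces (Fin.cons x₀ z : Fin (n + 1) → ℝ) y},
      ENNReal.ofReal (chamberDensity b x z) *
        (ENNReal.ofReal (vandermondeProd y / vandermondeProd (Fin.cons x₀ z : Fin (n + 1) → ℝ)) *
        (ENNReal.ofReal (gammaKernel (b + 1)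
            (secularWeight (Fin.cons x₀ z : Fin (n + 1) → ℝ) y 0)) *
          ∏ i : Fin n, ENNReal.ofReal (Real.exp
            (-secularWeight (Fin.cons x₀ z : Fin (n + 1) → ℝ) y i.succ)))) =
      ENNReal.ofReal (chamberDensity (b + 1) (Fin.cons x₀ x : Fin (n + 1) → ℝ) y) := by
  set ξx : Fin (n + 1) → ℝ := Fin.cons x₀ x with hξx
  rcases le_or_gt (y 0) x₀ with h0 | h0
  · have hk : kernelDet (b + 1) ξx y = 0 := kernelDet_eq_zero _ hx.monotone (by simpa [hξx] using h0)
    have hempty : {z : Fin n → ℝ | Interlaces (Fin.cons x₀ z : Fin (n + 1) → ℝ) y} = ∅ := by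
      ext z
      simp only [Set.mem_ofPred_eq, Set.mem_empty_iff_false, iff_false]
      intro h
      have := h.1 0
      simp only [Fin.cons_zero] at this
      linarith
    rw [hempty, chamberDensity, hk]
    simp
  have hxk : ∀ k, x₀ < x k := fun k => by
    have := hx (Fin.succ_pos k)
    simpa [hξx] using this
  have hyj : ∀ j, x₀ < y j := fun j => h0.trans_le (hy.monotone (Fin.zero_le j))
  have hVx : 0 < vandermondeProd x := by
    refine vandermondeProd_pos fun i k hik => ?_
    simpa [hξx] using hx (Fin.succ_lt_succ_iff.2 hik)
  have hVy := vandermondeProd_pos hy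
  have hPx : 0 < ∏ k, (x k - x₀) := Finset.prod_pos fun k _ => sub_pos.2 (hxk k)
  have hG1 := Real.Gamma_pos_of_pos hb1
  have hGn : 0 < Real.Gamma b ^ n ∧ Real.Gamma (b + 1) ^ n = Real.Gamma b ^ n * b ^ n ∧ 0 < b ^ n := by
    rcases eq_or_ne n 0 with rfl | hn
    · simp
    · have := hb hn
      exact ⟨pow_pos (Real.Gamma_pos_of_pos this) n, by
        rw [Real.Gamma_add_one this.ne', mul_comm, mul_pow], pow_pos this n⟩
  set K := vandermondeProd y / vandermondeProd x * (Real.Gamma b ^ n)⁻¹ * (Real.Gamma (b + 1))⁻¹ *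
      Real.exp (x₀ + ∑ k, x k - ∑ j, y j) * (∏ j, (y j - x₀) ^ b) with hK
  have hKpos : 0 < K := by
    have : 0 < ∏ j, (y j - x₀) ^ b :=
      Finset.prod_pos fun j _ => Real.rpow_pos_of_pos (sub_pos.2 (hyj j)) b
    have := hGn.1
    positivity
  set S := {z : Fin n → ℝ | Interlaces (Fin.cons x₀ z : Fin (n + 1) → ℝ) y} with hS
  have hSbox := setOf_interlaces_cons (n := n) hy h0
  have hSm : MeasurableSet S := by
    rw [hS, hSbox]
    exact MeasurableSet.univ_pi fun _ => measurableSet_Ioo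
  have hch : ∀ z ∈ S, 0 ≤ chamberDensity b x z := fun z hz => by
    have hzm : StrictMono z := fun i k hik => by
      simpa using (Interlaces.strictMono_left hz) (Fin.succ_lt_succ_iff.2 hik)
    exact mul_nonneg (div_nonneg (vandermondeProd_pos hzm).le hVx.le) (hnonneg z hzm)
  have hpt : ∀ z ∈ S, ENNReal.ofReal (chamberDensity b x z) *
        (ENNReal.ofReal (vandermondeProd y / vandermondeProd (Fin.cons x₀ z : Fin (n + 1) → ℝ)) *
        (ENNReal.ofReal (gammaKernel (b + 1)
            (secularWeight (Fin.cons x₀ z : Fin (n + 1) → ℝ) y 0)) *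
          ∏ i : Fin n, ENNReal.ofReal (Real.exp
            (-secularWeight (Fin.cons x₀ z : Fin (n + 1) → ℝ) y i.succ)))) =
      ENNReal.ofReal (K * (Matrix.of fun j k => boxIntegrand b x₀ (x k) (z j)).det) ∧
      0 ≤ K * (Matrix.of fun j k => boxIntegrand b x₀ (x k) (z j)).det := fun z hz => by
    have hV : 0 ≤ vandermondeProd y / vandermondeProd (Fin.cons x₀ z : Fin (n + 1) → ℝ) :=
      div_nonneg hVy.le (vandermondeProd_pos (Interlaces.strictMono_left hz)).le
    have hP : 0 ≤ ∏ i : Fin n, Real.exp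
            (-secularWeight (Fin.cons x₀ z : Fin (n + 1) → ℝ) y i.succ) :=
      Finset.prod_nonneg fun _ _ => Real.exp_nonneg _
    have hg := gammaKernel_nonneg hb1 (secularWeight (Fin.cons x₀ z : Fin (n + 1) → ℝ) y 0)
    rw [← step_integrand_eq hz]
    refine ⟨?_, mul_nonneg (hch z hz) (mul_nonneg hV (mul_nonneg hg hP))⟩
    rw [ENNReal.ofReal_mul (hch z hz), ENNReal.ofReal_mul hV, ENNReal.ofReal_mul hg,
      ENNReal.ofReal_prod_of_nonneg fun _ _ => Real.exp_nonneg _]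
  have hbox : ∀ j k, Integrable (boxIntegrand b x₀ (x k))
      (volume.restrict (Set.Ioo (y (Fin.castSucc j)) (y (Fin.succ j)))) := fun j k =>
    (integral_boxIntegrand (hb (Fin.pos j).ne') (hxk k) (hyj _)
      (hy.monotone j.castSucc_lt_succ.le)).1
  obtain ⟨hdint, hdet⟩ := integral_det_eq_det_integral
    (fun j : Fin n => volume.restrict (Set.Ioo (y j.castSucc) (y j.succ)))
    (fun _ k => boxIntegrand b x₀ (x k)) hbox
  rw [← Measure.restrict_pi_pi, ← volume_pi, ← hSbox] at hdint hdet
  have hval : ∫ z in S, K * (Matrix.of fun j k => boxIntegrand b x₀ (x k) (z j)).det =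
      chamberDensity (b + 1) ξx y := by
    rw [integral_const_mul, hdet]
    have : (Matrix.of fun j k : Fin n => ∫ t in Set.Ioo (y j.castSucc) (y j.succ),
        boxIntegrand b x₀ (x k) t) = Matrix.of fun j k : Fin n =>
        boxPrimitive b x₀ (x k) (y j.succ) - boxPrimitive b x₀ (x k) (y j.castSucc) := by
      ext j k
      exact (integral_boxIntegrand (hb (Fin.pos j).ne') (hxk k) (hyj _)
        (hy.monotone j.castSucc_lt_succ.le)).2
    rw [this, hK, mul_assoc, prod_rpow_mul_det_boxPrimitive hyj, chamberDensity, kernelDet_eq,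
      add_sub_cancel_right, ← hξx, hξx, vandermondeProd_cons, ← hξx, Fin.sum_univ_succ (f := ξx)]
    simp only [hξx, Fin.cons_zero, Fin.cons_succ]
    rw [← hξx, pow_succ, hGn.2.1, Finset.prod_mul_distrib, Finset.prod_const, Finset.card_univ,
      Fintype.card_fin]
    have h1 := hGn.1
    have h2 := hGn.2.2
    field_simp
  have hpos : 0 ≤ chamberDensity (b + 1) ξx y := by
    rw [← hval]
    exact setIntegral_nonneg hSm fun z hz => (hpt z hz).2
  constructor
  · have hq : 0 < vandermondeProd y / vandermondeProd ξx := div_pos hVy (vandermondeProd_pos hx)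
    exact (mul_nonneg_iff_of_pos_left hq).1 hpos
  · rw [setLIntegral_congr_fun hSm fun z hz => (hpt z hz).1, ← hval,
      ofReal_integral_eq_lintegral_ofReal (hdint.const_mul K)]
    exact (ae_restrict_iff' hSm).2 (Filter.Eventually.of_forall fun z hz => (hpt z hz).2)

end GammaKernel

/-! ### Ordered eigenvalues -/

section Eigenvalues

variable {n : ℕ}

/-- The permutation, independent of the matrix, that lists the eigenvalues in increasing order. -/
def eigOrder (n : ℕ) : Equiv.Perm (Fin n) :=
  (Fin.revPerm.trans (finCongr (Fintype.card_fin n).symm)).trans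
    (Fintype.equivOfCardEq (Fintype.card_fin _))

/-- The eigenvalues of a Hermitian matrix in increasing order. -/
def sortedEigs (A : Herm n) : Fin n → ℝ := eigs A ∘ eigOrder n

lemma monotone_sortedEigs (A : Herm n) : Monotone (sortedEigs A) := by
  have hA : Matrix.IsHermitian A.1 := A.2
  have h : sortedEigs A = hA.eigenvalues₀ ∘ fun i : Fin n => finCongr (Fintype.card_fin n).symm i.rev := by
    funext i
    simp only [sortedEigs, eigs, Function.comp_apply, eigOrder, Matrix.IsHermitian.eigenvalues,
      Equiv.trans_apply, Equiv.symm_apply_apply, Fin.revPerm_apply]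
  rw [h]
  refine hA.eigenvalues₀_antitone.comp fun i k hik => ?_
  exact (Fin.rev_le_rev.2 hik : k.rev.val ≤ i.rev.val)

lemma prod_sortedEigs (A : Herm n) {M : Type*} [CommMonoid M] (F : ℝ → M) :
    ∏ j, F (sortedEigs A j) = ∏ j, F (eigs A j) :=
  Equiv.prod_comp (eigOrder n) fun j => F (eigs A j)

lemma charpoly_eq_prod_sortedEigs (A : Herm n) : (A : Matrix (Fin n) (Fin n) ℂ).charpoly =
    (∏ j, (Polynomial.X - Polynomial.C (sortedEigs A j))).map Complex.ofRealHom := by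
  rw [prod_sortedEigs A fun t => Polynomial.X - Polynomial.C t, Polynomial.map_prod]
  simp only [Polynomial.map_sub, Polynomial.map_X, Polynomial.map_C]
  exact Matrix.IsHermitian.charpoly_eq A.2

/-- The ordered eigenvalues are read off from the characteristic polynomial. -/
lemma sortedEigs_eq_of_charpoly {A : Herm n} {y : Fin n → ℝ} (hy : Monotone y)
    (h : (A : Matrix (Fin n) (Fin n) ℂ).charpoly =
      (∏ j, (Polynomial.X - Polynomial.C (y j))).map Complex.ofRealHom) : sortedEigs A = y := by
  refine eq_of_prod_X_sub_C_eq (monotone_sortedEigs A) hy ?_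
  apply Polynomial.map_injective Complex.ofRealHom Complex.ofRealHom.injective
  rw [← charpoly_eq_prod_sortedEigs, h]

lemma sortedEigs_eq_of_charpoly_eq {A B : Herm n} (h : (A : Matrix (Fin n) (Fin n) ℂ).charpoly =
    (B : Matrix (Fin n) (Fin n) ℂ).charpoly) : sortedEigs A = sortedEigs B :=
  sortedEigs_eq_of_charpoly (monotone_sortedEigs B) (h.trans (charpoly_eq_prod_sortedEigs B))

lemma continuous_herm_apply (j k : Fin n) :
    Continuous fun A : Herm n => (A : Matrix (Fin n) (Fin n) ℂ) j k :=
  (continuous_id.matrix_elem j k).comp continuous_subtype_val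

lemma continuous_herm_det_sub (m : ℝ) : Continuous fun A : Herm n =>
    (Matrix.det (Matrix.scalar (Fin n) (m : ℂ) - A.1)).re :=
  Complex.continuous_re.comp
    (continuous_const.sub continuous_subtype_val).matrix_det

lemma prod_sub_sortedEigs (A : Herm n) (m : ℝ) : ∏ j, (m - sortedEigs A j) =
    (Matrix.det (Matrix.scalar (Fin n) (m : ℂ) - A.1)).re := by
  have h := congrArg (Polynomial.eval (m : ℂ)) (charpoly_eq_prod_sortedEigs A)
  rw [Matrix.eval_charpoly, Polynomial.map_prod, Polynomial.eval_prod] at h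
  rw [h]
  simp only [Polynomial.map_sub, Polynomial.map_X, Polynomial.map_C, Polynomial.eval_sub,
    Polynomial.eval_X, Polynomial.eval_C, Complex.ofRealHom_eq_coe]
  rw [← Complex.ofReal_re (∏ j, (m - sortedEigs A j))]
  push_cast
  rfl

/-- The increasing eigenvalue vector is a measurable function of the matrix: `y ↦ ∏ⱼ (m - yⱼ)`,
`m = 0, 1, 2, …`, is an injective measurable map on increasing vectors, hence a measurable
embedding by the Lusin-Souslin theorem. -/
lemma measurable_sortedEigs : Measurable (sortedEigs : Herm n → Fin n → ℝ) := by
  have hcl : IsClosed {y : Fin n → ℝ | Monotone y} := by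
    have : {y : Fin n → ℝ | Monotone y} = ⋂ i, ⋂ k, {y : Fin n → ℝ | i ≤ k → y i ≤ y k} := by
      ext y; simp [Monotone]
    rw [this]
    refine isClosed_iInter fun i => isClosed_iInter fun k => ?_
    by_cases h : i ≤ k
    · simpa [h] using isClosed_le (continuous_apply i) (continuous_apply k)
    · simp [h]
  have := hcl.measurableSet.standardBorel
  let Φ : {y : Fin n → ℝ | Monotone y} → ℕ → ℝ := fun y m => ∏ j, ((m : ℝ) - y.1 j)
  have hΦm : Measurable Φ := by
    refine measurable_pi_lambda _ fun m => Finset.measurable_prod _ fun j _ => ?_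
    exact measurable_const.sub ((measurable_pi_apply j).comp measurable_subtype_coe)
  have hΦi : Function.Injective Φ := by
    intro y z h
    refine Subtype.ext (eq_of_prod_X_sub_C_eq y.2 z.2 ?_)
    refine Polynomial.eq_of_infinite_eval_eq _ _
      ((Set.infinite_range_of_injective (Nat.cast_injective (R := ℝ))).mono ?_)
    rintro _ ⟨m, rfl⟩
    simpa [Polynomial.eval_prod] using congrFun h m
  have hemb := hΦm.measurableEmbedding hΦi
  have h1 : Measurable fun A : Herm n =>
      (⟨sortedEigs A, monotone_sortedEigs A⟩ : {y : Fin n → ℝ | Monotone y}) := by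
    rw [← hemb.measurable_comp_iff]
    refine measurable_pi_lambda _ fun m => ?_
    have : (fun A : Herm n => Φ ⟨sortedEigs A, monotone_sortedEigs A⟩ m) = fun A : Herm n =>
        (Matrix.det (Matrix.scalar (Fin n) ((m : ℝ) : ℂ) - A.1)).re := by
      funext A
      exact prod_sub_sortedEigs A m
    exact this ▸ (continuous_herm_det_sub _).measurable
  exact measurable_subtype_coe.comp h1

lemma eigs_eq_sortedEigs_comp (A : Herm n) : eigs A = sortedEigs A ∘ (eigOrder n).symm := by
  funext i; simp [sortedEigs]

lemma measurable_eigs : Measurable (eigs : Herm n → Fin n → ℝ) := by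
  have : (eigs : Herm n → Fin n → ℝ) = fun A => sortedEigs A ∘ (eigOrder n).symm :=
    funext eigs_eq_sortedEigs_comp
  rw [this]
  exact measurable_pi_lambda _ fun i => (measurable_pi_apply _).comp measurable_sortedEigs

lemma posDef_iff_sortedEigs_pos (A : Herm n) :
    (A : Matrix (Fin n) (Fin n) ℂ).PosDef ↔ ∀ j, 0 < sortedEigs A j := by
  rw [Matrix.IsHermitian.posDef_iff_eigenvalues_pos A.2]
  constructor
  · exact fun h j => h _
  · intro h i
    have := h ((eigOrder n).symm i)
    rwa [sortedEigs, Function.comp_apply, Equiv.apply_symm_apply] at this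

lemma measurable_lueDensity (α : ℝ) : Measurable (lueDensity n α) := by
  have hS : MeasurableSet {A : Herm n | (A : Matrix (Fin n) (Fin n) ℂ).PosDef} := by
    have : {A : Herm n | (A : Matrix (Fin n) (Fin n) ℂ).PosDef} =
        sortedEigs ⁻¹' {y | ∀ j, 0 < y j} := by
      ext A; exact posDef_iff_sortedEigs_pos A
    rw [this]
    refine measurable_sortedEigs ?_
    have h2 : {y : Fin n → ℝ | ∀ j, 0 < y j} = ⋂ j, {y | 0 < y j} := by ext; simp
    rw [h2]
    exact MeasurableSet.iInter fun j => measurableSet_lt measurable_const (measurable_pi_apply j)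
  have hdet : Continuous fun A : Herm n => (A : Matrix (Fin n) (Fin n) ℂ).det.re :=
    Complex.continuous_re.comp continuous_subtype_val.matrix_det
  have htr : Continuous fun A : Herm n => (A : Matrix (Fin n) (Fin n) ℂ).trace.re :=
    Complex.continuous_re.comp continuous_subtype_val.matrix_trace
  unfold lueDensity
  refine Measurable.ite hS ?_ measurable_const
  exact (((hdet.measurable.pow_const α).div_const _)).mul
    (Real.measurable_exp.comp htr.measurable.neg)

/-- The diagonal matrix with real entries `x`. -/
def diagHerm (x : Fin n → ℝ) : Herm n :=
  ⟨Matrix.diagonal fun j => (x j : ℂ), by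
    rw [selfAdjoint.mem_iff, Matrix.star_eq_conjTranspose, Matrix.diagonal_conjTranspose]
    congr 1
    funext j
    simp⟩

lemma charpoly_conjBy (U : Matrix.unitaryGroup (Fin n) ℂ) (A : Herm n) :
    (conjBy U A : Matrix (Fin n) (Fin n) ℂ).charpoly = (A : Matrix (Fin n) (Fin n) ℂ).charpoly := by
  rw [conjBy, Matrix.charpoly_mul_comm, ← mul_assoc]
  simp

lemma conjBy_add (U : Matrix.unitaryGroup (Fin n) ℂ) (A B : Herm n) :
    conjBy U (A + B) = conjBy U A + conjBy U B := by
  ext1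
  simp [conjBy, mul_add, add_mul]

lemma conjBy_conjBy (U V : Matrix.unitaryGroup (Fin n) ℂ) (A : Herm n) :
    conjBy U (conjBy V A) = conjBy (U * V) A := by
  ext1
  simp [conjBy, mul_assoc]

lemma conjBy_one (A : Herm n) : conjBy 1 A = A := by
  ext1
  simp [conjBy]

lemma continuous_conjBy (U : Matrix.unitaryGroup (Fin n) ℂ) : Continuous (conjBy U) :=
  Continuous.subtype_mk
    ((continuous_const.matrix_mul continuous_subtype_val).matrix_mul continuous_const) _

/-- Diagonalization of a Hermitian matrix with the eigenvalues in increasing order. -/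
lemma exists_conjBy_diagHerm (A : Herm n) :
    ∃ U : Matrix.unitaryGroup (Fin n) ℂ, A = conjBy U (diagHerm (sortedEigs A)) := by
  set V := Matrix.IsHermitian.eigenvectorUnitary (A := A.1) A.2 with hV
  have hVV : ∀ j l, ∑ k, (V : Matrix (Fin n) (Fin n) ℂ) j k *
      star ((V : Matrix (Fin n) (Fin n) ℂ) l k) = (1 : Matrix (Fin n) (Fin n) ℂ) j l := fun j l => by
    rw [← (Matrix.mem_unitaryGroup_iff.1 V.2), Matrix.mul_apply]
    rfl
  have hA : ∀ j l, A.1 j l = ∑ k, (V : Matrix (Fin n) (Fin n) ℂ) j k * (eigs A k : ℂ) *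
      star ((V : Matrix (Fin n) (Fin n) ℂ) l k) := fun j l => by
    conv_lhs => rw [Matrix.IsHermitian.spectral_theorem (A := A.1) A.2]
    rw [Unitary.conjStarAlgAut_apply, Matrix.mul_apply]
    refine Finset.sum_congr rfl fun k _ => ?_
    rw [Matrix.mul_diagonal, ← hV]
    rfl
  refine ⟨⟨(V : Matrix (Fin n) (Fin n) ℂ).submatrix id (eigOrder n), ?_⟩, ?_⟩
  · rw [Matrix.mem_unitaryGroup_iff]
    ext j l
    rw [← hVV j l, Matrix.mul_apply]
    exact Equiv.sum_comp (eigOrder n) fun k => (V : Matrix (Fin n) (Fin n) ℂ) j k *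
      star ((V : Matrix (Fin n) (Fin n) ℂ) l k)
  · ext1
    ext j l
    change A.1 j l = ((V : Matrix (Fin n) (Fin n) ℂ).submatrix id (eigOrder n) *
      Matrix.diagonal (fun k => ((sortedEigs A k : ℝ) : ℂ)) *
      star ((V : Matrix (Fin n) (Fin n) ℂ).submatrix id (eigOrder n))) j l
    rw [hA j l, Matrix.mul_apply]
    simp only [Matrix.mul_diagonal]
    exact (Equiv.sum_comp (eigOrder n) fun k => (V : Matrix (Fin n) (Fin n) ℂ) j k *
      (eigs A k : ℂ) * star ((V : Matrix (Fin n) (Fin n) ℂ) l k)).symm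

end Eigenvalues

/-! ### The flat measure on Hermitian matrices -/

section FlatMeasure

variable {n : ℕ}

/-- The coordinate space `ℝⁿ × ℂ^{n(n-1)/2}` of `Herm n`. -/
abbrev HermCoords (n : ℕ) : Type := (Fin n → ℝ) × ({q : Fin n × Fin n // q.1 < q.2} → ℂ)

instance : SecondCountableTopology (Herm n) :=
  have : SecondCountableTopology (Matrix (Fin n) (Fin n) ℂ) :=
    inferInstanceAs (SecondCountableTopology (Fin n → Fin n → ℂ))
  TopologicalSpace.Subtype.secondCountableTopology _

instance : (volume : Measure (HermCoords n)).IsAddHaarMeasure :=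
  Measure.prod.instIsAddHaarMeasure (volume : Measure (Fin n → ℝ))
    (volume : Measure ({q : Fin n × Fin n // q.1 < q.2} → ℂ))

/-- The coordinates of a Hermitian matrix. -/
def hermCoords (A : Herm n) : HermCoords n := (fun j => (A.1 j j).re, fun q => A.1 q.1.1 q.1.2)

lemma herm_star_apply (A : Herm n) (j k : Fin n) : star (A.1 j k) = A.1 k j := by
  have : star A.1 = A.1 := A.2
  conv_rhs => rw [← this, Matrix.star_apply]

lemma herm_diag_eq (A : Herm n) (j : Fin n) : ((A.1 j j).re : ℂ) = A.1 j j :=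
  Complex.conj_eq_iff_re.1 (herm_star_apply A j j)

lemma hermOfCoords_lt (p : HermCoords n) {j k : Fin n} (h : j < k) :
    (hermOfCoords p).1 j k = p.2 ⟨(j, k), h⟩ := by
  simp [hermOfCoords, h]

lemma hermOfCoords_diag (p : HermCoords n) (j : Fin n) :
    (hermOfCoords p).1 j j = (p.1 j : ℂ) := by
  simp [hermOfCoords]

lemma herm_ext_upper {A B : Herm n} (h : ∀ j k, j ≤ k → A.1 j k = B.1 j k) : A = B := by
  ext1
  ext j k
  rcases le_total j k with hjk | hjk
  · exact h j k hjk
  · have := h k j hjk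
    change A.1 j k = B.1 j k
    rw [← herm_star_apply A, ← herm_star_apply B, this]

lemma hermOfCoords_hermCoords (A : Herm n) : hermOfCoords (hermCoords A) = A := by
  refine herm_ext_upper fun j k hjk => ?_
  rcases hjk.eq_or_lt with rfl | h
  · rw [hermOfCoords_diag]; exact herm_diag_eq A j
  · rw [hermOfCoords_lt _ h]; rfl

lemma hermCoords_hermOfCoords (p : HermCoords n) : hermCoords (hermOfCoords p) = p := by
  ext q
  · simp [hermCoords, hermOfCoords_diag]
  · exact hermOfCoords_lt p q.2

lemma continuous_hermCoords : Continuous (hermCoords : Herm n → HermCoords n) :=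
  (continuous_pi fun j => Complex.continuous_re.comp (continuous_herm_apply j j)).prodMk
    (continuous_pi fun q => continuous_herm_apply q.1.1 q.1.2)

lemma continuous_hermOfCoords : Continuous (hermOfCoords : HermCoords n → Herm n) := by
  refine Continuous.subtype_mk (continuous_matrix fun j k => ?_) _
  rcases lt_trichotomy j k with h | h | h
  · simp only [Matrix.of_apply, h, dite_true]; fun_prop
  · subst h; simp only [Matrix.of_apply, lt_irrefl, dite_false]; fun_prop
  · simp only [Matrix.of_apply, h, h.not_gt, dite_true, dite_false]; fun_prop

lemma hermCoords_add (A B : Herm n) : hermCoords (A + B) = hermCoords A + hermCoords B := by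
  ext <;> simp [hermCoords]

lemma hermOfCoords_add (p q : HermCoords n) :
    hermOfCoords (p + q) = hermOfCoords p + hermOfCoords q := by
  rw [← hermOfCoords_hermCoords (hermOfCoords p + hermOfCoords q), hermCoords_add,
    hermCoords_hermOfCoords, hermCoords_hermOfCoords]

/-- The coordinate homeomorphism onto `Herm n`, as a measurable equivalence. -/
def hermEquiv (n : ℕ) : HermCoords n ≃ᵐ Herm n where
  toFun := hermOfCoords
  invFun := hermCoords
  left_inv := hermCoords_hermOfCoords
  right_inv := hermOfCoords_hermCoords
  measurable_toFun := continuous_hermOfCoords.measurable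
  measurable_invFun := continuous_hermCoords.measurable

lemma measurePreserving_hermEquiv :
    MeasurePreserving (hermEquiv n) volume (hermVolume n) :=
  ⟨(hermEquiv n).measurable, rfl⟩

instance : SigmaFinite (hermVolume n) :=
  (hermEquiv n).sigmaFinite_map

lemma lintegral_hermVolume_add_right (F : Herm n → ℝ≥0∞) (B : Herm n) :
    ∫⁻ A, F (A + B) ∂hermVolume n = ∫⁻ A, F A ∂hermVolume n := by
  rw [← measurePreserving_hermEquiv.lintegral_comp_emb (hermEquiv n).measurableEmbedding,
    ← measurePreserving_hermEquiv.lintegral_comp_emb (hermEquiv n).measurableEmbedding,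
    ← lintegral_add_right_eq_self (fun p => F (hermEquiv n p)) (hermCoords B)]
  refine lintegral_congr fun p => ?_
  change F (hermOfCoords p + B) = F (hermOfCoords (p + hermCoords B))
  rw [hermOfCoords_add, hermOfCoords_hermCoords]

/-- Conjugation by a unitary matrix, in coordinates. -/
def conjCoords (U : Matrix.unitaryGroup (Fin n) ℂ) : HermCoords n →ₗ[ℝ] HermCoords n where
  toFun p := hermCoords (conjBy U (hermOfCoords p))
  map_add' p q := by rw [hermOfCoords_add, conjBy_add, hermCoords_add]
  map_smul' c p := by
    have h : hermOfCoords (c • p) = c • hermOfCoords p := by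
      rw [← hermOfCoords_hermCoords (c • hermOfCoords p)]
      congr 1
      conv_lhs => rw [← hermCoords_hermOfCoords p]
      ext <;> simp [hermCoords]
    rw [h]
    ext <;> simp [hermCoords, conjBy]

/-- An invertible linear map that preserves a bounded neighbourhood of the origin, given as a
sublevel set, preserves Lebesgue measure: its determinant has absolute value one. -/
lemma measurePreserving_of_gauge {E : Type*} [NormedAddCommGroup E] [NormedSpace ℝ E]
    [MeasurableSpace E] [BorelSpace E] [FiniteDimensional ℝ E] (μ : Measure E) [μ.IsAddHaarMeasure]
    {T T' : E →ₗ[ℝ] E} (hTT' : T.comp T' = LinearMap.id) {N : E → ℝ} (hNc : Continuous N)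
    (hTN : ∀ p, N (T p) = N p) (hb : ∀ p, N p ≤ 1 → ‖p‖ ≤ 1) (h0 : N 0 < 1) :
    MeasurePreserving T μ μ := by
  have hdet : LinearMap.det T ≠ 0 := by
    intro h0
    have := congrArg LinearMap.det hTT'
    rw [LinearMap.det_comp, h0, zero_mul, LinearMap.det_id] at this
    exact zero_ne_one this
  have hmap := Measure.map_linearMap_addHaar_eq_smul_addHaar μ hdet
  set c := ENNReal.ofReal |(LinearMap.det T)⁻¹| with hc
  have hTc : Continuous T := T.continuous_of_finiteDimensional
  set S : Set E := {p | N p ≤ 1} with hS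
  have hSm : MeasurableSet S := (isClosed_le hNc continuous_const).measurableSet
  have hpre : T ⁻¹' S = S := by
    ext p
    simp [hS, hTN]
  have hfin : μ S ≠ ⊤ := by
    refine ((measure_mono fun p hp => ?_).trans_lt
      (measure_closedBall_lt_top (x := (0 : E)) (r := 1))).ne
    rw [mem_closedBall_zero_iff]
    exact hb p hp
  have hpos : μ S ≠ 0 := by
    have hopen : IsOpen {p | N p < 1} := isOpen_lt hNc continuous_const
    have hne : ({p | N p < 1} : Set E).Nonempty := ⟨0, h0⟩
    exact ((hopen.measure_pos μ hne).trans_le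
      (measure_mono fun p (hp : N p < 1) => hp.le)).ne'
  have hc1 : c = 1 := by
    have h1 : Measure.map T μ S = c * μ S := by rw [hmap]; rfl
    rw [Measure.map_apply hTc.measurable hSm, hpre] at h1
    exact ((ENNReal.mul_eq_right hpos hfin).1 h1.symm)
  rw [hc1, one_smul] at hmap
  exact ⟨hTc.measurable, hmap⟩

/-- The squared Hilbert-Schmidt norm, as `Re Tr A²`. -/
def hsNormSq (A : Herm n) : ℝ := (Matrix.trace (A.1 * A.1)).re

lemma hsNormSq_conjBy (U : Matrix.unitaryGroup (Fin n) ℂ) (A : Herm n) :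
    hsNormSq (conjBy U A) = hsNormSq A := by
  have hU : star (U : Matrix (Fin n) (Fin n) ℂ) * U = 1 := Matrix.mem_unitaryGroup_iff'.1 U.2
  have : (conjBy U A).1 * (conjBy U A).1 = U * (A.1 * A.1) * star (U : Matrix (Fin n) (Fin n) ℂ) := by
    change (U * A.1 * star (U : Matrix (Fin n) (Fin n) ℂ)) *
      (U * A.1 * star (U : Matrix (Fin n) (Fin n) ℂ)) = _
    calc _ = U * A.1 * (star (U : Matrix (Fin n) (Fin n) ℂ) * U) * A.1 *
          star (U : Matrix (Fin n) (Fin n) ℂ) := by simp only [mul_assoc]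
      _ = _ := by rw [hU]; simp only [mul_assoc, one_mul]
  rw [hsNormSq, this, Matrix.trace_mul_comm, ← mul_assoc, hU, one_mul, hsNormSq]

lemma hsNormSq_eq (A : Herm n) : hsNormSq A = ∑ j, ∑ k, ‖A.1 j k‖ ^ 2 := by
  rw [hsNormSq, Matrix.trace, Complex.re_sum]
  refine Finset.sum_congr rfl fun j _ => ?_
  rw [Matrix.diag_apply, Matrix.mul_apply, Complex.re_sum]
  refine Finset.sum_congr rfl fun k _ => ?_
  rw [← herm_star_apply A j k, Complex.star_def, Complex.mul_conj, Complex.normSq_eq_norm_sq,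
    Complex.ofReal_re]

lemma norm_hermCoords_le_one {A : Herm n} (h : hsNormSq A ≤ 1) : ‖hermCoords A‖ ≤ 1 := by
  have hjk : ∀ j k, ‖A.1 j k‖ ≤ 1 := fun j k => by
    rw [hsNormSq_eq] at h
    have h1 : ‖A.1 j k‖ ^ 2 ≤ ∑ k, ‖A.1 j k‖ ^ 2 :=
      Finset.single_le_sum (f := fun k => ‖A.1 j k‖ ^ 2) (fun _ _ => by positivity)
        (Finset.mem_univ k)
    have h2 : ∑ k, ‖A.1 j k‖ ^ 2 ≤ ∑ j, ∑ k, ‖A.1 j k‖ ^ 2 :=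
      Finset.single_le_sum (f := fun j => ∑ k, ‖A.1 j k‖ ^ 2)
        (fun _ _ => Finset.sum_nonneg fun _ _ => by positivity) (Finset.mem_univ j)
    nlinarith [norm_nonneg (A.1 j k)]
  refine norm_prod_le_iff.2 ⟨?_, ?_⟩
  · refine (pi_norm_le_iff_of_nonneg zero_le_one).2 fun j => ?_
    exact (Complex.abs_re_le_norm _).trans (hjk j j)
  · exact (pi_norm_le_iff_of_nonneg zero_le_one).2 fun q => hjk _ _

/-- The flat measure is invariant under unitary conjugation, which preserves the Hilbert-Schmidt
unit ball. -/
lemma measurePreserving_conjBy (U : Matrix.unitaryGroup (Fin n) ℂ) :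
    MeasurePreserving (conjBy U) (hermVolume n) (hermVolume n) := by
  have hinv : LinearMap.comp (conjCoords U) (conjCoords U⁻¹) = LinearMap.id := by
    refine LinearMap.ext fun p => ?_
    change hermCoords (conjBy U (hermOfCoords (hermCoords (conjBy U⁻¹ (hermOfCoords p))))) = p
    rw [hermOfCoords_hermCoords, conjBy_conjBy, mul_inv_cancel, conjBy_one,
      hermCoords_hermOfCoords]
  have hNc : Continuous fun p : HermCoords n => hsNormSq (hermOfCoords p) := by
    refine Complex.continuous_re.comp (Continuous.matrix_trace ?_)
    have h : Continuous fun p : HermCoords n => (hermOfCoords p).1 :=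
      continuous_subtype_val.comp continuous_hermOfCoords
    exact h.matrix_mul h
  have hT := measurePreserving_of_gauge (volume : Measure (HermCoords n)) hinv hNc
    (fun p => by
      change hsNormSq (hermOfCoords (hermCoords (conjBy U (hermOfCoords p)))) = _
      rw [hermOfCoords_hermCoords, hsNormSq_conjBy])
    (fun p hp => by simpa [hermCoords_hermOfCoords] using norm_hermCoords_le_one hp)
    (by
      have : hermOfCoords (0 : HermCoords n) = 0 := by
        rw [← hermOfCoords_hermCoords 0]
        congr 1
      rw [this]
      simp [hsNormSq])
  refine ⟨(continuous_conjBy U).measurable, ?_⟩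
  have h2 : (conjBy U) ∘ hermOfCoords = hermOfCoords ∘ conjCoords U := by
    funext p
    exact (hermOfCoords_hermCoords _).symm
  rw [hermVolume, Measure.map_map (continuous_conjBy U).measurable continuous_hermOfCoords.measurable,
    h2, ← Measure.map_map continuous_hermOfCoords.measurable hT.measurable, hT.map_eq]

lemma lueDensity_conjBy (α : ℝ) (U : Matrix.unitaryGroup (Fin n) ℂ) (A : Herm n) :
    lueDensity n α (conjBy U A) = lueDensity n α A := by
  have hU : star (U : Matrix (Fin n) (Fin n) ℂ) * U = 1 := Matrix.mem_unitaryGroup_iff'.1 U.2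
  have hpd : (conjBy U A).1.PosDef ↔ A.1.PosDef := by
    rw [posDef_iff_sortedEigs_pos, posDef_iff_sortedEigs_pos,
      sortedEigs_eq_of_charpoly_eq (charpoly_conjBy U A)]
  have hdet : (conjBy U A).1.det = A.1.det := by
    change (U * A.1 * star (U : Matrix (Fin n) (Fin n) ℂ)).det = _
    rw [Matrix.det_mul_comm, ← mul_assoc, hU, one_mul]
  have htr : (conjBy U A).1.trace = A.1.trace := by
    change (U * A.1 * star (U : Matrix (Fin n) (Fin n) ℂ)).trace = _
    rw [Matrix.trace_mul_comm, ← mul_assoc, hU, one_mul]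
  by_cases h : A.1.PosDef
  · rw [lueDensity, lueDensity, if_pos h, if_pos (hpd.2 h), hdet, htr]
  · rw [lueDensity, lueDensity, if_neg h, if_neg fun h' => h (hpd.1 h')]

lemma measurePreserving_conjBy_lueLaw (α : ℝ) (U : Matrix.unitaryGroup (Fin n) ℂ) :
    MeasurePreserving (conjBy U) (lueLaw n α) (lueLaw n α) := by
  refine ⟨(continuous_conjBy U).measurable, ?_⟩
  refine Measure.ext fun s hs => ?_
  have hm := (continuous_conjBy U).measurable
  have hd := (measurable_lueDensity (n := n) α).ennreal_ofReal
  rw [Measure.map_apply hm hs, lueLaw, withDensity_apply _ (hm hs), withDensity_apply _ hs,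
    ← lintegral_indicator (hm hs), ← lintegral_indicator hs,
    ← (measurePreserving_conjBy U).lintegral_comp (hd.indicator hs)]
  refine lintegral_congr fun A => ?_
  simp only [Set.indicator, lueDensity_conjBy]
  rfl

end FlatMeasure

/-! ### Block decomposition and the Schur complement of an LUE matrix -/

section Block

variable {n : ℕ}

/-- The Hermitian matrix with first diagonal entry `ℓ`, first row `u` beyond the diagonal, and
lower right block `W`. -/
def blockHerm (ℓ : ℝ) (u : Fin n → ℂ) (W : Herm n) : Herm (n + 1) :=
  ⟨Matrix.of (Fin.cons (Fin.cons (ℓ : ℂ) u) fun j => Fin.cons (star (u j)) (W.1 j)), by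
    rw [selfAdjoint.mem_iff]
    ext j k
    rw [Matrix.star_apply]
    refine Fin.cases ?_ (fun j => ?_) j <;> refine Fin.cases ?_ (fun k => ?_) k
    · simp
    · simp
    · simp
    · simpa using herm_star_apply W k j⟩

@[simp] lemma blockHerm_zero_zero (ℓ : ℝ) (u : Fin n → ℂ) (W : Herm n) :
    (blockHerm ℓ u W).1 0 0 = ℓ := rfl

@[simp] lemma blockHerm_zero_succ (ℓ : ℝ) (u : Fin n → ℂ) (W : Herm n) (k : Fin n) :
    (blockHerm ℓ u W).1 0 k.succ = u k := rfl

@[simp] lemma blockHerm_succ_zero (ℓ : ℝ) (u : Fin n → ℂ) (W : Herm n) (j : Fin n) :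
    (blockHerm ℓ u W).1 j.succ 0 = star (u j) := rfl

@[simp] lemma blockHerm_succ_succ (ℓ : ℝ) (u : Fin n → ℂ) (W : Herm n) (j k : Fin n) :
    (blockHerm ℓ u W).1 j.succ k.succ = W.1 j k := rfl

lemma blockHerm_add (ℓ ℓ' : ℝ) (u u' : Fin n → ℂ) (W W' : Herm n) :
    blockHerm ℓ u W + blockHerm ℓ' u' W' = blockHerm (ℓ + ℓ') (u + u') (W + W') := by
  ext1
  ext j k
  change (blockHerm ℓ u W).1 j k + (blockHerm ℓ' u' W').1 j k =
    (blockHerm (ℓ + ℓ') (u + u') (W + W')).1 j k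
  refine Fin.cases ?_ (fun j => ?_) j <;> refine Fin.cases ?_ (fun k => ?_) k <;> simp

/-- The Hermitian matrix `u* u` of a row vector `u`. -/
def outerHerm (u : Fin n → ℂ) : Herm n :=
  ⟨Matrix.of fun j k => star (u j) * u k, by
    rw [selfAdjoint.mem_iff]
    ext j k
    simp [Matrix.star_apply, mul_comm]⟩

@[simp] lemma outerHerm_apply (u : Fin n → ℂ) (j k : Fin n) :
    (outerHerm u).1 j k = star (u j) * u k := rfl

lemma continuous_outerHerm : Continuous (outerHerm : (Fin n → ℂ) → Herm n) :=
  Continuous.subtype_mk (continuous_matrix fun j k =>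
    ((continuous_apply j).star).mul (continuous_apply k)) _

lemma continuous_blockHerm :
    Continuous fun p : ℝ × (Fin n → ℂ) × Herm n => blockHerm p.1 p.2.1 p.2.2 := by
  refine Continuous.subtype_mk (continuous_matrix fun j k => ?_) _
  refine Fin.cases ?_ (fun j => ?_) j <;> refine Fin.cases ?_ (fun k => ?_) k
  · exact Complex.continuous_ofReal.comp continuous_fst
  · exact (continuous_apply k).comp (continuous_fst.comp continuous_snd)
  · exact ((continuous_apply j).comp (continuous_fst.comp continuous_snd)).star
  · exact (continuous_herm_apply j k).comp (continuous_snd.comp continuous_snd)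

lemma diagHerm_cons (x₀ : ℝ) (x : Fin n → ℝ) :
    diagHerm (Fin.cons x₀ x : Fin (n + 1) → ℝ) = blockHerm x₀ 0 (diagHerm x) := by
  refine herm_ext_upper fun j k _ => ?_
  refine Fin.cases ?_ (fun j => ?_) j <;> refine Fin.cases ?_ (fun k => ?_) k
  · simp [diagHerm]
  · simp [diagHerm, (Fin.succ_ne_zero k).symm]
  · simp [diagHerm, Fin.succ_ne_zero j]
  · simp [diagHerm, Matrix.diagonal_apply]

/-- Positions above the diagonal are either in the first row or in the lower right block. -/
def upperEquiv (n : ℕ) : Fin n ⊕ {q : Fin n × Fin n // q.1 < q.2} ≃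
    {q : Fin (n + 1) × Fin (n + 1) // q.1 < q.2} :=
  Equiv.ofBijective
    (Sum.elim (fun j => ⟨(0, j.succ), Fin.succ_pos j⟩)
      (fun q => ⟨(q.1.1.succ, q.1.2.succ), Fin.succ_lt_succ_iff.2 q.2⟩)) (by
    constructor
    · rintro (j | ⟨⟨a, b⟩, h⟩) (j' | ⟨⟨a', b'⟩, h'⟩) he
      · simpa using he
      · simp [Fin.ext_iff] at he
      · simp [Fin.ext_iff] at he
      · simpa using he
    · rintro ⟨⟨a, b⟩, h⟩
      obtain ⟨k, rfl⟩ := Fin.exists_succ_eq.2 (Fin.ne_zero_of_lt h)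
      rcases Fin.eq_zero_or_eq_succ a with rfl | ⟨j, rfl⟩
      · exact ⟨Sum.inl k, rfl⟩
      · exact ⟨Sum.inr ⟨(j, k), Fin.succ_lt_succ_iff.1 h⟩, rfl⟩)

/-- Exchanging the middle factors of a fourfold product preserves product measures. -/
lemma measurePreserving_prod_rearrange {A B C D : Type*} [MeasureSpace A] [MeasureSpace B]
    [MeasureSpace C] [MeasureSpace D] [SigmaFinite (volume : Measure A)]
    [SigmaFinite (volume : Measure B)] [SigmaFinite (volume : Measure C)]
    [SigmaFinite (volume : Measure D)] :
    MeasurePreserving (fun p : A × B × C × D => ((p.1, p.2.2.1), (p.2.1, p.2.2.2)))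
      volume volume := by
  have h1 : MeasurePreserving (MeasurableEquiv.prodAssoc (α := B) (β := C) (γ := D)).symm
      volume volume := (measurePreserving_prodAssoc volume volume volume).symm _
  have h2 : MeasurePreserving (Prod.map Prod.swap id : (B × C) × D → (C × B) × D)
      volume volume := (Measure.measurePreserving_swap).prod (MeasurePreserving.id volume)
  have h3 : MeasurePreserving (MeasurableEquiv.prodAssoc (α := C) (β := B) (γ := D))
      volume volume := measurePreserving_prodAssoc volume volume volume
  have h4 := (MeasurePreserving.id (volume : Measure A)).prod (h3.comp (h2.comp h1))
  have h5 : MeasurePreserving (MeasurableEquiv.prodAssoc (α := A) (β := C) (γ := B × D)).symm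
      volume volume := (measurePreserving_prodAssoc volume volume volume).symm _
  exact h5.comp h4

/-- In terms of blocks, the flat measure on `Herm (n + 1)` is the product of Lebesgue measure on the
corner and on the row with the flat measure on `Herm n`. -/
lemma measurePreserving_blockHerm :
    MeasurePreserving (fun p : ℝ × (Fin n → ℂ) × Herm n => blockHerm p.1 p.2.1 p.2.2)
      ((volume : Measure ℝ).prod ((volume : Measure (Fin n → ℂ)).prod (hermVolume n)))
      (hermVolume (n + 1)) := by
  have hin : MeasurePreserving (Prod.map id (Prod.map id (hermEquiv n)) :
      ℝ × (Fin n → ℂ) × HermCoords n → ℝ × (Fin n → ℂ) × Herm n) volume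
      ((volume : Measure ℝ).prod ((volume : Measure (Fin n → ℂ)).prod (hermVolume n))) :=
    (MeasurePreserving.id _).prod ((MeasurePreserving.id _).prod measurePreserving_hermEquiv)
  have h1 : MeasurePreserving (MeasurableEquiv.piFinSuccAbove (fun _ : Fin (n + 1) => ℝ) 0).symm
      volume volume := (volume_preserving_piFinSuccAbove _ _).symm _
  have h2 : MeasurePreserving (MeasurableEquiv.sumPiEquivProdPi
      (fun _ : Fin n ⊕ {q : Fin n × Fin n // q.1 < q.2} => ℂ)).symm volume volume :=
    volume_measurePreserving_sumPiEquivProdPi_symm _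
  have h3 := volume_measurePreserving_piCongrLeft
    (fun _ : {q : Fin (n + 1) × Fin (n + 1) // q.1 < q.2} => ℂ) (upperEquiv n)
  have hout := measurePreserving_hermEquiv.comp
    ((h1.prod (h3.comp h2)).comp measurePreserving_prod_rearrange)
  have heq : (fun p : ℝ × (Fin n → ℂ) × Herm n => blockHerm p.1 p.2.1 p.2.2) ∘
      (Prod.map id (Prod.map id (hermEquiv n))) =
      (hermEquiv (n + 1)) ∘ (Prod.map (MeasurableEquiv.piFinSuccAbove (fun _ => ℝ) 0).symm
        ((MeasurableEquiv.piCongrLeft (fun _ => ℂ) (upperEquiv n)) ∘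
          (MeasurableEquiv.sumPiEquivProdPi fun _ => ℂ).symm) ∘
        fun p : ℝ × (Fin n → ℂ) × HermCoords n => ((p.1, p.2.2.1), (p.2.1, p.2.2.2))) := by
    funext ⟨ℓ, u, d, q⟩
    have hu : ∀ (h : (Fin n ⊕ {q : Fin n × Fin n // q.1 < q.2}) → ℂ) r,
        MeasurableEquiv.piCongrLeft (fun _ => ℂ) (upperEquiv n) h (upperEquiv n r) = h r :=
      fun h r => Equiv.piCongrLeft_apply_apply (fun _ => ℂ) (upperEquiv n) h r
    refine herm_ext_upper fun j k hjk => ?_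
    change (blockHerm ℓ u (hermOfCoords (d, q))).1 j k = (hermOfCoords (_, _)).1 j k
    rcases hjk.eq_or_lt with rfl | h
    · rw [hermOfCoords_diag]
      refine Fin.cases ?_ (fun j => ?_) j
      · rfl
      · rw [blockHerm_succ_succ, hermOfCoords_diag]; rfl
    · rw [hermOfCoords_lt _ h]
      obtain ⟨k, rfl⟩ := Fin.exists_succ_eq.2 (Fin.ne_zero_of_lt h)
      rcases Fin.eq_zero_or_eq_succ j with rfl | ⟨j, rfl⟩
      · exact (hu ((MeasurableEquiv.sumPiEquivProdPi fun _ => ℂ).symm (u, q)) (Sum.inl k)).symm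
      · have hjk' := Fin.succ_lt_succ_iff.1 h
        rw [blockHerm_succ_succ, hermOfCoords_lt _ hjk']
        exact (hu ((MeasurableEquiv.sumPiEquivProdPi fun _ => ℂ).symm (u, q))
          (Sum.inr ⟨(j, k), hjk'⟩)).symm
  refine ⟨continuous_blockHerm.measurable, ?_⟩
  rw [← hin.map_eq, Measure.map_map continuous_blockHerm.measurable hin.measurable, heq]
  exact hout.map_eq

lemma det_of_first_col {M : Matrix (Fin (n + 1)) (Fin (n + 1)) ℂ} (h : ∀ j : Fin n, M j.succ 0 = 0) :
    M.det = M 0 0 * (M.submatrix Fin.succ Fin.succ).det := by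
  rw [Matrix.det_succ_column_zero, Fin.sum_univ_succ]
  simp [h]

lemma det_scalar_sub_blockHerm_zero (ℓ : ℝ) (W : Herm n) (t : ℂ) :
    (Matrix.scalar (Fin (n + 1)) t - (blockHerm ℓ 0 W).1).det =
      (t - ℓ) * (Matrix.scalar (Fin n) t - W.1).det := by
  rw [det_of_first_col]
  · congr 1
    · congr 1
      ext j k
      simp only [Matrix.submatrix_apply, Matrix.sub_apply, blockHerm_succ_succ,
        Matrix.scalar_apply, Matrix.diagonal_apply, Fin.succ_inj]
  · intro j; simp

/-- Positive definiteness read off from the real roots of the characteristic polynomial; all roots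
are real. -/
lemma posDef_iff_det_scalar_sub (A : Herm n) : A.1.PosDef ↔
    ∀ t : ℝ, (Matrix.scalar (Fin n) (t : ℂ) - A.1).det = 0 → 0 < t := by
  have h : ∀ t : ℝ, (Matrix.scalar (Fin n) (t : ℂ) - A.1).det = ((∏ j, (t - sortedEigs A j) : ℝ) : ℂ) :=
    fun t => by
      rw [← Matrix.eval_charpoly, charpoly_eq_prod_sortedEigs, Polynomial.map_prod,
        Polynomial.eval_prod]
      simp
  simp only [h, Complex.ofReal_eq_zero, Finset.prod_eq_zero_iff, Finset.mem_univ, true_and]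
  rw [posDef_iff_sortedEigs_pos]
  constructor
  · rintro h t ⟨j, hj⟩
    rw [sub_eq_zero.1 hj]
    exact h j
  · exact fun h j => h _ ⟨j, sub_self _⟩

lemma posDef_blockHerm_zero (ℓ : ℝ) (W : Herm n) :
    (blockHerm ℓ 0 W).1.PosDef ↔ 0 < ℓ ∧ W.1.PosDef := by
  simp only [posDef_iff_det_scalar_sub, det_scalar_sub_blockHerm_zero, mul_eq_zero]
  constructor
  · exact fun h => ⟨h ℓ (Or.inl (sub_self _)), fun t ht => h t (Or.inr ht)⟩
  · rintro ⟨h1, h2⟩ t (ht | ht)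
    · rwa [show t = ℓ by exact_mod_cast sub_eq_zero.1 ht]
    · exact h2 t ht

/-- The unit lower triangular matrix with first column `(1, c)`. -/
def lowerCol (c : Fin n → ℂ) : Matrix (Fin (n + 1)) (Fin (n + 1)) ℂ :=
  Matrix.of (Fin.cons (Fin.cons 1 0) fun j => Fin.cons (c j) ((1 : Matrix (Fin n) (Fin n) ℂ) j))

lemma det_lowerCol (c : Fin n → ℂ) : (lowerCol c).det = 1 := by
  rw [← Matrix.det_transpose, det_of_first_col]
  · have : ((lowerCol c).transpose.submatrix Fin.succ Fin.succ) = 1 := by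
      ext j k
      simp [lowerCol, Matrix.one_apply, eq_comm]
    rw [this]
    simp [lowerCol]
  · intro j; simp [lowerCol]

/-- Schur complement factorization. -/
lemma blockHerm_eq_mul {ℓ : ℝ} (hℓ : 0 < ℓ) (u : Fin n → ℂ) (W : Herm n) :
    (blockHerm ℓ (fun k => (Real.sqrt ℓ : ℂ) * u k) (W + outerHerm u)).1 =
      lowerCol (fun k => star (u k) / (Real.sqrt ℓ : ℂ)) * (blockHerm ℓ 0 W).1 *
        star (lowerCol (fun k => star (u k) / (Real.sqrt ℓ : ℂ))) := by
  have hs : (Real.sqrt ℓ : ℂ) ≠ 0 := by exact_mod_cast (Real.sqrt_pos.2 hℓ).ne'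
  have hsq : (ℓ : ℂ) = (Real.sqrt ℓ : ℂ) * (Real.sqrt ℓ : ℂ) := by
    exact_mod_cast (Real.mul_self_sqrt hℓ.le).symm
  ext j k
  rw [Matrix.mul_apply, Fin.sum_univ_succ]
  simp only [Matrix.mul_apply, Fin.sum_univ_succ, Matrix.star_apply]
  refine Fin.cases ?_ (fun j => ?_) j <;> refine Fin.cases ?_ (fun k => ?_) k
  · simp [lowerCol]
  · simp [lowerCol]
    rw [hsq]; field_simp
  · simp [lowerCol, Matrix.one_apply]
    rw [hsq]; field_simp
  · simp [lowerCol, Matrix.one_apply]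
    rw [hsq]; field_simp
    exact add_comm _ _

lemma det_blockHerm_zero (ℓ : ℝ) (W : Herm n) : (blockHerm ℓ 0 W).1.det = ℓ * W.1.det := by
  rw [det_of_first_col]
  · rfl
  · intro j; simp

/-- In Schur complement coordinates, where the row is `√ℓ u` and the lower right block is `W + u* u`,
the LUE density times the Jacobian `ℓⁿ` of `u ↦ √ℓ u` factorizes into Gamma, Gaussian and LUE
densities: `det A = ℓ det W` and `Tr A = ℓ + ‖u‖² + Tr W`. -/
lemma lueDensity_blockHerm {α ℓ : ℝ} (hℓ : 0 < ℓ) (u : Fin n → ℂ) (W : Herm n) :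
    ℓ ^ n * lueDensity (n + 1) α
      (blockHerm ℓ (fun k => (Real.sqrt ℓ : ℂ) * u k) (W + outerHerm u)) =
    gammaKernel (α + n + 1) ℓ * ((∏ k, Real.exp (-‖u k‖ ^ 2)) / Real.pi ^ n * lueDensity n α W) := by
  set A := blockHerm ℓ (fun k => (Real.sqrt ℓ : ℂ) * u k) (W + outerHerm u) with hA
  set C := lowerCol (fun k => star (u k) / (Real.sqrt ℓ : ℂ)) with hC
  have hmul : A.1 = C * (blockHerm ℓ 0 W).1 * star C := blockHerm_eq_mul hℓ u W
  have hCd : C.det = 1 := det_lowerCol _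
  have hpd : A.1.PosDef ↔ W.1.PosDef := by
    rw [hmul, Matrix.IsUnit.posDef_star_right_conjugate_iff, posDef_blockHerm_zero]
    · simp [hℓ]
    · rw [Matrix.isUnit_iff_isUnit_det, hCd]; exact isUnit_one
  have hdet : A.1.det = ℓ * W.1.det := by
    rw [hmul, Matrix.det_mul, Matrix.det_mul, Matrix.star_eq_conjTranspose,
      Matrix.det_conjTranspose, hCd, det_blockHerm_zero]
    simp
  have htr : A.1.trace.re = ℓ + W.1.trace.re + ∑ k, ‖u k‖ ^ 2 := by
    rw [Matrix.trace, Fin.sum_univ_succ]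
    simp only [Matrix.diag_apply, hA, blockHerm_zero_zero, blockHerm_succ_succ]
    have : ∀ k, (W + outerHerm u).1 k k = W.1 k k + ((‖u k‖ ^ 2 : ℝ) : ℂ) := fun k => by
      change W.1 k k + star (u k) * u k = _
      rw [Complex.star_def, ← Complex.normSq_eq_conj_mul_self, Complex.normSq_eq_norm_sq]
    simp only [this, Finset.sum_add_distrib, Complex.add_re, Complex.ofReal_re, Matrix.trace,
      Matrix.diag_apply, ← Complex.ofReal_sum]
    ring
  by_cases h : W.1.PosDef
  · have hd : 0 < W.1.det.re := by
      have := h.det_pos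
      exact (Complex.lt_def.1 this).1
    rw [lueDensity, lueDensity, if_pos (hpd.2 h), if_pos h, htr, hdet, gammaKernel,
      posPow_of_pos hℓ, Complex.re_ofReal_mul, Real.mul_rpow hℓ.le hd.le,
      Finset.prod_Icc_succ_top (by omega), add_sub_cancel_right, Real.rpow_add hℓ, Real.rpow_natCast,
      ← Real.exp_sum, Finset.sum_neg_distrib]
    have hexp : Real.exp (-(ℓ + W.1.trace.re + ∑ k, ‖u k‖ ^ 2)) =
        Real.exp (-ℓ) * (Real.exp (-∑ k, ‖u k‖ ^ 2) * Real.exp (-W.1.trace.re)) := by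
      rw [← Real.exp_add, ← Real.exp_add]; congr 1; ring
    have hpi : Real.pi ^ ((n + 1) * (n + 1 - 1) / 2) =
        Real.pi ^ (n * (n - 1) / 2) * Real.pi ^ n := by
      rw [← pow_add]
      congr 1
      have : (n + 1) * (n + 1 - 1) = n * (n - 1) + n * 2 := by
        rcases n with _ | m
        · rfl
        · simp only [Nat.add_sub_cancel]; ring
      rw [this, Nat.add_mul_div_right _ _ two_pos]
    rw [hexp, hpi]
    push_cast
    rw [← add_assoc]
    have := Real.pi_pos
    simp only [div_eq_mul_inv, mul_inv]
    ring
  · rw [lueDensity, lueDensity, if_neg h, if_neg fun h' => h (hpd.1 h')]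
    simp

lemma lueDensity_blockHerm_of_nonpos {α ℓ : ℝ} (hℓ : ℓ ≤ 0) (u : Fin n → ℂ) (W : Herm n) :
    lueDensity (n + 1) α (blockHerm ℓ u W) = 0 := by
  refine if_neg fun h => ?_
  have := h.diag_pos (i := 0)
  simp at this
  linarith

end Block

/-! ### Rank one perturbations -/

section RankOne

variable {n : ℕ}

/-- The characteristic polynomial of a rank one perturbation of a diagonal matrix. -/
lemma charpoly_diagonal_add_vecMulVec (ξ : Fin n → ℝ) (c : Fin n → ℂ) :
    (Matrix.diagonal (fun j => (ξ j : ℂ)) + Matrix.vecMulVec c (star c)).charpoly =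
      (secularPoly ξ fun i => ‖c i‖ ^ 2).map Complex.ofRealHom := by
  -- off the nodes `ξ`, the determinant is `∏ᵢ (t - ξᵢ)` times that of `1` minus a rank one matrix
  have hinf : ((fun t : ℝ => (t : ℂ)) '' (Set.range ξ)ᶜ).Infinite :=
    ((Set.finite_range ξ).infinite_compl).image Complex.ofReal_injective.injOn
  refine Polynomial.eq_of_infinite_eval_eq _ _ (hinf.mono ?_)
  rintro _ ⟨t, ht, rfl⟩
  have hne : ∀ i, (t : ℂ) - ξ i ≠ 0 := fun i h => ht ⟨i, by exact_mod_cast (sub_eq_zero.1 h).symm⟩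
  have hneR : ∀ i, t - ξ i ≠ 0 := fun i h => ht ⟨i, (sub_eq_zero.1 h).symm⟩
  have hfac : Matrix.scalar (Fin n) (t : ℂ) -
      (Matrix.diagonal (fun j => (ξ j : ℂ)) + Matrix.vecMulVec c (star c)) =
      Matrix.diagonal (fun j => (t : ℂ) - ξ j) *
        (1 + Matrix.replicateCol Unit (fun j => -c j / ((t : ℂ) - ξ j)) *
          Matrix.replicateRow Unit (star c)) := by
    ext j k
    rw [Matrix.diagonal_mul, Matrix.add_apply, ← Matrix.vecMulVec_eq, Matrix.sub_apply,
      Matrix.add_apply, Matrix.vecMulVec_apply, Matrix.vecMulVec_apply, Matrix.scalar_apply, mul_add,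
      ← mul_assoc, mul_div_cancel₀ _ (hne j)]
    by_cases h : j = k
    · subst h; simp; ring
    · simp [h]
  have hsec : (secularPoly ξ fun i => ‖c i‖ ^ 2).eval t =
      (∏ i, (t - ξ i)) * (1 - ∑ i, ‖c i‖ ^ 2 / (t - ξ i)) := by
    rw [eval_secularPoly, mul_sub, mul_one, Finset.mul_sum]
    congr 1
    refine Finset.sum_congr rfl fun i _ => ?_
    rw [← Finset.mul_prod_erase _ _ (Finset.mem_univ i)]
    have := hneR i
    field_simp
  have hR : ((secularPoly ξ fun i => ‖c i‖ ^ 2).map Complex.ofRealHom).eval (t : ℂ) =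
      (((secularPoly ξ fun i => ‖c i‖ ^ 2).eval t : ℝ) : ℂ) :=
    Polynomial.eval_map_apply (f := Complex.ofRealHom) (p := secularPoly ξ fun i => ‖c i‖ ^ 2) t
  rw [Set.mem_ofPred_eq, hR, hsec, Matrix.eval_charpoly, hfac, Matrix.det_mul, Matrix.det_diagonal,
    Matrix.det_one_add_replicateCol_mul_replicateRow]
  push_cast
  congr 1
  rw [sub_eq_add_neg, ← Finset.sum_neg_distrib, dotProduct]
  congr 1
  refine Finset.sum_congr rfl fun i _ => ?_
  rw [Pi.star_apply, Complex.star_def, mul_div_assoc', mul_neg, ← Complex.normSq_eq_conj_mul_self,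
    Complex.normSq_eq_norm_sq, neg_div]
  push_cast
  rfl

/-- The bordered matrix is `diag(x₀, w) + c c*` with `c = (√ℓ, u*)`. -/
lemma charpoly_blockHerm_diag {ℓ : ℝ} (x₀ : ℝ) (hℓ : 0 ≤ ℓ) (w : Fin n → ℝ) (u : Fin n → ℂ) :
    (blockHerm (x₀ + ℓ) (fun k => (Real.sqrt ℓ : ℂ) * u k)
      (diagHerm w + outerHerm u)).1.charpoly =
    (secularPoly (Fin.cons x₀ w : Fin (n + 1) → ℝ) (Fin.cons ℓ fun i => ‖u i‖ ^ 2)).map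
      Complex.ofRealHom := by
  have hsq : (Real.sqrt ℓ : ℂ) * (Real.sqrt ℓ : ℂ) = (ℓ : ℂ) := by
    exact_mod_cast Real.mul_self_sqrt hℓ
  set c : Fin (n + 1) → ℂ := Fin.cons (Real.sqrt ℓ : ℂ) fun i => star (u i) with hc
  have h1 : (fun i => ‖c i‖ ^ 2) = (Fin.cons ℓ fun i => ‖u i‖ ^ 2 : Fin (n + 1) → ℝ) := by
    funext i
    refine Fin.cases ?_ (fun i => ?_) i
    · simp [hc, Real.sq_sqrt hℓ]
    · simp [hc]
  rw [← h1, ← charpoly_diagonal_add_vecMulVec]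
  congr 1
  ext j k
  rw [Matrix.add_apply, Matrix.vecMulVec_apply]
  refine Fin.cases ?_ (fun j => ?_) j <;> refine Fin.cases ?_ (fun k => ?_) k
  · simp [hc, hsq]
  · simp [hc, (Fin.succ_ne_zero k).symm]
  · simp [hc, Fin.succ_ne_zero j, mul_comm]
  · rw [blockHerm_succ_succ]
    change (diagHerm w).1 j k + star (u j) * u k = _
    simp [hc, diagHerm, Matrix.diagonal_apply]

/-- The unitary matrix `1 ⊕ V`. -/
def liftUnitary (V : Matrix.unitaryGroup (Fin n) ℂ) : Matrix.unitaryGroup (Fin (n + 1)) ℂ :=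
  ⟨Matrix.of (Fin.cons (Fin.cons 1 0) fun j => Fin.cons 0 (V.1 j)), by
    have hV := Matrix.mem_unitaryGroup_iff.1 V.2
    rw [Matrix.mem_unitaryGroup_iff]
    ext j k
    rw [Matrix.mul_apply, Fin.sum_univ_succ]
    refine Fin.cases ?_ (fun j => ?_) j <;> refine Fin.cases ?_ (fun k => ?_) k
    · simp [Matrix.star_apply]
    · simp [Matrix.star_apply, (Fin.succ_ne_zero k).symm]
    · simp [Matrix.star_apply, Fin.succ_ne_zero j]
    · have := congrFun (congrFun hV j) k
      rw [Matrix.mul_apply] at this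
      simpa [Matrix.star_apply, Matrix.one_apply] using this⟩

lemma conjBy_liftUnitary_blockHerm (V : Matrix.unitaryGroup (Fin n) ℂ) (ℓ : ℝ) (u : Fin n → ℂ)
    (W : Herm n) : conjBy (liftUnitary V) (blockHerm ℓ u W) =
      blockHerm ℓ (Matrix.vecMul u (star V.1)) (conjBy V W) := by
  refine herm_ext_upper fun j k _ => ?_
  change ((liftUnitary V).1 * (blockHerm ℓ u W).1 * star (liftUnitary V).1) j k = _
  rw [Matrix.mul_apply, Fin.sum_univ_succ]
  simp only [Matrix.mul_apply, Fin.sum_univ_succ, Matrix.star_apply]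
  refine Fin.cases ?_ (fun j => ?_) j <;> refine Fin.cases ?_ (fun k => ?_) k
  · simp [liftUnitary]
  · simp [liftUnitary, Matrix.vecMul, dotProduct, Matrix.star_apply]
  · simp [liftUnitary, Matrix.vecMul, dotProduct, Matrix.star_apply, mul_comm]
  · rw [blockHerm_succ_succ]
    change _ = (V.1 * W.1 * star V.1) j k
    simp [liftUnitary, Matrix.mul_apply, Matrix.star_apply]

lemma conjBy_outerHerm (V : Matrix.unitaryGroup (Fin n) ℂ) (u : Fin n → ℂ) :
    conjBy V (outerHerm u) = outerHerm (Matrix.vecMul u (star V.1)) := by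
  refine herm_ext_upper fun j k _ => ?_
  change (V.1 * (outerHerm u).1 * star V.1) j k = _
  simp only [Matrix.mul_apply, outerHerm_apply, Matrix.vecMul, dotProduct, Matrix.star_apply,
    star_sum, star_mul', star_star, Finset.sum_mul, Finset.mul_sum]
  refine Finset.sum_congr rfl fun a _ => Finset.sum_congr rfl fun b _ => ?_
  ring

end RankOne

/-! ### Gaussian vectors -/

section Gaussian

variable {n : ℕ}

/-- The density of a standard complex Gaussian vector. -/
def gaussDensity (u : Fin n → ℂ) : ℝ := (∏ k, Real.exp (-‖u k‖ ^ 2)) / Real.pi ^ n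

lemma measurable_gaussDensity : Measurable (gaussDensity : (Fin n → ℂ) → ℝ) := by
  unfold gaussDensity; fun_prop

/-- Multiplication of row vectors by `V*`, as a real linear map. -/
def vecMulStar (V : Matrix.unitaryGroup (Fin n) ℂ) : (Fin n → ℂ) →ₗ[ℝ] (Fin n → ℂ) where
  toFun u := Matrix.vecMul u (star V.1)
  map_add' _ _ := Matrix.add_vecMul _ _ _
  map_smul' _ _ := Matrix.smul_vecMul _ _ _

lemma sum_norm_sq_vecMul (V : Matrix.unitaryGroup (Fin n) ℂ) (u : Fin n → ℂ) :
    ∑ k, ‖Matrix.vecMul u (star V.1) k‖ ^ 2 = ∑ k, ‖u k‖ ^ 2 := by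
  have h : ∀ v : Fin n → ℂ, ((∑ k, ‖v k‖ ^ 2 : ℝ) : ℂ) = v ⬝ᵥ star v := fun v => by
    rw [dotProduct]
    push_cast
    refine Finset.sum_congr rfl fun k _ => ?_
    rw [Pi.star_apply, Complex.star_def, Complex.mul_conj, Complex.normSq_eq_norm_sq]
    push_cast; rfl
  have hV : star V.1 * V.1 = 1 := Matrix.mem_unitaryGroup_iff'.1 V.2
  have : ((∑ k, ‖Matrix.vecMul u (star V.1) k‖ ^ 2 : ℝ) : ℂ) = ((∑ k, ‖u k‖ ^ 2 : ℝ) : ℂ) := by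
    rw [h, h, Matrix.star_vecMul, Matrix.star_eq_conjTranspose, Matrix.conjTranspose_conjTranspose,
      ← Matrix.dotProduct_mulVec, Matrix.mulVec_mulVec, ← Matrix.star_eq_conjTranspose, hV,
      Matrix.one_mulVec]
  exact_mod_cast this

lemma measurePreserving_vecMulStar (V : Matrix.unitaryGroup (Fin n) ℂ) :
    MeasurePreserving (vecMulStar V) volume volume := by
  refine measurePreserving_of_gauge (volume : Measure (Fin n → ℂ)) (T' := vecMulStar V⁻¹) ?_
    (N := fun u => ∑ k, ‖u k‖ ^ 2) (by fun_prop) (sum_norm_sq_vecMul V) ?_ (by simp)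
  · refine LinearMap.ext fun u => ?_
    change Matrix.vecMul (Matrix.vecMul u (star (V⁻¹).1)) (star V.1) = u
    rw [Matrix.vecMul_vecMul]
    have : star (V⁻¹).1 * star V.1 = 1 := by
      rw [← star_mul]
      have h : V.1 * (V⁻¹).1 = 1 := by
        rw [← Submonoid.coe_mul, mul_inv_cancel]; rfl
      rw [h, star_one]
    rw [this, Matrix.vecMul_one]
  · intro u hu
    refine (pi_norm_le_iff_of_nonneg zero_le_one).2 fun k => ?_
    have : ‖u k‖ ^ 2 ≤ ∑ k, ‖u k‖ ^ 2 :=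
      Finset.single_le_sum (f := fun k => ‖u k‖ ^ 2) (fun _ _ => by positivity) (Finset.mem_univ k)
    nlinarith [norm_nonneg (u k)]

/-- The standard complex Gaussian law is invariant under unitary maps. -/
lemma lintegral_gauss_vecMul (V : Matrix.unitaryGroup (Fin n) ℂ) {H : (Fin n → ℂ) → ℝ≥0∞}
    (hH : Measurable H) :
    ∫⁻ u, ENNReal.ofReal (gaussDensity u) * H (Matrix.vecMul u (star V.1)) =
      ∫⁻ u, ENNReal.ofReal (gaussDensity u) * H u := by
  have hm : Measurable fun u => ENNReal.ofReal (gaussDensity u) * H u :=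
    measurable_gaussDensity.ennreal_ofReal.mul hH
  rw [← (measurePreserving_vecMulStar V).lintegral_comp hm]
  refine lintegral_congr fun u => ?_
  change _ = ENNReal.ofReal (gaussDensity (Matrix.vecMul u (star V.1))) *
    H (Matrix.vecMul u (star V.1))
  congr 2
  simp only [gaussDensity, ← Real.exp_sum, Finset.sum_neg_distrib, sum_norm_sq_vecMul]

/-- The squared modulus maps Lebesgue measure on `ℂ` to `π` times Lebesgue measure on the positive
half-line. -/
lemma map_norm_sq_volume : Measure.map (fun z : ℂ => ‖z‖ ^ 2) volume =
    ENNReal.ofReal Real.pi • (volume.restrict (Set.Ioi (0 : ℝ))) := by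
  refine Measure.ext_of_lintegral _ fun f hf => ?_
  rw [lintegral_map hf (by fun_prop), ← Complex.lintegral_comp_polarCoord_symm,
    polarCoord_target]
  have h1 : ∀ p : ℝ × ℝ, p ∈ Set.Ioi (0 : ℝ) ×ˢ Set.Ioo (-Real.pi) Real.pi →
      ENNReal.ofReal p.1 • f (‖Complex.polarCoord.symm p‖ ^ 2) =
        ENNReal.ofReal p.1 * f (p.1 ^ 2) := fun p hp => by
    rw [Complex.norm_polarCoord_symm, sq_abs, smul_eq_mul]
  rw [setLIntegral_congr_fun (measurableSet_Ioi.prod measurableSet_Ioo) h1, Measure.volume_eq_prod,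
    ← Measure.prod_restrict, lintegral_prod _ (by fun_prop)]
  simp only [lintegral_const, Measure.restrict_apply MeasurableSet.univ, Set.univ_inter,
    Real.volume_Ioo]
  have himg : (fun r : ℝ => r ^ 2) '' Set.Ioi 0 = Set.Ioi 0 := by
    ext r
    constructor
    · rintro ⟨s, hs, rfl⟩
      exact pow_pos (Set.mem_Ioi.1 hs) 2
    · intro hr
      exact ⟨Real.sqrt r, Real.sqrt_pos.2 hr, Real.sq_sqrt (le_of_lt hr)⟩
  have hcv := lintegral_image_eq_lintegral_abs_deriv_mul (s := Set.Ioi (0 : ℝ))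
    (f := fun r => r ^ 2) (f' := fun r => 2 * r) measurableSet_Ioi
    (fun r _ => by simpa using (hasDerivAt_pow 2 r).hasDerivWithinAt)
    (fun a ha b hb h => by
      exact (sq_eq_sq₀ (le_of_lt ha) (le_of_lt hb)).1 h) f
  rw [himg] at hcv
  rw [lintegral_smul_measure, hcv, smul_eq_mul, ← lintegral_const_mul _ (by fun_prop)]
  refine setLIntegral_congr_fun measurableSet_Ioi fun r hr => ?_
  rw [abs_of_pos (by linarith [Set.mem_Ioi.1 hr] : (0 : ℝ) < 2 * r), ← mul_assoc,
    ← ENNReal.ofReal_mul Real.pi_pos.le, mul_right_comm, ← ENNReal.ofReal_mul (le_of_lt hr)]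
  congr 2
  ring

/-- The squared moduli of the coordinates turn Lebesgue measure on `ℂⁿ` into `πⁿ` times Lebesgue
measure on the positive orthant. -/
lemma lintegral_norm_sq {H : (Fin n → ℝ) → ℝ≥0∞} (hH : Measurable H) :
    ∫⁻ u : Fin n → ℂ, H (fun k => ‖u k‖ ^ 2) =
      ENNReal.ofReal Real.pi ^ n * ∫⁻ r in {r : Fin n → ℝ | ∀ i, 0 < r i}, H r := by
  have hsf : SigmaFinite (Measure.map (fun z : ℂ => ‖z‖ ^ 2) volume) := by
    rw [map_norm_sq_volume]
    exact SMul.sigmaFinite (μ := volume.restrict (Set.Ioi (0 : ℝ))) Real.pi.toNNReal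
  have hset : {r : Fin n → ℝ | ∀ i, 0 < r i} = Set.univ.pi fun _ => Set.Ioi 0 := by
    ext r; simp
  have hmap : Measure.map (fun (u : Fin n → ℂ) k => ‖u k‖ ^ 2) volume =
      ENNReal.ofReal Real.pi ^ n • (volume.restrict {r : Fin n → ℝ | ∀ i, 0 < r i}) := by
    have hpi := Measure.pi_map_pi (μ := fun _ : Fin n => (volume : Measure ℂ))
      (f := fun _ z => ‖z‖ ^ 2) (hμ := fun _ => hsf)
      (fun _ => (by fun_prop : Measurable fun z : ℂ => ‖z‖ ^ 2).aemeasurable)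
    rw [volume_pi, hpi, hset, volume_pi, Measure.restrict_pi_pi]
    refine Measure.pi_eq fun s hs => ?_
    rw [Measure.smul_apply, Measure.pi_pi, map_norm_sq_volume]
    simp [Finset.prod_mul_distrib]
  rw [← lintegral_map hH (by fun_prop), hmap, lintegral_smul_measure, smul_eq_mul]

end Gaussian

/-! ### Recursion of the LUE in the size -/

section Recursion

variable {n : ℕ}

instance (α : ℝ) : SFinite (lueLaw n α) := by
  unfold lueLaw; infer_instance

/-- The substitution `w = √ℓ u` on `ℂⁿ`, of real dimension `2n`, has the Jacobian `ℓⁿ`. -/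
lemma lintegral_scale_sqrt {ℓ : ℝ} (hℓ : 0 < ℓ) {H : (Fin n → ℂ) → ℝ≥0∞} (hH : Measurable H) :
    ∫⁻ w, H w = ENNReal.ofReal (ℓ ^ n) *
      ∫⁻ u : Fin n → ℂ, H (fun k => (Real.sqrt ℓ : ℂ) * u k) := by
  have hs := Real.sqrt_pos.2 hℓ
  have h := Measure.map_addHaar_smul (volume : Measure (Fin n → ℂ)) hs.ne'
  have hfr : Module.finrank ℝ (Fin n → ℂ) = 2 * n := by
    rw [Module.finrank_pi_fintype]; simp [mul_comm]
  rw [hfr, pow_mul, Real.sq_sqrt hℓ.le, abs_of_pos (by positivity)] at h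
  have h2 : ∫⁻ u : Fin n → ℂ, H (fun k => (Real.sqrt ℓ : ℂ) * u k) =
      ∫⁻ w, H w ∂(Measure.map (fun u : Fin n → ℂ => Real.sqrt ℓ • u) volume) := by
    rw [lintegral_map hH (by fun_prop)]
    rfl
  rw [h2, h, lintegral_smul_measure, smul_eq_mul, ← mul_assoc, ← ENNReal.ofReal_mul (by positivity),
    mul_inv_cancel₀ (by positivity), ENNReal.ofReal_one, one_mul]

/-- An LUE matrix of size `n + 1` is built from a Gamma variable `ℓ`, a Gaussian vector `u` and an
LUE matrix `W` of size `n` with the same parameter, all independent. -/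
lemma lintegral_lueLaw_succ {α : ℝ} (hα : -1 < α) {F : Herm (n + 1) → ℝ≥0∞} (hF : Measurable F) :
    ∫⁻ A, F A ∂lueLaw (n + 1) α =
      ∫⁻ ℓ : ℝ, ENNReal.ofReal (gammaKernel (α + n + 1) ℓ) *
        ∫⁻ W, (∫⁻ u : Fin n → ℂ, ENNReal.ofReal (gaussDensity u) *
          F (blockHerm ℓ (fun k => (Real.sqrt ℓ : ℂ) * u k) (W + outerHerm u))) ∂lueLaw n α := by
  have hd := (measurable_lueDensity (n := n + 1) α).ennreal_ofReal
  have hdn := (measurable_lueDensity (n := n) α).ennreal_ofReal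
  set G : Herm (n + 1) → ℝ≥0∞ := fun A => ENNReal.ofReal (lueDensity (n + 1) α A) * F A with hG
  have hGm : Measurable G := hd.mul hF
  have hGb : Measurable fun p : ℝ × (Fin n → ℂ) × Herm n => G (blockHerm p.1 p.2.1 p.2.2) :=
    hGm.comp continuous_blockHerm.measurable
  have h1 : ∫⁻ A, F A ∂lueLaw (n + 1) α = ∫⁻ A, G A ∂hermVolume (n + 1) := by
    rw [lueLaw, lintegral_withDensity_eq_lintegral_mul _ hd hF]
    rfl
  rw [h1, ← measurePreserving_blockHerm.lintegral_comp hGm, lintegral_prod _ hGb.aemeasurable]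
  refine lintegral_congr fun ℓ => ?_
  have hGℓ : Measurable fun p : (Fin n → ℂ) × Herm n => G (blockHerm ℓ p.1 p.2) :=
    hGm.comp (continuous_blockHerm.comp (continuous_const.prodMk continuous_id)).measurable
  dsimp only
  rw [lintegral_prod _ hGℓ.aemeasurable]
  dsimp only
  rcases le_or_gt ℓ 0 with hℓ | hℓ
  · rw [gammaKernel_of_nonpos _ hℓ]
    simp [hG, lueDensity_blockHerm_of_nonpos hℓ]
  have hin : Measurable fun u : Fin n → ℂ => ∫⁻ W, G (blockHerm ℓ u W) ∂hermVolume n :=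
    hGℓ.lintegral_prod_right'
  rw [lintegral_scale_sqrt hℓ hin]
  have hshift : ∀ u : Fin n → ℂ,
      ∫⁻ W, G (blockHerm ℓ (fun k => (Real.sqrt ℓ : ℂ) * u k) W) ∂hermVolume n =
      ∫⁻ W, G (blockHerm ℓ (fun k => (Real.sqrt ℓ : ℂ) * u k) (W + outerHerm u)) ∂hermVolume n :=
    fun u => (lintegral_hermVolume_add_right
      (fun W => G (blockHerm ℓ (fun k => (Real.sqrt ℓ : ℂ) * u k) W)) (outerHerm u)).symm
  simp only [hshift]
  have hcont : Continuous fun p : (Fin n → ℂ) × Herm n =>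
      blockHerm ℓ (fun k => (Real.sqrt ℓ : ℂ) * p.1 k) (p.2 + outerHerm p.1) := by
    refine continuous_blockHerm.comp (continuous_const.prodMk (Continuous.prodMk ?_ ?_))
    · fun_prop
    · exact continuous_snd.add (continuous_outerHerm.comp continuous_fst)
  have hGm2 : Measurable fun p : (Fin n → ℂ) × Herm n =>
      G (blockHerm ℓ (fun k => (Real.sqrt ℓ : ℂ) * p.1 k) (p.2 + outerHerm p.1)) :=
    hGm.comp hcont.measurable
  have hFm2 : Measurable fun p : (Fin n → ℂ) × Herm n =>
      F (blockHerm ℓ (fun k => (Real.sqrt ℓ : ℂ) * p.1 k) (p.2 + outerHerm p.1)) :=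
    hF.comp hcont.measurable
  have hgm : Measurable fun p : (Fin n → ℂ) × Herm n => ENNReal.ofReal (gaussDensity p.1) :=
    (measurable_gaussDensity.comp measurable_fst).ennreal_ofReal
  have hgF : Measurable fun p : (Fin n → ℂ) × Herm n => ENNReal.ofReal (gaussDensity p.1) *
      F (blockHerm ℓ (fun k => (Real.sqrt ℓ : ℂ) * p.1 k) (p.2 + outerHerm p.1)) := hgm.mul hFm2
  have hgF' : Measurable fun W : Herm n => ∫⁻ u : Fin n → ℂ, ENNReal.ofReal (gaussDensity u) *
      F (blockHerm ℓ (fun k => (Real.sqrt ℓ : ℂ) * u k) (W + outerHerm u)) :=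
    hgF.lintegral_prod_left'
  have hG' : Measurable fun W : Herm n => ∫⁻ u : Fin n → ℂ,
      G (blockHerm ℓ (fun k => (Real.sqrt ℓ : ℂ) * u k) (W + outerHerm u)) :=
    hGm2.lintegral_prod_left'
  rw [lintegral_lintegral_swap hGm2.aemeasurable, lueLaw,
    lintegral_withDensity_eq_lintegral_mul _ hdn hgF', ← lintegral_const_mul _ hG',
    ← lintegral_const_mul _ (hdn.mul hgF')]
  refine lintegral_congr fun W => ?_
  have hGW : Measurable fun u : Fin n → ℂ =>
      G (blockHerm ℓ (fun k => (Real.sqrt ℓ : ℂ) * u k) (W + outerHerm u)) :=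
    hGm2.of_uncurry_right (f := fun u W => G (blockHerm ℓ (fun k => (Real.sqrt ℓ : ℂ) * u k)
      (W + outerHerm u)))
  have hFW : Measurable fun u : Fin n → ℂ => ENNReal.ofReal (gaussDensity u) *
      F (blockHerm ℓ (fun k => (Real.sqrt ℓ : ℂ) * u k) (W + outerHerm u)) :=
    hgF.of_uncurry_right (f := fun u W => ENNReal.ofReal (gaussDensity u) *
      F (blockHerm ℓ (fun k => (Real.sqrt ℓ : ℂ) * u k) (W + outerHerm u)))
  rw [Pi.mul_apply, ← lintegral_const_mul _ hGW, ← lintegral_const_mul _ hFW,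
    ← lintegral_const_mul _ (hFW.const_mul _)]
  refine lintegral_congr fun u => ?_
  have hkey := lueDensity_blockHerm (α := α) hℓ u W
  have hgauss : 0 ≤ gaussDensity u := by
    have := Real.pi_pos
    exact div_nonneg (Finset.prod_nonneg fun _ _ => Real.exp_nonneg _) (by positivity)
  have hγ : 0 ≤ gammaKernel (α + n + 1) ℓ := gammaKernel_nonneg (by have := n.cast_nonneg (α := ℝ); linarith) ℓ
  have hpow : (0 : ℝ) ≤ ℓ ^ n := by positivity
  rw [← gaussDensity] at hkey
  simp only [hG]
  rw [← mul_assoc, ← ENNReal.ofReal_mul hpow, hkey, ENNReal.ofReal_mul hγ,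
    ENNReal.ofReal_mul hgauss]
  ring

end Recursion

/-! ### Eigenvalues of bordered matrices -/

section Bordered

variable {n : ℕ}

/-- The ordered eigenvalues of the matrix bordering `diag(w) + √rᵢ√rₖ` by the corner `x₀ + ℓ` and
the row `√ℓ √rₖ`; its secular polynomial has the nodes `x₀, w` and the weights `ℓ, r`. -/
def borderedEigs (x₀ ℓ : ℝ) (r w : Fin n → ℝ) : Fin (n + 1) → ℝ :=
  sortedEigs (blockHerm (x₀ + ℓ) (fun k => (Real.sqrt ℓ : ℂ) * (Real.sqrt (r k) : ℂ))
    (diagHerm w + outerHerm fun k => (Real.sqrt (r k) : ℂ)))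

lemma continuous_diagHerm : Continuous (diagHerm : (Fin n → ℝ) → Herm n) :=
  Continuous.subtype_mk (Continuous.matrix_diagonal (by fun_prop)) _

lemma measurable_borderedEigs (x₀ : ℝ) : Measurable
    fun p : (ℝ × (Fin n → ℝ)) × (Fin n → ℝ) => borderedEigs x₀ p.1.1 p.1.2 p.2 := by
  refine measurable_sortedEigs.comp (Continuous.measurable ?_)
  refine continuous_blockHerm.comp (Continuous.prodMk (by fun_prop) (Continuous.prodMk
    (by fun_prop) ?_))
  exact (continuous_diagHerm.comp continuous_snd).add (continuous_outerHerm.comp (by fun_prop))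

lemma measurable_borderedEigs_weights (x₀ ℓ : ℝ) (w : Fin n → ℝ) :
    Measurable fun r => borderedEigs x₀ ℓ r w := by
  have h : Measurable fun r : Fin n → ℝ => (((ℓ, r), w) : (ℝ × (Fin n → ℝ)) × (Fin n → ℝ)) := by
    fun_prop
  have h2 := (measurable_borderedEigs x₀).comp h
  exact h2

/-- The eigenvalues depend on the row `u` through the squared moduli of its entries only. -/
lemma sortedEigs_blockHerm_diag (x₀ : ℝ) {ℓ : ℝ} (hℓ : 0 ≤ ℓ) (w : Fin n → ℝ) (u : Fin n → ℂ) :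
    sortedEigs (blockHerm (x₀ + ℓ) (fun k => (Real.sqrt ℓ : ℂ) * u k) (diagHerm w + outerHerm u)) =
      borderedEigs x₀ ℓ (fun k => ‖u k‖ ^ 2) w := by
  refine sortedEigs_eq_of_charpoly_eq ?_
  rw [charpoly_blockHerm_diag x₀ hℓ w u, charpoly_blockHerm_diag x₀ hℓ w]
  simp

lemma borderedEigs_secularWeight {x₀ : ℝ} {w : Fin n → ℝ} {y : Fin (n + 1) → ℝ}
    (h : Interlaces (Fin.cons x₀ w : Fin (n + 1) → ℝ) y) :
    borderedEigs x₀ (secularWeight (Fin.cons x₀ w : Fin (n + 1) → ℝ) y 0)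
      (fun i => secularWeight (Fin.cons x₀ w : Fin (n + 1) → ℝ) y i.succ) w = y := by
  refine sortedEigs_eq_of_charpoly h.strictMono_right.monotone ?_
  rw [charpoly_blockHerm_diag x₀ (secularWeight_pos h 0).le w,
    ← secularPoly_secularWeight h.strictMono_left.injective]
  congr 2
  funext i
  refine Fin.cases ?_ (fun i => ?_) i
  · simp
  · simp [Real.sq_sqrt (secularWeight_pos h i.succ).le]

/-- Bordering `M` by a Gaussian vector `u`: the eigenvalues depend on `M` through its spectrum
only, and the squared moduli of the coordinates of `u` in an eigenbasis of `M` are independent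
exponential variables. -/
lemma lintegral_gauss_sortedEigs (x₀ : ℝ) {ℓ : ℝ} (hℓ : 0 ≤ ℓ) (M : Herm n)
    {F : (Fin (n + 1) → ℝ) → ℝ≥0∞} (hF : Measurable F) :
    ∫⁻ u : Fin n → ℂ, ENNReal.ofReal (gaussDensity u) *
        F (sortedEigs (blockHerm (x₀ + ℓ) (fun k => (Real.sqrt ℓ : ℂ) * u k) (M + outerHerm u))) =
      ∫⁻ r in {r : Fin n → ℝ | ∀ i, 0 < r i}, (∏ i, ENNReal.ofReal (Real.exp (-r i))) *
        F (borderedEigs x₀ ℓ r (sortedEigs M)) := by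
  obtain ⟨V, hV⟩ := exists_conjBy_diagHerm M
  generalize sortedEigs M = w at hV ⊢
  set H : (Fin n → ℂ) → ℝ≥0∞ := fun u =>
    F (sortedEigs (blockHerm (x₀ + ℓ) (fun k => (Real.sqrt ℓ : ℂ) * u k) (M + outerHerm u))) with hH
  have hHm : Measurable H := by
    refine hF.comp (measurable_sortedEigs.comp (Continuous.measurable ?_))
    refine continuous_blockHerm.comp (Continuous.prodMk (by fun_prop) (Continuous.prodMk
      (by fun_prop) ?_))
    exact continuous_const.add (continuous_outerHerm)
  -- conjugation by `1 ⊕ V` replaces `diag(w)` by `M` and `u` by `u V*`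
  have hrot : ∀ u, H (Matrix.vecMul u (star V.1)) = F (borderedEigs x₀ ℓ (fun k => ‖u k‖ ^ 2) w) :=
    fun u => by
      have hsmul : (fun k => (Real.sqrt ℓ : ℂ) * Matrix.vecMul u (star V.1) k) =
          Matrix.vecMul (fun k => (Real.sqrt ℓ : ℂ) * u k) (star V.1) :=
        (Matrix.smul_vecMul (Real.sqrt ℓ : ℂ) u (star V.1)).symm
      simp only [hH]
      rw [hsmul, hV, ← conjBy_outerHerm, ← conjBy_add, ← conjBy_liftUnitary_blockHerm,
        sortedEigs_eq_of_charpoly_eq (charpoly_conjBy _ _), sortedEigs_blockHerm_diag x₀ hℓ]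
  have hB : Measurable fun r : Fin n → ℝ => F (borderedEigs x₀ ℓ r w) :=
    hF.comp (measurable_borderedEigs_weights x₀ ℓ w)
  have hE : Measurable fun r : Fin n → ℝ => ∏ i, ENNReal.ofReal (Real.exp (-r i)) := by fun_prop
  have hK : Measurable fun r : Fin n → ℝ => (∏ i, ENNReal.ofReal (Real.exp (-r i))) *
      F (borderedEigs x₀ ℓ r w) := hE.mul hB
  have hKu : Measurable fun u : Fin n → ℂ => (∏ i, ENNReal.ofReal (Real.exp (-‖u i‖ ^ 2))) *
      F (borderedEigs x₀ ℓ (fun k => ‖u k‖ ^ 2) w) :=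
    hK.comp (by fun_prop : Measurable fun (u : Fin n → ℂ) k => ‖u k‖ ^ 2)
  have hpi := ENNReal.ofReal_pos.2 Real.pi_pos
  have hstep : ∀ u : Fin n → ℂ, ENNReal.ofReal (gaussDensity u) * H (Matrix.vecMul u (star V.1)) =
      (ENNReal.ofReal Real.pi ^ n)⁻¹ * ((∏ i, ENNReal.ofReal (Real.exp (-‖u i‖ ^ 2))) *
        F (borderedEigs x₀ ℓ (fun k => ‖u k‖ ^ 2) w)) := fun u => by
    rw [hrot, gaussDensity, div_eq_inv_mul, ENNReal.ofReal_mul (by positivity),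
      ENNReal.ofReal_prod_of_nonneg (fun _ _ => Real.exp_nonneg _),
      ENNReal.ofReal_inv_of_pos (by positivity), ENNReal.ofReal_pow Real.pi_pos.le, mul_assoc]
  calc _ = ∫⁻ u, ENNReal.ofReal (gaussDensity u) * H (Matrix.vecMul u (star V.1)) :=
        (lintegral_gauss_vecMul V hHm).symm
    _ = (ENNReal.ofReal Real.pi ^ n)⁻¹ * ∫⁻ u : Fin n → ℂ,
          (∏ i, ENNReal.ofReal (Real.exp (-‖u i‖ ^ 2))) *
            F (borderedEigs x₀ ℓ (fun k => ‖u k‖ ^ 2) w) := by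
        rw [← lintegral_const_mul _ hKu]
        exact lintegral_congr hstep
    _ = _ := by
        rw [lintegral_norm_sq hK, ← mul_assoc, ENNReal.inv_mul_cancel, one_mul]
        · exact pow_ne_zero n hpi.ne'
        · exact ENNReal.pow_ne_top ENNReal.ofReal_ne_top

end Bordered

/-! ### Change of variables for bordered matrices -/

section SecularTransform

variable {n : ℕ}

lemma measurable_cons (x₀ : ℝ) : Measurable fun w : Fin n → ℝ => (Fin.cons x₀ w : Fin (n + 1) → ℝ) :=
  measurable_pi_lambda _ fun i => by
    refine Fin.cases ?_ (fun i => ?_) i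
    · simp
    · simpa using measurable_pi_apply i

lemma measurable_secularWeight (i : Fin n) :
    Measurable fun p : (Fin n → ℝ) × (Fin n → ℝ) => secularWeight p.1 p.2 i := by
  unfold secularWeight
  fun_prop

lemma measurable_secularWeight_cons (x₀ : ℝ) (i : Fin (n + 1)) :
    Measurable fun p : (Fin n → ℝ) × (Fin (n + 1) → ℝ) =>
      secularWeight (Fin.cons x₀ p.1 : Fin (n + 1) → ℝ) p.2 i := by
  have h : Measurable fun p : (Fin n → ℝ) × (Fin (n + 1) → ℝ) =>
      ((Fin.cons x₀ p.1 : Fin (n + 1) → ℝ), p.2) :=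
    ((measurable_cons x₀).comp measurable_fst).prodMk measurable_snd
  have h2 := (measurable_secularWeight i).comp h
  exact h2

lemma measurableSet_interlaces_cons (x₀ : ℝ) : MeasurableSet
    {p : (Fin n → ℝ) × (Fin (n + 1) → ℝ) | Interlaces (Fin.cons x₀ p.1 : Fin (n + 1) → ℝ) p.2} := by
  have hc : ∀ i : Fin (n + 1), Measurable fun p : (Fin n → ℝ) × (Fin (n + 1) → ℝ) =>
      (Fin.cons x₀ p.1 : Fin (n + 1) → ℝ) i := fun i =>
    (measurable_pi_apply i).comp ((measurable_cons x₀).comp measurable_fst)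
  have hy : ∀ i : Fin (n + 1), Measurable fun p : (Fin n → ℝ) × (Fin (n + 1) → ℝ) => p.2 i :=
    fun i => (measurable_pi_apply i).comp measurable_snd
  refine MeasurableSet.inter (MeasurableSet.congr (MeasurableSet.iInter fun i =>
    measurableSet_lt (hc i) (hy i)) ?_) (MeasurableSet.congr (MeasurableSet.iInter fun i =>
    MeasurableSet.iInter fun k => MeasurableSet.iInter fun (_ : i < k) =>
    measurableSet_lt (hy i) (hc k)) ?_)
  · ext p
    simp only [Set.mem_iInter]
    exact Iff.rfl
  · ext p
    simp only [Set.mem_iInter]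
    exact Iff.rfl

lemma lintegral_orthant_succ {h : (Fin (n + 1) → ℝ) → ℝ≥0∞} (hh : Measurable h) :
    ∫⁻ r in {r : Fin (n + 1) → ℝ | ∀ i, 0 < r i}, h r =
      ∫⁻ ℓ in Set.Ioi (0 : ℝ), ∫⁻ r in {r : Fin n → ℝ | ∀ i, 0 < r i}, h (Fin.cons ℓ r) := by
  have hmp := (volume_preserving_piFinSuccAbove (fun _ : Fin (n + 1) => ℝ) 0).symm
  have hfun : ∀ p : ℝ × (Fin n → ℝ), (MeasurableEquiv.piFinSuccAbove (fun _ : Fin (n + 1) => ℝ) 0).symm p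
      = Fin.cons p.1 p.2 := fun p => by
    simp [MeasurableEquiv.piFinSuccAbove, Fin.insertNthEquiv]
  have hset : (MeasurableEquiv.piFinSuccAbove (fun _ : Fin (n + 1) => ℝ) 0).symm ⁻¹'
      {r : Fin (n + 1) → ℝ | ∀ i, 0 < r i} = Set.Ioi 0 ×ˢ {r : Fin n → ℝ | ∀ i, 0 < r i} := by
    ext p
    rw [Set.mem_preimage, hfun]
    simp [Fin.forall_fin_succ]
  have hcons : Measurable fun p : ℝ × (Fin n → ℝ) => h (Fin.cons p.1 p.2) := by
    have := hh.comp hmp.measurable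
    exact (funext fun p => congrArg h (hfun p) : (fun p => h _) = _) ▸ this
  rw [← hmp.setLIntegral_comp_preimage_emb (MeasurableEquiv.measurableEmbedding _), hset,
    Measure.volume_eq_prod, ← Measure.prod_restrict]
  simp only [hfun]
  rw [lintegral_prod _ hcons.aemeasurable]

/-- For fixed nodes `x₀ < w₁ < ⋯ < wₙ`, the change of variables from the weights `(ℓ, r)` to the
eigenvalues of the bordered matrix. -/
lemma lintegral_borderedEigs (b : ℝ) {x₀ : ℝ} {w : Fin n → ℝ}
    (hw : StrictMono (Fin.cons x₀ w : Fin (n + 1) → ℝ))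
    {F : (Fin (n + 1) → ℝ) → ℝ≥0∞} (hF : Measurable F) :
    ∫⁻ ℓ in Set.Ioi (0 : ℝ), ENNReal.ofReal (gammaKernel b ℓ) *
        ∫⁻ r in {r : Fin n → ℝ | ∀ i, 0 < r i}, (∏ i, ENNReal.ofReal (Real.exp (-r i))) *
          F (borderedEigs x₀ ℓ r w) =
      ∫⁻ y in {y | Interlaces (Fin.cons x₀ w : Fin (n + 1) → ℝ) y},
        ENNReal.ofReal (vandermondeProd y / vandermondeProd (Fin.cons x₀ w : Fin (n + 1) → ℝ)) *
        (ENNReal.ofReal (gammaKernel b (secularWeight (Fin.cons x₀ w : Fin (n + 1) → ℝ) y 0)) *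
          ∏ i : Fin n, ENNReal.ofReal (Real.exp
            (-secularWeight (Fin.cons x₀ w : Fin (n + 1) → ℝ) y i.succ))) * F y := by
  set h : (Fin (n + 1) → ℝ) → ℝ≥0∞ := fun r => ENNReal.ofReal (gammaKernel b (r 0)) *
    ((∏ i : Fin n, ENNReal.ofReal (Real.exp (-r i.succ))) *
      F (borderedEigs x₀ (r 0) (fun i => r i.succ) w)) with hh
  have hB : Measurable fun r : Fin (n + 1) → ℝ => borderedEigs x₀ (r 0) (fun i => r i.succ) w := by
    have h1 : Measurable fun r : Fin (n + 1) → ℝ =>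
        (((r 0, fun i => r i.succ), w) : (ℝ × (Fin n → ℝ)) × (Fin n → ℝ)) := by fun_prop
    have h2 := (measurable_borderedEigs x₀).comp h1
    exact h2
  have hm : Measurable h :=
    (((measurable_gammaKernel b).comp (measurable_pi_apply 0)).ennreal_ofReal).mul
      ((by fun_prop : Measurable fun r : Fin (n + 1) → ℝ =>
        ∏ i : Fin n, ENNReal.ofReal (Real.exp (-r i.succ))).mul (hF.comp hB))
  have hL := lintegral_orthant_succ hm
  rw [lintegral_weights_eq_lintegral_interlaces hw] at hL
  have hE : Measurable fun r : Fin n → ℝ => ∏ i, ENNReal.ofReal (Real.exp (-r i)) := by fun_prop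
  calc _ = ∫⁻ ℓ in Set.Ioi (0 : ℝ), ∫⁻ r in {r : Fin n → ℝ | ∀ i, 0 < r i}, h (Fin.cons ℓ r) := by
        refine lintegral_congr fun ℓ => ?_
        have hK : Measurable fun r : Fin n → ℝ => (∏ i, ENNReal.ofReal (Real.exp (-r i))) *
            F (borderedEigs x₀ ℓ r w) := hE.mul (hF.comp (measurable_borderedEigs_weights x₀ ℓ w))
        rw [← lintegral_const_mul _ hK]
        refine lintegral_congr fun r => ?_
        simp [hh]
    _ = _ := by
        rw [← hL]
        refine setLIntegral_congr_fun (measurableSet_interlaces _) fun y hy => ?_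
        simp only [hh]
        rw [borderedEigs_secularWeight hy]
        ring

end SecularTransform

/-! ### Ordered eigenvalues of a diagonal matrix plus an LUE matrix -/

section Induction

variable {n : ℕ}

/-- The density at `y` of the eigenvalues of the bordered matrix with the nodes `x₀, w`, for a
Gamma weight of shape `b` at `x₀` and exponential weights at the other nodes. -/
def interlacingKernel (b x₀ : ℝ) (w : Fin n → ℝ) (y : Fin (n + 1) → ℝ) : ℝ≥0∞ :=
  ENNReal.ofReal (vandermondeProd y / vandermondeProd (Fin.cons x₀ w : Fin (n + 1) → ℝ)) *
    (ENNReal.ofReal (gammaKernel b (secularWeight (Fin.cons x₀ w : Fin (n + 1) → ℝ) y 0)) *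
      ∏ i : Fin n, ENNReal.ofReal (Real.exp
        (-secularWeight (Fin.cons x₀ w : Fin (n + 1) → ℝ) y i.succ)))

lemma measurable_interlacingKernel (b x₀ : ℝ) :
    Measurable fun p : (Fin n → ℝ) × (Fin (n + 1) → ℝ) => interlacingKernel b x₀ p.1 p.2 := by
  have hV : Measurable fun p : (Fin n → ℝ) × (Fin (n + 1) → ℝ) =>
      vandermondeProd (Fin.cons x₀ p.1 : Fin (n + 1) → ℝ) :=
    measurable_vandermondeProd.comp ((measurable_cons x₀).comp measurable_fst)
  refine ((measurable_vandermondeProd.comp measurable_snd).div hV).ennreal_ofReal.mul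
    (((measurable_gammaKernel b).comp (measurable_secularWeight_cons x₀ 0)).ennreal_ofReal.mul
      (Finset.measurable_fun_prod _ fun i _ => ?_))
  exact (Real.measurable_exp.comp (measurable_secularWeight_cons x₀ i.succ).neg).ennreal_ofReal

lemma lintegral_eq_setLIntegral_Ioi {f : ℝ → ℝ≥0∞} (hf : ∀ ℓ ≤ 0, f ℓ = 0) :
    ∫⁻ ℓ, f ℓ = ∫⁻ ℓ in Set.Ioi (0 : ℝ), f ℓ := by
  rw [← lintegral_indicator measurableSet_Ioi]
  refine lintegral_congr fun ℓ => ?_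
  by_cases h : 0 < ℓ
  · rw [Set.indicator_of_mem (Set.mem_Ioi.2 h)]
  · rw [Set.indicator_of_notMem (by simpa using h), hf ℓ (not_lt.1 h)]

/-- The effect of bordering on an LUE matrix, in terms of the ordered eigenvalues of the
smaller matrix `diag(x) + W`. -/
lemma lintegral_lueLaw_succ_sortedEigs {α : ℝ} (hα : -1 < α) (x₀ : ℝ) (x : Fin n → ℝ)
    {F : (Fin (n + 1) → ℝ) → ℝ≥0∞} (hF : Measurable F) :
    ∫⁻ A, F (sortedEigs (diagHerm (Fin.cons x₀ x : Fin (n + 1) → ℝ) + A)) ∂lueLaw (n + 1) α =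
      ∫⁻ ℓ in Set.Ioi (0 : ℝ), ENNReal.ofReal (gammaKernel (α + n + 1) ℓ) *
        ∫⁻ W, (∫⁻ r in {r : Fin n → ℝ | ∀ i, 0 < r i}, (∏ i, ENNReal.ofReal (Real.exp (-r i))) *
          F (borderedEigs x₀ ℓ r (sortedEigs (diagHerm x + W)))) ∂lueLaw n α := by
  have hm : Measurable fun A : Herm (n + 1) =>
      F (sortedEigs (diagHerm (Fin.cons x₀ x : Fin (n + 1) → ℝ) + A)) :=
    hF.comp (measurable_sortedEigs.comp (continuous_const.add continuous_id).measurable)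
  rw [lintegral_lueLaw_succ hα hm, lintegral_eq_setLIntegral_Ioi fun ℓ hℓ => by
    rw [gammaKernel_of_nonpos _ hℓ, ENNReal.ofReal_zero, zero_mul]]
  refine setLIntegral_congr_fun measurableSet_Ioi fun ℓ hℓ => ?_
  congr 1
  refine lintegral_congr fun W => ?_
  rw [← lintegral_gauss_sortedEigs x₀ (le_of_lt hℓ) _ hF]
  refine lintegral_congr fun u => ?_
  rw [diagHerm_cons, blockHerm_add, zero_add, add_assoc]

lemma measurable_lintegral_borderedEigs (x₀ : ℝ) {F : (Fin (n + 1) → ℝ) → ℝ≥0∞}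
    (hF : Measurable F) : Measurable fun p : ℝ × (Fin n → ℝ) =>
      ∫⁻ r in {r : Fin n → ℝ | ∀ i, 0 < r i}, (∏ i, ENNReal.ofReal (Real.exp (-r i))) *
        F (borderedEigs x₀ p.1 r p.2) := by
  have h1 : Measurable fun q : (ℝ × (Fin n → ℝ)) × (Fin n → ℝ) =>
      (((q.1.1, q.2), q.1.2) : (ℝ × (Fin n → ℝ)) × (Fin n → ℝ)) := by fun_prop
  have h2 := (measurable_borderedEigs x₀).comp h1
  have h3 : Measurable fun q : (ℝ × (Fin n → ℝ)) × (Fin n → ℝ) =>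
      ∏ i, ENNReal.ofReal (Real.exp (-q.2 i)) := by fun_prop
  have h4 := (h3.mul (hF.comp h2)).lintegral_prod_right' (ν := volume.restrict
    {r : Fin n → ℝ | ∀ i, 0 < r i})
  exact h4

/-- Adding a positive definite matrix raises the smallest eigenvalue: the density vanishes where
`w₀ ≤ x₀`. -/
lemma chamberDensity_eq_zero_of_not_strictMono_cons (b : ℝ) {x₀ : ℝ} {x w : Fin n → ℝ}
    (hx : StrictMono (Fin.cons x₀ x : Fin (n + 1) → ℝ)) (hw : StrictMono w)
    (h : ¬ StrictMono (Fin.cons x₀ w : Fin (n + 1) → ℝ)) : chamberDensity b x w = 0 := by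
  rcases n with _ | n
  · exact absurd (fun i k hik => absurd hik (by omega)) h
  · have hx' := strictMono_vecCons.1 hx
    have hwx : w 0 ≤ x 0 := by
      by_contra! hlt
      exact h (strictMono_vecCons.2 ⟨hx'.1.trans hlt, hw⟩)
    rw [chamberDensity, kernelDet_eq_zero b hx'.2.monotone hwx, mul_zero]

/-- For `x` increasing, the ordered eigenvalues of `diag(x) + L`, with `L` an LUE matrix of
parameter `α`, have the density `chamberDensity (α + n) x`. The nonnegativity of the kernel
determinant is part of the induction: it makes `ENNReal.ofReal` of the density faithful. -/
theorem lintegral_sortedEigs_diagHerm_add {α : ℝ} (hα : -1 < α) : ∀ (n : ℕ) {x : Fin n → ℝ},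
    StrictMono x → (∀ y : Fin n → ℝ, StrictMono y → 0 ≤ kernelDet (α + n) x y) ∧
      ∀ F : (Fin n → ℝ) → ℝ≥0∞, Measurable F →
        ∫⁻ A, F (sortedEigs (diagHerm x + A)) ∂lueLaw n α =
          ∫⁻ y in {y : Fin n → ℝ | StrictMono y},
            ENNReal.ofReal (chamberDensity (α + n) x y) * F y
  | 0, x, _ => by
    refine ⟨fun y _ => by simp [kernelDet], fun F hF => ?_⟩
    have huniv : {y : Fin 0 → ℝ | StrictMono y} = Set.univ := by
      ext y
      simp [StrictMono]
    have hdens : ∀ A : Herm 0, lueDensity 0 α A = 1 := fun A => by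
      have hpd : A.1.PosDef := (posDef_iff_sortedEigs_pos A).2 fun j => j.elim0
      rw [lueDensity, if_pos hpd]
      simp [Matrix.trace]
    have hone : ∀ {ι E : Type} [Fintype ι] [IsEmpty ι] [MeasureSpace E]
        [SigmaFinite (volume : Measure E)], (volume : Measure (ι → E)) Set.univ = 1 := by
      intros
      rw [volume_pi, Measure.pi_of_empty]
      simp
    have hvol : hermVolume 0 Set.univ = 1 := by
      rw [hermVolume, Measure.map_apply continuous_hermOfCoords.measurable MeasurableSet.univ,
        Set.preimage_univ, Measure.volume_eq_prod, ← Set.univ_prod_univ, Measure.prod_prod,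
        hone, hone, one_mul]
    have hc : ∀ A, F (sortedEigs (diagHerm x + A)) = F x := fun A =>
      congrArg F (Subsingleton.elim _ _)
    have hc2 : ∀ y, F y = F x := fun y => congrArg F (Subsingleton.elim _ _)
    rw [huniv, Measure.restrict_univ, lueLaw]
    simp only [hdens, hc, hc2, ENNReal.ofReal_one]
    simp [hvol, hone, chamberDensity, kernelDet, vandermondeProd]
  | n + 1, x, hx => by
    obtain ⟨x₀, x, rfl⟩ : ∃ x₀ x', x = Fin.cons x₀ x' := ⟨_, _, (Fin.cons_self_tail x).symm⟩
    have hx' : StrictMono x := fun i k hik => by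
      simpa using hx (Fin.succ_lt_succ_iff.2 hik)
    obtain ⟨hpos, hIH⟩ := lintegral_sortedEigs_diagHerm_add hα n hx'
    have hb : n ≠ 0 → 0 < α + n := fun hn => by
      have : (1 : ℝ) ≤ n := by exact_mod_cast Nat.one_le_iff_ne_zero.2 hn
      linarith
    have hb1 : 0 < α + n + 1 := by
      have := n.cast_nonneg (α := ℝ)
      linarith
    have hstep := fun y (hy : StrictMono y) => lintegral_chamberDensity_step hb hb1 hx hpos hy
    have hcast : α + ((n + 1 : ℕ) : ℝ) = α + n + 1 := by push_cast; ring
    rw [hcast]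
    refine ⟨fun y hy => (hstep y hy).1, fun F hF => ?_⟩
    set Φ : ℝ → (Fin n → ℝ) → ℝ≥0∞ := fun ℓ w => ∫⁻ r in {r : Fin n → ℝ | ∀ i, 0 < r i},
      (∏ i, ENNReal.ofReal (Real.exp (-r i))) * F (borderedEigs x₀ ℓ r w) with hΦ
    have hΦm : Measurable fun p : ℝ × (Fin n → ℝ) => Φ p.1 p.2 :=
      measurable_lintegral_borderedEigs x₀ hF
    have hcd : Measurable fun w : Fin n → ℝ => ENNReal.ofReal (chamberDensity (α + n) x w) :=
      ((measurable_chamberDensity (α + n)).comp measurable_prodMk_left).ennreal_ofReal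
    have hγ : Measurable fun ℓ : ℝ => ENNReal.ofReal (gammaKernel (α + n + 1) ℓ) :=
      (measurable_gammaKernel _).ennreal_ofReal
    -- the joint density of the eigenvalues `w` of `diag(x') + W` and the eigenvalues `y` of the
    -- bordered matrix, times `F y`; the two pairs of integrations are exchanged below
    set I : Set ((Fin n → ℝ) × (Fin (n + 1) → ℝ)) :=
      {p | Interlaces (Fin.cons x₀ p.1 : Fin (n + 1) → ℝ) p.2} with hI
    have hIm : MeasurableSet I := measurableSet_interlaces_cons x₀
    set J : (Fin n → ℝ) × (Fin (n + 1) → ℝ) → ℝ≥0∞ := I.indicator fun p =>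
      ENNReal.ofReal (chamberDensity (α + n) x p.1) *
        (interlacingKernel (α + n + 1) x₀ p.1 p.2 * F p.2) with hJ
    have hJm : Measurable J := ((hcd.comp measurable_fst).mul
      ((measurable_interlacingKernel _ x₀).mul (hF.comp measurable_snd))).indicator hIm
    calc _ = ∫⁻ ℓ in Set.Ioi (0 : ℝ), ENNReal.ofReal (gammaKernel (α + n + 1) ℓ) *
          ∫⁻ W, Φ ℓ (sortedEigs (diagHerm x + W)) ∂lueLaw n α :=
        lintegral_lueLaw_succ_sortedEigs hα x₀ x hF
      _ = ∫⁻ ℓ in Set.Ioi (0 : ℝ), ∫⁻ w in {w : Fin n → ℝ | StrictMono w},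
          ENNReal.ofReal (gammaKernel (α + n + 1) ℓ) *
            (ENNReal.ofReal (chamberDensity (α + n) x w) * Φ ℓ w) := by
        refine lintegral_congr fun ℓ => ?_
        have hΦℓ : Measurable (Φ ℓ) := hΦm.of_uncurry_left
        have hm : Measurable fun w => ENNReal.ofReal (chamberDensity (α + n) x w) * Φ ℓ w :=
          hcd.mul hΦℓ
        rw [hIH _ hΦℓ, lintegral_const_mul _ hm]
      _ = ∫⁻ w in {w : Fin n → ℝ | StrictMono w}, ∫⁻ ℓ in Set.Ioi (0 : ℝ),
          ENNReal.ofReal (gammaKernel (α + n + 1) ℓ) *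
            (ENNReal.ofReal (chamberDensity (α + n) x w) * Φ ℓ w) := by
        refine lintegral_lintegral_swap (Measurable.aemeasurable ?_)
        exact (hγ.comp measurable_fst).mul ((hcd.comp measurable_snd).mul hΦm)
      _ = ∫⁻ w in {w : Fin n → ℝ | StrictMono w}, ∫⁻ y, J (w, y) := by
        refine setLIntegral_congr_fun measurableSet_strictMono fun w hw => ?_
        have hΦw : Measurable fun ℓ => Φ ℓ w := hΦm.of_uncurry_right
        have hm : Measurable fun ℓ => ENNReal.ofReal (gammaKernel (α + n + 1) ℓ) * Φ ℓ w :=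
          hγ.mul hΦw
        simp only [mul_left_comm (ENNReal.ofReal (gammaKernel _ _))]
        rw [lintegral_const_mul _ hm]
        by_cases h : StrictMono (Fin.cons x₀ w : Fin (n + 1) → ℝ)
        · have hK : Measurable fun y => interlacingKernel (α + n + 1) x₀ w y * F y :=
            (measurable_interlacingKernel _ x₀).of_uncurry_left.mul hF
          have hJw : ∀ y, J (w, y) = {y | Interlaces (Fin.cons x₀ w : Fin (n + 1) → ℝ) y}.indicator
              (fun y => ENNReal.ofReal (chamberDensity (α + n) x w) *
                (interlacingKernel (α + n + 1) x₀ w y * F y)) y := fun y => rfl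
          simp only [hJw]
          rw [lintegral_indicator (measurableSet_interlaces _), lintegral_const_mul _ hK]
          congr 1
          exact lintegral_borderedEigs (α + n + 1) h hF
        · -- for `w` not to the right of `x₀` both sides vanish, as the density at `w` does
          have h0 : ∀ y, J (w, y) = 0 := fun y =>
            Set.indicator_of_notMem (s := I)
              (fun hy => h (Interlaces.strictMono_left (ξ := Fin.cons x₀ w) hy)) _
          simp [h0, chamberDensity_eq_zero_of_not_strictMono_cons (α + n) hx hw h]
      _ = ∫⁻ y, ∫⁻ w in {w : Fin n → ℝ | StrictMono w}, J (w, y) :=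
        lintegral_lintegral_swap hJm.aemeasurable
      _ = _ := by
        rw [← lintegral_indicator measurableSet_strictMono]
        refine lintegral_congr fun y => ?_
        by_cases hy : StrictMono y
        · rw [Set.indicator_of_mem (show y ∈ {y | StrictMono y} from hy), ← (hstep y hy).2]
          have hS : MeasurableSet {w : Fin n → ℝ | Interlaces (Fin.cons x₀ w : Fin (n + 1) → ℝ) y} :=
            measurable_prodMk_right hIm
          have hK : Measurable fun w => ENNReal.ofReal (chamberDensity (α + n) x w) *
              interlacingKernel (α + n + 1) x₀ w y :=
            hcd.mul (measurable_interlacingKernel _ x₀).of_uncurry_right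
          refine Eq.trans ?_ (lintegral_mul_const (F y) hK)
          rw [← lintegral_indicator hS, ← lintegral_indicator measurableSet_strictMono]
          refine lintegral_congr fun w => ?_
          by_cases hw : Interlaces (Fin.cons x₀ w : Fin (n + 1) → ℝ) y
          · have hwm : StrictMono w := fun i k hik => by
              simpa using hw.strictMono_left (Fin.succ_lt_succ_iff.2 hik)
            rw [Set.indicator_of_mem (show w ∈ {w | StrictMono w} from hwm), hJ,
              Set.indicator_of_mem (show (w, y) ∈ I from hw), Set.indicator_of_mem
                (show w ∈ {w | Interlaces (Fin.cons x₀ w : Fin (n + 1) → ℝ) y} from hw), mul_assoc]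
            rfl
          · rw [Set.indicator_of_notMem
              (show w ∉ {w | Interlaces (Fin.cons x₀ w : Fin (n + 1) → ℝ) y} from hw)]
            refine Set.indicator_apply_eq_zero.2 fun _ => ?_
            exact Set.indicator_of_notMem (s := I) (a := (w, y)) hw _
        · rw [Set.indicator_of_notMem (show y ∉ {y | StrictMono y} from hy)]
          have h0 : ∀ w, J (w, y) = 0 := fun w =>
            Set.indicator_of_notMem (s := I)
              (fun h => hy (Interlaces.strictMono_right (y := y) h)) _
          simp [h0]

end Induction

/-! ### Integrability of the functions of a polynomial ensemble -/

section Integrability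

variable {n : ℕ}

/-- The function `Δₙ(x) det [fₖ(xⱼ)]`. -/
def peProd (f : Fin n → ℝ → ℝ) (x : Fin n → ℝ) : ℝ :=
  vandermondeProd x * (Matrix.of fun j k => f k (x j)).det

lemma peProd_comp_perm (f : Fin n → ℝ → ℝ) (x : Fin n → ℝ) (σ : Equiv.Perm (Fin n)) :
    peProd f (x ∘ σ) = peProd f x := by
  have h : (Matrix.of fun j k => f k ((x ∘ σ) j)).det =
      (Equiv.Perm.sign σ : ℤ) * (Matrix.of fun j k => f k (x j)).det := by
    rw [← Matrix.det_permute]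
    rfl
  rw [peProd, peProd, h, vandermondeProd_comp_perm, mul_mul_mul_comm, ← Int.cast_mul,
    ← Units.val_mul, Int.units_mul_self]
  simp

lemma measurable_peProd {f : Fin n → ℝ → ℝ} (hf : ∀ k, Measurable (f k)) :
    Measurable (peProd f) := by
  refine measurable_vandermondeProd.mul ?_
  simp only [Matrix.det_apply']
  refine Finset.measurable_fun_sum _ fun σ _ => Measurable.const_mul
    (Finset.measurable_fun_prod _ fun i _ => ?_) _
  exact (hf i).comp (measurable_pi_apply _)

/-- Almost every section of an integrable function in one coordinate is integrable. -/
lemma ae_integrable_update {D : (Fin n → ℝ) → ℝ} (hD : Integrable D) (i : Fin n) :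
    ∀ᵐ x : Fin n → ℝ, Integrable fun t => D (Function.update x i t) := by
  obtain ⟨m, rfl⟩ : ∃ m, n = m + 1 := ⟨n - 1, by have := i.pos; omega⟩
  have hmp := volume_preserving_piFinSuccAbove (fun _ : Fin (m + 1) => ℝ) i
  have h1 : Integrable (fun p : ℝ × (Fin m → ℝ) => D (i.insertNth p.1 p.2))
      ((volume : Measure ℝ).prod volume) := by
    have := (hmp.symm).integrable_comp_emb (MeasurableEquiv.measurableEmbedding _) (g := D)
    exact this.2 hD
  have h2 : ∀ᵐ x' : Fin m → ℝ, Integrable fun t => D (i.insertNth t x') := h1.prod_left_ae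
  have h3 : Measure.QuasiMeasurePreserving (fun x : Fin (m + 1) → ℝ => i.removeNth x)
      volume volume :=
    Measure.quasiMeasurePreserving_snd.comp hmp.quasiMeasurePreserving
  filter_upwards [h3.ae h2] with x hx
  simpa only [Fin.insertNth_removeNth] using hx

/-- As a function of the coordinate `xᵢ = t`, the Vandermonde product is a constant multiple of the
product of the distances of `t` to the other coordinates. -/
lemma abs_peProd_update (f : Fin n → ℝ → ℝ) {x : Fin n → ℝ} (hx : Function.Injective x)
    (i : Fin n) : ∃ c : ℝ, 0 < c ∧ ∀ t, |peProd f (Function.update x i t)| =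
      c * (∏ k ∈ Finset.univ.erase i, |t - x k|) *
        |((Matrix.of fun j k => f k (x j)).updateRow i fun k => f k t).det| := by
  obtain ⟨m, rfl⟩ : ∃ m, n = m + 1 := ⟨n - 1, by have := i.pos; omega⟩
  have hinj : Function.Injective (i.removeNth x) := hx.comp (Fin.succAbove_right_injective)
  refine ⟨|vandermondeProd (i.removeNth x)|, ?_, fun t => ?_⟩
  · rw [abs_pos, vandermondeProd_eq_det, Matrix.det_vandermonde_ne_zero_iff]
    exact hinj
  · have hV : |vandermondeProd (Function.update x i t)| =
        |vandermondeProd (i.removeNth x)| * ∏ k ∈ Finset.univ.erase i, |t - x k| := by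
      rw [← Fin.insertNth_removeNth, ← Fin.cons_comp_cycleRange, vandermondeProd_comp_perm,
        vandermondeProd_cons, abs_mul, abs_mul, Finset.abs_prod, mul_comm (∏ _, _)]
      have hs : |((Equiv.Perm.sign i.cycleRange : ℤ) : ℝ)| = 1 := by
        rcases Int.units_eq_one_or (Equiv.Perm.sign i.cycleRange) with h | h <;> simp [h]
      rw [hs, one_mul]
      congr 1
      have he : Finset.univ.erase i = Finset.univ.image i.succAbove := by
        rw [Fin.image_succAbove_univ, Finset.compl_singleton]
      rw [he, Finset.prod_image fun a _ b _ h => Fin.succAbove_right_injective h]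
      exact Finset.prod_congr rfl fun k _ => abs_sub_comm _ _
    have hM : (Matrix.of fun j k => f k (Function.update x i t j)) =
        (Matrix.of fun j k => f k (x j)).updateRow i fun k => f k t := by
      ext j k
      rcases eq_or_ne j i with rfl | h
      · simp
      · simp [h]
    rw [peProd, abs_mul, hV, hM]

/-- Cramer's rule, in the form that expands a row `b` in the rows of `M`. -/
lemma det_mul_eq_sum_updateRow (M : Matrix (Fin n) (Fin n) ℝ) (b : Fin n → ℝ) (k : Fin n) :
    M.det * b k = ∑ i, M i k * (M.updateRow i b).det := by
  have h := congrFun (Matrix.mulVec_cramer M.transpose b) k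
  rw [Matrix.det_transpose, Pi.smul_apply, smul_eq_mul] at h
  rw [← h, Matrix.mulVec, dotProduct]
  exact Finset.sum_congr rfl fun i _ => by rw [Matrix.cramer_transpose_apply, Matrix.transpose_apply]

/-- A bounded weight that vanishes at the points `x` only. -/
def nodeWeight (x : Fin n → ℝ) (t : ℝ) : ℝ := ∏ k, min 1 |t - x k|

lemma nodeWeight_nonneg (x : Fin n → ℝ) (t : ℝ) : 0 ≤ nodeWeight x t :=
  Finset.prod_nonneg fun _ _ => le_min zero_le_one (abs_nonneg _)

lemma nodeWeight_le (x : Fin n → ℝ) (i : Fin n) (t : ℝ) :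
    nodeWeight x t ≤ ∏ k ∈ Finset.univ.erase i, |t - x k| := by
  rw [nodeWeight, ← Finset.mul_prod_erase _ _ (Finset.mem_univ i), ← one_mul (∏ _ ∈ _, |_|)]
  refine mul_le_mul (min_le_left _ _) (Finset.prod_le_prod
    (fun _ _ => le_min zero_le_one (abs_nonneg _)) fun _ _ => min_le_right _ _)
    (Finset.prod_nonneg fun _ _ => le_min zero_le_one (abs_nonneg _)) zero_le_one

lemma measurable_nodeWeight (x : Fin n → ℝ) : Measurable (nodeWeight x) := by
  unfold nodeWeight; fun_prop

/-- If all the sections of `Δₙ(x) det [fₖ(xⱼ)]` through a nondegenerate point `x` are integrable,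
then each `fₖ` is integrable away from the coordinates of `x`. -/
lemma integrable_mul_nodeWeight {f : Fin n → ℝ → ℝ} (hf : ∀ k, Measurable (f k)) {x : Fin n → ℝ}
    (hx : Function.Injective x) (hdet : (Matrix.of fun j k => f k (x j)).det ≠ 0)
    (hint : ∀ i, Integrable fun t => peProd f (Function.update x i t)) (k : Fin n) :
    Integrable fun t => f k t * nodeWeight x t := by
  set M : Matrix (Fin n) (Fin n) ℝ := Matrix.of fun j k => f k (x j) with hM
  have hdm : ∀ i, Measurable fun t => (M.updateRow i fun k => f k t).det := fun i => by
    simp only [Matrix.det_apply']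
    refine Finset.measurable_fun_sum _ fun σ _ => Measurable.const_mul
      (Finset.measurable_fun_prod _ fun j _ => ?_) _
    rcases eq_or_ne (σ j) i with h | h
    · simpa [Matrix.updateRow_apply, h] using hf j
    · simp [Matrix.updateRow_apply, h]
  have hi : ∀ i, Integrable fun t => (M.updateRow i fun k => f k t).det * nodeWeight x t :=
    fun i => by
      obtain ⟨c, hc, hci⟩ := abs_peProd_update f hx i
      refine Integrable.mono' ((hint i).abs.const_mul c⁻¹)
        ((hdm i).mul (measurable_nodeWeight x)).aestronglyMeasurable (Filter.Eventually.of_forall fun t => ?_)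
      rw [hci t, mul_assoc, inv_mul_cancel_left₀ hc.ne', Real.norm_eq_abs, abs_mul,
        abs_of_nonneg (nodeWeight_nonneg x t), mul_comm]
      exact mul_le_mul_of_nonneg_right (nodeWeight_le x i t) (abs_nonneg _)
  have hsum : (fun t => f k t * nodeWeight x t) = fun t => M.det⁻¹ * ∑ i, M i k *
      ((M.updateRow i fun k => f k t).det * nodeWeight x t) := by
    funext t
    have h := det_mul_eq_sum_updateRow M (fun k => f k t) k
    simp only [← mul_assoc]
    rw [← Finset.sum_mul, ← h]
    field_simp
  rw [hsum]
  exact (integrable_finsetSum _ fun i _ => (hi i).const_mul _).const_mul _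

/-- The functions of a polynomial ensemble are integrable: two nondegenerate points without common
coordinates control each other's exceptional sets. -/
lemma integrable_of_integrable_peProd {f : Fin n → ℝ → ℝ} (hf : ∀ k, Measurable (f k))
    (hD : Integrable (peProd f)) (h0 : ¬ ∀ᵐ x, peProd f x = 0) (k : Fin n) : Integrable (f k) := by
  set Good : (Fin n → ℝ) → Prop := fun x =>
    Function.Injective x ∧ ∀ i, Integrable fun t => peProd f (Function.update x i t) with hGood
  have hgood : ∀ᵐ x, Good x :=
    ae_injective.and (ae_all_iff.2 fun i => ae_integrable_update hD i)
  have hfreq : ∃ᵐ x, peProd f x ≠ 0 := fun h => h0 (h.mono fun x hx => not_not.1 hx)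
  obtain ⟨x, hx0, hxinj, hxi⟩ := (hfreq.and_eventually hgood).exists
  have hdisj : ∀ᵐ y : Fin n → ℝ, ∀ i j, x i ≠ y j := by
    refine ae_all_iff.2 fun i => ae_all_iff.2 fun j => ?_
    have h : Measure.QuasiMeasurePreserving (fun y : Fin n → ℝ => y j) volume volume :=
      Measure.quasiMeasurePreserving_eval _ j
    have h2 : ∀ᵐ t : ℝ, x i ≠ t := by
      rw [ae_iff]
      simp
    exact h.ae h2
  obtain ⟨y, hy0, ⟨hyinj, hyi⟩, hxy⟩ := (hfreq.and_eventually (hgood.and hdisj)).exists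
  have hx := integrable_mul_nodeWeight hf hxinj (right_ne_zero_of_mul hx0) hxi k
  have hy := integrable_mul_nodeWeight hf hyinj (right_ne_zero_of_mul hy0) hyi k
  -- every `t` is at distance at least `δ` from all `xᵢ` or from all `yⱼ`
  obtain ⟨δ, hδ, hδ1, hδxy⟩ : ∃ δ : ℝ, 0 < δ ∧ δ ≤ 1 ∧ ∀ i j, 2 * δ ≤ |x i - y j| := by
    have hev : ∀ᶠ δ : ℝ in nhdsWithin 0 (Set.Ioi 0), δ ≤ 1 ∧ ∀ i j, 2 * δ ≤ |x i - y j| := by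
      refine Filter.Eventually.and ?_ (Filter.eventually_all.2 fun i => Filter.eventually_all.2
        fun j => ?_)
      · exact (Filter.Eventually.filter_mono nhdsWithin_le_nhds (Iic_mem_nhds one_pos))
      · refine Filter.Eventually.filter_mono nhdsWithin_le_nhds ?_
        have : Filter.Tendsto (fun δ : ℝ => 2 * δ) (nhds 0) (nhds 0) := by
          simpa using (continuous_const_mul (2 : ℝ)).tendsto 0
        exact this.eventually (Iic_mem_nhds (abs_pos.2 (sub_ne_zero.2 (hxy i j))))
    obtain ⟨δ, h1, h2⟩ := (hev.and self_mem_nhdsWithin).exists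
    exact ⟨δ, h2, h1.1, h1.2⟩
  have hpow : ∀ (z : Fin n → ℝ) t, (∀ i, δ ≤ |t - z i|) → δ ^ n ≤ nodeWeight z t := fun z t h => by
    have := Finset.prod_le_prod (s := Finset.univ) (f := fun _ : Fin n => δ)
      (g := fun i => min 1 |t - z i|) (fun _ _ => hδ.le) fun i _ => le_min hδ1 (h i)
    simpa [nodeWeight] using this
  have hlow : ∀ t, δ ^ n ≤ nodeWeight x t + nodeWeight y t := fun t => by
    by_cases h : ∀ i, δ ≤ |t - x i|
    · linarith [hpow x t h, nodeWeight_nonneg y t]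
    · push Not at h
      obtain ⟨i, hi⟩ := h
      refine (hpow y t fun j => ?_).trans (le_add_of_nonneg_left (nodeWeight_nonneg x t))
      have h1 := abs_sub_le (x i) t (y j)
      rw [abs_sub_comm (x i) t] at h1
      linarith [hδxy i j]
  refine Integrable.mono' ((hx.abs.add hy.abs).const_mul (δ ^ n)⁻¹) (hf k).aestronglyMeasurable
    (Filter.Eventually.of_forall fun t => ?_)
  rw [Pi.add_apply, abs_mul, abs_mul, abs_of_nonneg (nodeWeight_nonneg x t),
    abs_of_nonneg (nodeWeight_nonneg y t), ← mul_add, Real.norm_eq_abs, inv_mul_eq_div,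
    le_div_iff₀ (pow_pos hδ n)]
  exact mul_le_mul_of_nonneg_left (hlow t) (abs_nonneg _)

end Integrability

/-! ### Convolution with the Gamma density and Andréief's identity -/

section Convolution

variable {n : ℕ}

lemma gammaKernel_mul_Gamma {b : ℝ} (hb : 0 < b) {t : ℝ} (ht : 0 < t) :
    t ^ (b - 1) * Real.exp (-t) = Real.Gamma b * gammaKernel b t := by
  have := (Real.Gamma_pos_of_pos hb).ne'
  rw [gammaKernel, posPow_of_pos ht]
  field_simp

lemma integrable_gammaKernel {b : ℝ} (hb : 0 < b) : Integrable (gammaKernel b) := by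
  have h := (Real.GammaIntegral_convergent hb).const_mul (Real.Gamma b)⁻¹
  rw [← IntegrableOn, ← integrable_indicator_iff measurableSet_Ioi] at h
  refine h.congr (Filter.Eventually.of_forall fun t => ?_)
  by_cases ht : 0 < t
  · rw [Set.indicator_of_mem (Set.mem_Ioi.2 ht), gammaKernel, posPow_of_pos ht]
    ring
  · rw [Set.indicator_of_notMem (by simpa using ht), gammaKernel_of_nonpos b (not_lt.1 ht)]

/-- The convolution of `f` with the Gamma density of shape `b`. -/
def gammaConv (b : ℝ) (f : ℝ → ℝ) (y : ℝ) : ℝ := ∫ t, gammaKernel b (y - t) * f t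

lemma ae_integrable_gammaKernel_mul {b : ℝ} (hb : 0 < b) {f : ℝ → ℝ} (hf : Integrable f) :
    ∀ᵐ y : ℝ, Integrable fun t => gammaKernel b (y - t) * f t := by
  have h := hf.ae_convolution_exists (ContinuousLinearMap.mul ℝ ℝ) (integrable_gammaKernel hb)
  filter_upwards [h] with y hy
  have h2 : Integrable fun t => f t * gammaKernel b (y - t) := hy
  simpa only [mul_comm] using h2

lemma integrableOn_lueTransform {α : ℝ} (hb : 0 < α + n) {f : ℝ → ℝ} {y : ℝ}
    (h : Integrable fun t => gammaKernel (α + n) (y - t) * f t) :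
    IntegrableOn (fun x : ℝ => x ^ (α + n - 1) * Real.exp (-x) * f (y - x)) (Set.Ioi 0) := by
  have h2 := ((h.comp_sub_left y).const_mul (Real.Gamma (α + n))).integrableOn (s := Set.Ioi 0)
  refine h2.congr_fun (fun x hx => ?_) measurableSet_Ioi
  simp only [sub_sub_cancel]
  rw [gammaKernel_mul_Gamma hb hx, mul_assoc]

lemma lueTransform_eq {α : ℝ} (hb : 0 < α + n) (f : ℝ → ℝ) (y : ℝ) :
    lueTransform n α f y = Real.Gamma (α + n) * gammaConv (α + n) f y := by
  rw [gammaConv, ← integral_sub_left_eq_self _ volume y, ← integral_const_mul,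
    ← setIntegral_eq_integral_of_forall_compl_eq_zero (s := Set.Ioi 0)]
  · refine setIntegral_congr_fun measurableSet_Ioi fun x hx => ?_
    simp only [sub_sub_cancel]
    rw [gammaKernel_mul_Gamma hb hx, mul_assoc]
  · intro x hx
    rw [sub_sub_cancel, gammaKernel_of_nonpos _ (by simpa using hx), zero_mul, mul_zero]

lemma measurable_lueTransform (α : ℝ) {f : ℝ → ℝ} (hf : Measurable f) :
    Measurable (lueTransform n α f) := by
  refine StronglyMeasurable.measurable ?_
  unfold lueTransform
  refine StronglyMeasurable.integral_prod_right (f := fun (y x : ℝ) =>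
    x ^ (α + n - 1) * Real.exp (-x) * f (y - x)) (Measurable.stronglyMeasurable ?_)
  have : Measurable fun p : ℝ × ℝ => f (p.1 - p.2) := hf.comp (by fun_prop)
  exact (by fun_prop : Measurable fun p : ℝ × ℝ => p.2 ^ (α + n - 1) * Real.exp (-p.2)).mul this

/-- Andréief's identity for the kernel `γ_b(y - t)`. -/
lemma integral_det_mul_kernelDet {b : ℝ} {f : Fin n → ℝ → ℝ} {y : Fin n → ℝ}
    (h : ∀ j k, Integrable fun t => gammaKernel b (y j - t) * f k t) :
    Integrable (fun x => (Matrix.of fun j k => f k (x j)).det * kernelDet b x y) ∧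
      ∫ x, (Matrix.of fun j k => f k (x j)).det * kernelDet b x y =
        n ! * (Matrix.of fun j k => gammaConv b (f k) (y j)).det := by
  have hexp : ∀ x : Fin n → ℝ, (Matrix.of fun j k => f k (x j)).det * kernelDet b x y =
      ∑ σ : Equiv.Perm (Fin n), ((Equiv.Perm.sign σ : ℤ) : ℝ) *
        (Matrix.of fun j k => gammaKernel b (y (σ j) - x j) * f k (x j)).det := fun x => by
    rw [kernelDet, Matrix.det_apply' (Matrix.of fun j k => gammaKernel b (y j - x k)),
      Finset.mul_sum]
    refine Finset.sum_congr rfl fun σ _ => ?_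
    rw [show (Matrix.of fun j k => gammaKernel b (y (σ j) - x j) * f k (x j)).det =
      (∏ j, gammaKernel b (y (σ j) - x j)) * (Matrix.of fun j k => f k (x j)).det from
      Matrix.det_mul_column _ _]
    simp only [Matrix.of_apply]
    ring
  have hσ := fun σ : Equiv.Perm (Fin n) => integral_det_eq_det_integral
    (fun _ : Fin n => (volume : Measure ℝ))
    (fun j k t => gammaKernel b (y (σ j) - t) * f k t) fun j k => h (σ j) k
  simp only [← volume_pi] at hσ
  simp only [hexp]
  refine ⟨integrable_finsetSum _ fun σ _ => (hσ σ).1.const_mul _, ?_⟩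
  rw [integral_finsetSum _ fun σ _ => (hσ σ).1.const_mul _]
  have hval : ∀ σ : Equiv.Perm (Fin n), ∫ x : Fin n → ℝ, ((Equiv.Perm.sign σ : ℤ) : ℝ) *
      (Matrix.of fun j k => gammaKernel b (y (σ j) - x j) * f k (x j)).det =
      (Matrix.of fun j k => gammaConv b (f k) (y j)).det := fun σ => by
    rw [integral_const_mul, (hσ σ).2]
    have : (Matrix.of fun j k => ∫ t, gammaKernel b (y (σ j) - t) * f k t).det =
        (Equiv.Perm.sign σ : ℤ) * (Matrix.of fun j k => gammaConv b (f k) (y j)).det := by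
      rw [← Matrix.det_permute]
      rfl
    rw [this, ← mul_assoc, ← Int.cast_mul, ← Units.val_mul, Int.units_mul_self]
    simp
  rw [Finset.sum_congr rfl fun σ _ => hval σ]
  simp [Fintype.card_perm]

end Convolution

/-! ### Symmetrization of the eigenvalue law -/

section Symmetrization

variable {n : ℕ}

/-- The average of `H` over the permutations of the coordinates. -/
def symmAvg (H : (Fin n → ℝ) → ℝ≥0∞) (y : Fin n → ℝ) : ℝ≥0∞ :=
  (n ! : ℝ≥0∞)⁻¹ * ∑ σ : Equiv.Perm (Fin n), H (y ∘ σ)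

lemma measurable_comp_perm (σ : Equiv.Perm (Fin n)) :
    Measurable fun y : Fin n → ℝ => y ∘ σ :=
  measurable_pi_lambda _ fun i => measurable_pi_apply (σ i)

lemma measurable_symmAvg {H : (Fin n → ℝ) → ℝ≥0∞} (hH : Measurable H) : Measurable (symmAvg H) :=
  Measurable.const_mul (Finset.measurable_fun_sum _ fun σ _ => hH.comp (measurable_comp_perm σ)) _

lemma symmAvg_comp_perm (H : (Fin n → ℝ) → ℝ≥0∞) (τ : Equiv.Perm (Fin n)) (y : Fin n → ℝ) :
    symmAvg H (y ∘ τ) = symmAvg H y := by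
  rw [symmAvg, symmAvg]
  congr 1
  exact Fintype.sum_equiv (Equiv.mulLeft τ) _ _ fun σ => rfl

lemma factorial_inv_mul_cancel : (n ! : ℝ≥0∞)⁻¹ * n ! = 1 :=
  ENNReal.inv_mul_cancel (by exact_mod_cast n.factorial_ne_zero) (ENNReal.natCast_ne_top _)

lemma symmAvg_of_symmetric {H : (Fin n → ℝ) → ℝ≥0∞}
    (hs : ∀ (σ : Equiv.Perm (Fin n)) y, H (y ∘ σ) = H y) : symmAvg H = H := by
  funext y
  simp only [symmAvg, hs, Finset.sum_const, Finset.card_univ, Fintype.card_perm, Fintype.card_fin,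
    nsmul_eq_mul]
  rw [← mul_assoc, factorial_inv_mul_cancel, one_mul]

/-- Against a symmetric function `q`, a function may be replaced by its average. -/
lemma lintegral_mul_symmAvg {q H : (Fin n → ℝ) → ℝ≥0∞} (hq : Measurable q) (hH : Measurable H)
    (hs : ∀ (σ : Equiv.Perm (Fin n)) y, q (y ∘ σ) = q y) :
    ∫⁻ y, q y * symmAvg H y = ∫⁻ y, q y * H y := by
  have h1 : ∀ σ : Equiv.Perm (Fin n), ∫⁻ y, q y * H (y ∘ σ) = ∫⁻ y, q y * H y := fun σ => by
    have h := (measurePreserving_comp_perm σ).lintegral_comp (hq.mul hH)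
    simpa [hs] using h
  have hm : ∀ σ : Equiv.Perm (Fin n), Measurable fun y => q y * H (y ∘ σ) := fun σ =>
    hq.mul (hH.comp (measurable_comp_perm σ))
  have h2 : ∀ y, q y * symmAvg H y =
      (n ! : ℝ≥0∞)⁻¹ * ∑ σ : Equiv.Perm (Fin n), q y * H (y ∘ σ) := fun y => by
    rw [symmAvg, mul_left_comm, Finset.mul_sum]
  simp only [h2]
  rw [lintegral_const_mul _ (Finset.measurable_fun_sum _ fun σ _ => hm σ),
    lintegral_finsetSum _ fun σ _ => hm σ]
  simp only [h1, Finset.sum_const, Finset.card_univ, Fintype.card_perm, Fintype.card_fin,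
    nsmul_eq_mul]
  rw [← mul_assoc, factorial_inv_mul_cancel, one_mul]

/-- The eigenvalue law tests a function through its symmetrization at the ordered eigenvalues. -/
lemma lintegral_eigenvalueLaw {Ω : Type*} [MeasurableSpace Ω] (P : Measure Ω) {X : Ω → Herm n}
    (hX : Measurable X) {H : (Fin n → ℝ) → ℝ≥0∞} (hH : Measurable H) :
    ∫⁻ y, H y ∂eigenvalueLaw P X = ∫⁻ ω, symmAvg H (sortedEigs (X ω)) ∂P := by
  have he : ∀ σ : Equiv.Perm (Fin n), Measurable fun ω j => eigs (X ω) (σ j) := fun σ =>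
    (measurable_comp_perm σ).comp (measurable_eigs.comp hX)
  have h1 : ∀ ω, symmAvg H (sortedEigs (X ω)) =
      (n ! : ℝ≥0∞)⁻¹ * ∑ σ : Equiv.Perm (Fin n), H fun j => eigs (X ω) (σ j) := fun ω =>
    (symmAvg_comp_perm H (eigOrder n) (eigs (X ω)))
  have hm : ∀ σ : Equiv.Perm (Fin n), Measurable fun ω => H fun j => eigs (X ω) (σ j) := fun σ =>
    hH.comp (he σ)
  simp only [h1]
  rw [eigenvalueLaw, lintegral_smul_measure, lintegral_finsetSum_measure, smul_eq_mul,
    lintegral_const_mul _ (Finset.measurable_fun_sum _ fun σ _ => hm σ),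
    lintegral_finsetSum _ fun σ _ => hm σ]
  congr 1
  exact Finset.sum_congr rfl fun σ _ => lintegral_map hH (he σ)

lemma lintegral_eigenvalueLaw_of_symmetric {Ω : Type*} [MeasurableSpace Ω] (P : Measure Ω)
    {X : Ω → Herm n} (hX : Measurable X) {H : (Fin n → ℝ) → ℝ≥0∞} (hH : Measurable H)
    (hs : ∀ (σ : Equiv.Perm (Fin n)) y, H (y ∘ σ) = H y) :
    ∫⁻ y, H y ∂eigenvalueLaw P X = ∫⁻ ω, H (sortedEigs (X ω)) ∂P := by
  rw [lintegral_eigenvalueLaw P hX hH, symmAvg_of_symmetric hs]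

/-- If the eigenvalue law has a density, the eigenvalues are almost surely distinct. -/
lemma ae_strictMono_sortedEigs {Ω : Type*} [MeasurableSpace Ω] {P : Measure Ω}
    {X : Ω → Herm n} (hX : Measurable X) (hac : eigenvalueLaw P X ≪ volume) :
    ∀ᵐ ω ∂P, StrictMono (sortedEigs (X ω)) := by
  have hS : MeasurableSet {y : Fin n → ℝ | ¬ Function.Injective y} := by
    have : {y : Fin n → ℝ | ¬ Function.Injective y} =
        ⋃ i, ⋃ k, ⋃ (_ : i ≠ k), {y : Fin n → ℝ | y i = y k} := by
      ext y
      simp only [Function.Injective, Set.mem_ofPred_eq, Set.mem_iUnion]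
      push Not
      exact ⟨fun ⟨i, k, h1, h2⟩ => ⟨i, k, h2, h1⟩, fun ⟨i, k, h2, h1⟩ => ⟨i, k, h1, h2⟩⟩
    rw [this]
    exact MeasurableSet.iUnion fun i => MeasurableSet.iUnion fun k => MeasurableSet.iUnion fun _ =>
      measurableSet_eq_fun (measurable_pi_apply i) (measurable_pi_apply k)
  have h0 : eigenvalueLaw P X {y | ¬ Function.Injective y} = 0 := hac (ae_iff.1 ae_injective)
  have h1 : ∫⁻ y, {y : Fin n → ℝ | ¬ Function.Injective y}.indicator 1 y ∂eigenvalueLaw P X = 0 := by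
    rw [lintegral_indicator_one hS, h0]
  have hm : Measurable ({y : Fin n → ℝ | ¬ Function.Injective y}.indicator (1 : (Fin n → ℝ) → ℝ≥0∞)) :=
    measurable_one.indicator hS
  have hm' : Measurable fun ω => {y : Fin n → ℝ | ¬ Function.Injective y}.indicator
      (1 : (Fin n → ℝ) → ℝ≥0∞) (sortedEigs (X ω)) := hm.comp (measurable_sortedEigs.comp hX)
  rw [lintegral_eigenvalueLaw_of_symmetric P hX hm, lintegral_eq_zero_iff hm'] at h1
  · filter_upwards [h1] with ω hω
    refine (monotone_sortedEigs (X ω)).strictMono_of_injective ?_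
    by_contra hc
    have : {y : Fin n → ℝ | ¬ Function.Injective y}.indicator (1 : (Fin n → ℝ) → ℝ≥0∞) (sortedEigs (X ω)) = 1 :=
      Set.indicator_of_mem (show sortedEigs (X ω) ∈ {y : Fin n → ℝ | ¬ Function.Injective y} from hc) _
    rw [Pi.zero_apply, this] at hω
    exact one_ne_zero hω
  · intro σ y
    have : Function.Injective (y ∘ σ) ↔ Function.Injective y :=
      ⟨fun h => by simpa [Function.comp_assoc] using h.comp σ.symm.injective, fun h => h.comp σ.injective⟩
    simp only [Set.indicator_apply, Set.mem_ofPred_eq, this, Pi.one_apply]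

end Symmetrization

/-! ### The transition operator of the addition of an LUE matrix -/

section Transition

variable {n : ℕ}

lemma kernelDet_comp_perm_left (b : ℝ) (σ : Equiv.Perm (Fin n)) (x y : Fin n → ℝ) :
    kernelDet b (x ∘ σ) y = (Equiv.Perm.sign σ : ℤ) * kernelDet b x y := by
  rw [kernelDet, kernelDet, ← Matrix.det_permute']
  rfl

lemma chamberDensity_comp_perm_left (b : ℝ) (σ : Equiv.Perm (Fin n)) (x y : Fin n → ℝ) :
    chamberDensity b (x ∘ σ) y = chamberDensity b x y := by
  rw [chamberDensity, chamberDensity, kernelDet_comp_perm_left, vandermondeProd_comp_perm]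
  rcases Int.units_eq_one_or (Equiv.Perm.sign σ) with h | h <;> simp [h, div_neg]

/-- The density is nonnegative for unordered `x` as well: the signs of the Vandermonde product and of
the kernel determinant under a permutation of `x` cancel. -/
lemma chamberDensity_nonneg {α : ℝ} (hα : -1 < α) {x y : Fin n → ℝ} (hx : Function.Injective x)
    (hy : StrictMono y) : 0 ≤ chamberDensity (α + n) x y := by
  have hs : StrictMono (x ∘ Tuple.sort x) := (strictMono_comp_perm_iff hx _).2 rfl
  rw [← chamberDensity_comp_perm_left _ (Tuple.sort x)]
  exact mul_nonneg (div_nonneg (vandermondeProd_pos hy).le (vandermondeProd_pos hs).le)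
    ((lintegral_sortedEigs_diagHerm_add hα n hs).1 y hy)

/-- The transition operator from the spectrum of `A` to the ordered spectrum of `A + L`. -/
def lueTransition (α : ℝ) (H : (Fin n → ℝ) → ℝ≥0∞) (x : Fin n → ℝ) : ℝ≥0∞ :=
  ∫⁻ y in {y : Fin n → ℝ | StrictMono y}, ENNReal.ofReal (chamberDensity (α + n) x y) * H y

lemma measurable_lueTransition (α : ℝ) {H : (Fin n → ℝ) → ℝ≥0∞} (hH : Measurable H) :
    Measurable (lueTransition α H) := by
  have h : Measurable fun p : (Fin n → ℝ) × (Fin n → ℝ) =>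
      ENNReal.ofReal (chamberDensity (α + n) p.1 p.2) * H p.2 :=
    (measurable_chamberDensity (α + n)).ennreal_ofReal.mul (hH.comp measurable_snd)
  have h2 := h.lintegral_prod_right' (ν := volume.restrict {y : Fin n → ℝ | StrictMono y})
  exact h2

/-- As the LUE is unitarily invariant, `A` may be replaced by the diagonal matrix of its ordered
eigenvalues. -/
lemma lintegral_sortedEigs_add {α : ℝ} (hα : -1 < α) {A : Herm n}
    (hA : StrictMono (sortedEigs A)) {H : (Fin n → ℝ) → ℝ≥0∞} (hH : Measurable H) :
    ∫⁻ L, H (sortedEigs (A + L)) ∂lueLaw n α = lueTransition α H (sortedEigs A) := by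
  obtain ⟨U, hU⟩ := exists_conjBy_diagHerm A
  have hm : Measurable fun L => H (sortedEigs (A + L)) :=
    hH.comp (measurable_sortedEigs.comp (continuous_const.add continuous_id).measurable)
  rw [← (measurePreserving_conjBy_lueLaw α U).lintegral_comp hm, lueTransition,
    ← (lintegral_sortedEigs_diagHerm_add hα n hA).2 H hH]
  refine lintegral_congr fun L => ?_
  congr 1
  refine sortedEigs_eq_of_charpoly_eq ?_
  rw [← charpoly_conjBy U (diagHerm (sortedEigs A) + L), conjBy_add, ← hU]

/-- The eigenvalue law of `X + L` in terms of the eigenvalue law of `X`. -/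
lemma lintegral_eigenvalueLaw_add {Ω : Type*} [MeasurableSpace Ω] {P : Measure Ω}
    [IsProbabilityMeasure P] {α : ℝ} (hα : -1 < α) {X L : Ω → Herm n} (hX : Measurable X)
    (hL : Measurable L) (hXL : IndepFun X L P) (hac : eigenvalueLaw P X ≪ volume)
    (hLUE : Measure.map L P = lueLaw n α) {H : (Fin n → ℝ) → ℝ≥0∞} (hH : Measurable H) :
    ∫⁻ y, H y ∂eigenvalueLaw P (fun ω => X ω + L ω) =
      ∫⁻ x, lueTransition α (symmAvg H) x ∂eigenvalueLaw P X := by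
  have hψ := measurable_symmAvg hH
  have hadd : Measurable fun p : Herm n × Herm n => p.1 + p.2 :=
    (continuous_fst.add continuous_snd).measurable
  have hsum : Measurable fun p : Herm n × Herm n => symmAvg H (sortedEigs (p.1 + p.2)) :=
    hψ.comp (measurable_sortedEigs.comp hadd)
  have hlaw : Measure.map (fun ω => (X ω, L ω)) P = (Measure.map X P).prod (lueLaw n α) := by
    rw [← hLUE]
    exact (indepFun_iff_map_prod_eq_prod_map_map hX.aemeasurable hL.aemeasurable).1 hXL
  have hXL' : Measurable fun ω => X ω + L ω := hadd.comp (hX.prodMk hL)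
  rw [lintegral_eigenvalueLaw P hXL' hH,
    lintegral_eigenvalueLaw_of_symmetric P hX (measurable_lueTransition α hψ)
      (fun σ x => by simp only [lueTransition, chamberDensity_comp_perm_left])]
  calc _ = ∫⁻ p, symmAvg H (sortedEigs (p.1 + p.2)) ∂(Measure.map (fun ω => (X ω, L ω)) P) :=
        (lintegral_map hsum (hX.prodMk hL)).symm
    _ = ∫⁻ A, ∫⁻ B, symmAvg H (sortedEigs (A + B)) ∂lueLaw n α ∂(Measure.map X P) := by
        rw [hlaw, lintegral_prod _ hsum.aemeasurable]
    _ = ∫⁻ ω, (∫⁻ B, symmAvg H (sortedEigs (X ω + B)) ∂lueLaw n α) ∂P :=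
        lintegral_map hsum.lintegral_prod_right' hX
    _ = _ := by
        refine lintegral_congr_ae ?_
        filter_upwards [ae_strictMono_sortedEigs hX hac] with ω hω
        exact lintegral_sortedEigs_add hα hω hψ

end Transition

/-! ### The density of the eigenvalues of the sum -/

section Density

variable {n : ℕ}

lemma peDensity_eq (Z : ℝ) (f : Fin n → ℝ → ℝ) (x : Fin n → ℝ) :
    peDensity Z f x = Z⁻¹ * peProd f x := by
  rw [peDensity, peProd, mul_assoc]

lemma peDensity_comp_perm (Z : ℝ) (f : Fin n → ℝ → ℝ) (x : Fin n → ℝ) (σ : Equiv.Perm (Fin n)) :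
    peDensity Z f (x ∘ σ) = peDensity Z f x := by
  rw [peDensity_eq, peDensity_eq, peProd_comp_perm]

lemma measurable_peDensity (Z : ℝ) {f : Fin n → ℝ → ℝ} (hf : ∀ k, Measurable (f k)) :
    Measurable (peDensity Z f) := by
  rw [funext (peDensity_eq Z f)]
  exact (measurable_peProd hf).const_mul _

/-- The functions of a polynomial ensemble are integrable. -/
lemma IsPE.integrable {Ω : Type*} [MeasurableSpace Ω] {P : Measure Ω} [IsProbabilityMeasure P]
    {X : Ω → Herm n} (hX : Measurable X) {f : Fin n → ℝ → ℝ} (h : IsPE P X f) (k : Fin n) :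
    Integrable (f k) := by
  obtain ⟨hf, Z, hZ, hnn, hlaw⟩ := h
  have hmass : ∫⁻ x, ENNReal.ofReal (peDensity Z f x) = 1 := by
    have h1 := lintegral_eigenvalueLaw_of_symmetric P hX (H := fun _ => 1) measurable_const
      fun _ _ => rfl
    rw [hlaw] at h1
    simpa using h1
  have hint : Integrable (peDensity Z f) :=
    ⟨(measurable_peDensity Z hf).aestronglyMeasurable,
      (hasFiniteIntegral_iff_ofReal hnn).2 (by rw [hmass]; exact ENNReal.one_lt_top)⟩
  have hprod : peProd f = fun x => Z * peDensity Z f x := by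
    funext x
    rw [peDensity_eq, mul_inv_cancel_left₀ hZ]
  refine integrable_of_integrable_peProd hf (hprod ▸ hint.const_mul Z) (fun h0 => ?_) k
  have hz : ∫⁻ x, ENNReal.ofReal (peDensity Z f x) = 0 := by
    rw [← lintegral_zero (μ := (volume : Measure (Fin n → ℝ)))]
    refine lintegral_congr_ae ?_
    filter_upwards [h0] with x hx
    rw [peDensity_eq, hx, mul_zero, ENNReal.ofReal_zero]
  exact one_ne_zero (hmass.symm.trans hz)

lemma det_lueTransform {α : ℝ} (hα : -1 < α) (f : Fin n → ℝ → ℝ) (y : Fin n → ℝ) :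
    (Matrix.of fun j k => lueTransform n α (f k) (y j)).det =
      Real.Gamma (α + n) ^ n * (Matrix.of fun j k => gammaConv (α + n) (f k) (y j)).det := by
  have h : (Matrix.of fun j k => lueTransform n α (f k) (y j)) =
      Real.Gamma (α + n) • (Matrix.of fun j k => gammaConv (α + n) (f k) (y j)) := by
    ext j k
    have hn : (1 : ℝ) ≤ n := by exact_mod_cast k.pos
    exact lueTransform_eq (by linarith) (f k) (y j)
  rw [h, Matrix.det_smul, Fintype.card_fin]

/-- For `n = 0` the argument of the Gamma function may be a pole, but the exponent is zero. -/
lemma Gamma_pow_ne_zero {α : ℝ} (hα : -1 < α) (n : ℕ) : Real.Gamma (α + n) ^ n ≠ 0 := by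
  rcases eq_or_ne n 0 with rfl | hn
  · simp
  · have hn1 : (1 : ℝ) ≤ n := by exact_mod_cast Nat.one_le_iff_ne_zero.2 hn
    exact pow_ne_zero n (Real.Gamma_pos_of_pos (by linarith)).ne'

/-- Averaging the transition density over the spectrum of `X` gives a polynomial ensemble. -/
lemma lintegral_peDensity_mul_chamberDensity {α : ℝ} (hα : -1 < α) {Z : ℝ} {f : Fin n → ℝ → ℝ}
    (hnn : ∀ᵐ x : Fin n → ℝ, 0 ≤ peDensity Z f x) {y : Fin n → ℝ} (hy : StrictMono y)
    (hint : ∀ j k, Integrable fun t => gammaKernel (α + n) (y j - t) * f k t) :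
    0 ≤ peDensity (Z * Real.Gamma (α + n) ^ n) (fun k => lueTransform n α (f k)) y ∧
      ∫⁻ x, ENNReal.ofReal (peDensity Z f x) * ENNReal.ofReal (chamberDensity (α + n) x y) =
        n ! * ENNReal.ofReal
          (peDensity (Z * Real.Gamma (α + n) ^ n) (fun k => lueTransform n α (f k)) y) := by
  set q := peDensity (Z * Real.Gamma (α + n) ^ n) (fun k => lueTransform n α (f k)) y with hq
  have hG := Gamma_pow_ne_zero hα n
  obtain ⟨hi, hval⟩ := integral_det_mul_kernelDet hint
  set r : (Fin n → ℝ) → ℝ := fun x => Z⁻¹ * vandermondeProd y *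
    ((Matrix.of fun j k => f k (x j)).det * kernelDet (α + n) x y) with hr
  have hri : Integrable r := hi.const_mul _
  have hrint : ∫ x, r x = n ! * q := by
    rw [integral_const_mul, hval, hq, peDensity, det_lueTransform hα, mul_inv]
    field_simp
  have hpt : ∀ᵐ x, peDensity Z f x * chamberDensity (α + n) x y = r x ∧ 0 ≤ peDensity Z f x ∧
      0 ≤ chamberDensity (α + n) x y := by
    filter_upwards [hnn, ae_injective] with x hx hxi
    refine ⟨?_, hx, chamberDensity_nonneg hα hxi hy⟩
    have hV : vandermondeProd x ≠ 0 := by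
      rw [vandermondeProd_eq_det]
      exact Matrix.det_vandermonde_ne_zero_iff.2 hxi
    rw [peDensity, chamberDensity, hr]
    field_simp
  have hr0 : 0 ≤ᵐ[volume] r := by
    filter_upwards [hpt] with x hx
    rw [Pi.zero_apply, ← hx.1]
    exact mul_nonneg hx.2.1 hx.2.2
  have hfac : (0 : ℝ) < n ! := by exact_mod_cast n.factorial_pos
  have hqn : 0 ≤ q := by
    have h := integral_nonneg_of_ae hr0
    rw [hrint] at h
    exact nonneg_of_mul_nonneg_right h hfac
  refine ⟨hqn, ?_⟩
  calc _ = ∫⁻ x, ENNReal.ofReal (r x) := by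
        refine lintegral_congr_ae ?_
        filter_upwards [hpt] with x hx
        rw [← ENNReal.ofReal_mul hx.2.1, hx.1]
    _ = _ := by
        rw [← ofReal_integral_eq_lintegral_ofReal hri hr0, hrint, ENNReal.ofReal_mul hfac.le,
          ENNReal.ofReal_natCast]

/-- Adding an independent LUE matrix to a polynomial ensemble. -/
theorem IsPE.add_lue {Ω : Type*} [MeasurableSpace Ω] {P : Measure Ω} [IsProbabilityMeasure P]
    {α : ℝ} (hα : -1 < α) {X L : Ω → Herm n} (hX : Measurable X) (hL : Measurable L)
    (hXL : IndepFun X L P) {f : Fin n → ℝ → ℝ} (h : IsPE P X f)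
    (hint : ∀ k, ∀ᵐ y : ℝ, Integrable fun t => gammaKernel (α + n) (y - t) * f k t)
    (hLUE : Measure.map L P = lueLaw n α) :
    IsPE P (fun ω => X ω + L ω) fun k => lueTransform n α (f k) := by
  obtain ⟨hf, Z, hZ, hnn, hlaw⟩ := h
  have hg : ∀ k, Measurable (lueTransform n α (f k)) := fun k => measurable_lueTransform α (hf k)
  have hac : eigenvalueLaw P X ≪ volume := hlaw ▸ withDensity_absolutelyContinuous _ _
  set q := peDensity (Z * Real.Gamma (α + n) ^ n) fun k => lueTransform n α (f k) with hq
  have hqm : Measurable fun y => ENNReal.ofReal (q y) := (measurable_peDensity _ hg).ennreal_ofReal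
  have hpm : Measurable fun x => ENNReal.ofReal (peDensity Z f x) :=
    (measurable_peDensity Z hf).ennreal_ofReal
  have hqs : ∀ (σ : Equiv.Perm (Fin n)) y, q (y ∘ σ) = q y := fun σ y =>
    peDensity_comp_perm _ _ y σ
  have hint' : ∀ᵐ y : Fin n → ℝ, ∀ j k,
      Integrable fun t => gammaKernel (α + n) (y j - t) * f k t := by
    refine ae_all_iff.2 fun j => ae_all_iff.2 fun k => ?_
    exact (Measure.quasiMeasurePreserving_eval (fun _ : Fin n => (volume : Measure ℝ)) j).ae (hint k)
  have hkey : ∀ᵐ y : Fin n → ℝ, StrictMono y → 0 ≤ q y ∧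
      ∫⁻ x, ENNReal.ofReal (peDensity Z f x) * ENNReal.ofReal (chamberDensity (α + n) x y) =
        n ! * ENNReal.ofReal (q y) := by
    filter_upwards [hint'] with y hy hmono
    exact lintegral_peDensity_mul_chamberDensity hα hnn hmono hy
  refine ⟨hg, Z * Real.Gamma (α + n) ^ n, mul_ne_zero hZ (Gamma_pow_ne_zero hα n), ?_, ?_⟩
  · have hall : ∀ᵐ y : Fin n → ℝ, ∀ σ : Equiv.Perm (Fin n), StrictMono (y ∘ σ) → 0 ≤ q (y ∘ σ) :=
      ae_all_iff.2 fun σ => (measurePreserving_comp_perm σ).quasiMeasurePreserving.ae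
        (hkey.mono fun y hy hm => (hy hm).1)
    filter_upwards [hall, ae_injective] with y hy hyi
    rw [← hq, ← hqs (Tuple.sort y)]
    exact hy _ ((strictMono_comp_perm_iff hyi _).2 rfl)
  · refine Measure.ext_of_lintegral _ fun H hH => ?_
    have hψ := measurable_symmAvg hH
    have hT := measurable_lueTransition α hψ
    have hcd : Measurable fun p : (Fin n → ℝ) × (Fin n → ℝ) =>
        ENNReal.ofReal (chamberDensity (α + n) p.1 p.2) :=
      (measurable_chamberDensity (α + n)).ennreal_ofReal
    have hm3 : Measurable fun p : (Fin n → ℝ) × (Fin n → ℝ) => ENNReal.ofReal (peDensity Z f p.1) *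
        (ENNReal.ofReal (chamberDensity (α + n) p.1 p.2) * symmAvg H p.2) :=
      (hpm.comp measurable_fst).mul (hcd.mul (hψ.comp measurable_snd))
    have hsym : ∀ (σ : Equiv.Perm (Fin n)) y, ENNReal.ofReal (q (y ∘ σ)) * symmAvg H (y ∘ σ) =
        ENNReal.ofReal (q y) * symmAvg H y := fun σ y => by
      rw [hqs, symmAvg_comp_perm]
    calc _ = ∫⁻ x, ENNReal.ofReal (peDensity Z f x) * lueTransition α (symmAvg H) x := by
          rw [lintegral_eigenvalueLaw_add hα hX hL hXL hac hLUE hH, hlaw,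
            lintegral_withDensity_eq_lintegral_mul _ hpm hT]
          rfl
      _ = ∫⁻ x, ∫⁻ y in {y : Fin n → ℝ | StrictMono y}, ENNReal.ofReal (peDensity Z f x) *
            (ENNReal.ofReal (chamberDensity (α + n) x y) * symmAvg H y) := by
          refine lintegral_congr fun x => ?_
          have hx : Measurable fun y =>
              ENNReal.ofReal (chamberDensity (α + n) x y) * symmAvg H y :=
            (hcd.comp measurable_prodMk_left).mul hψ
          rw [lueTransition, lintegral_const_mul _ hx]
      _ = ∫⁻ y in {y : Fin n → ℝ | StrictMono y}, ∫⁻ x, ENNReal.ofReal (peDensity Z f x) *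
            (ENNReal.ofReal (chamberDensity (α + n) x y) * symmAvg H y) :=
          lintegral_lintegral_swap hm3.aemeasurable
      _ = ∫⁻ y in {y : Fin n → ℝ | StrictMono y},
            n ! * (ENNReal.ofReal (q y) * symmAvg H y) := by
          refine setLIntegral_congr_fun_ae measurableSet_strictMono ?_
          filter_upwards [hkey] with y hy hmono
          have hcx : Measurable fun x => ENNReal.ofReal (chamberDensity (α + n) x y) :=
            hcd.of_uncurry_right (f := fun x y => ENNReal.ofReal (chamberDensity (α + n) x y))
          have hx : Measurable fun x => ENNReal.ofReal (peDensity Z f x) *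
              ENNReal.ofReal (chamberDensity (α + n) x y) :=
            hpm.mul hcx
          simp only [← mul_assoc]
          rw [lintegral_mul_const _ hx, (hy hmono).2]
      _ = ∫⁻ y, ENNReal.ofReal (q y) * symmAvg H y := by
          have hm : Measurable fun y => ENNReal.ofReal (q y) * symmAvg H y := hqm.mul hψ
          rw [lintegral_const_mul _ hm, lintegral_eq_factorial_mul_chamber hm hsym]
      _ = ∫⁻ y, ENNReal.ofReal (q y) * H y :=
          lintegral_mul_symmAvg hqm hH fun σ y => by rw [hqs]
      _ = _ := by
          rw [lintegral_withDensity_eq_lintegral_mul _ hqm hH]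
          rfl

end Density

end PolyEns

end

theorem corollary3p2 {Ω : Type*} [MeasurableSpace Ω] (P : Measure Ω) [IsProbabilityMeasure P]
    (n : ℕ) (α : ℝ) (hα : -1 < α)
    (X L : Ω → PolyEns.Herm n) (hX : Measurable X) (hL : Measurable L)
    (hXL : IndepFun X L P)
    (f : Fin n → ℝ → ℝ)
    (hXinv : PolyEns.UnitarilyInvariant P X)
    (hXPE : PolyEns.IsPE P X f)
    (hLUE : Measure.map L P = PolyEns.lueLaw n α) :
    (∀ k, ∀ᵐ y : ℝ, IntegrableOn
      (fun x : ℝ => x ^ (α + n - 1) * Real.exp (-x) * f k (y - x)) (Set.Ioi 0)) ∧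
    PolyEns.IsPE P (fun ω => X ω + L ω) (fun k => PolyEns.lueTransform n α (f k)) := by
  have hpos : Fin n → 0 < α + n := fun k => by
    have hn : (1 : ℝ) ≤ n := by exact_mod_cast k.pos
    linarith
  have hint : ∀ k, ∀ᵐ y : ℝ, Integrable fun t => PolyEns.gammaKernel (α + n) (y - t) * f k t :=
    fun k => PolyEns.ae_integrable_gammaKernel_mul (hpos k) (hXPE.integrable hX k)
  exact ⟨fun k => (hint k).mono fun y hy => PolyEns.integrableOn_lueTransform (hpos k) hy,
    hXPE.add_lue hα hX hL hXL hint hLUE⟩
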